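/- Let $k$ be a field. All dg categories are small, over $k$, with differentials of degree $+1$; $|f|$ is the degree of a homogeneous morphism, and dg functors are strict. **Twisted tensor product.** For dg categories $C,D$, let $C\tilde\otimes D$ be the dg category with objects $\mathrm{Ob}(C)\times\mathrm{Ob}(D)$ generated by morphisms $f\otimes\mathrm{id}_y$ (for $f$ in $C$, $y\in D$), $\mathrm{id}_x\otimes g$ (for $x\in C$, $g$ in $D$), and, for $f\colon x_0\to x_1$ in $C$ and a chain $y_0\xrightarrow{g_1}y_1\to\cdots\xrightarrow{g_n}y_n$ in $D$, $n\ge 1$, by morphisms $\varepsilon(f;g_1,\dots,g_n)\colon(x_0,y_0)\to(x_1,y_n)$ of degree $|f|+\sum_j(|g_j|-1)$, subject to the following relations, where $\varepsilon(f;\,):=f\otimes\mathrm{id}_y$ for the empty chain at $y$: * $f\mapsto f\otimes\mathrm{id}_y$ and $g\mapsto\mathrm{id}_x\otimes g$ are dg functors $C\to C\tilde\otimes D$ and $D\to C\tilde\otimes D$; * $\varepsilon(f;g_1,\dots,g_n)$ is linear in each argument, and for $n\ge1$ it is $0$ if some $g_i$ is an identity or $f$ is an identity; * $\varepsilon(f_2f_1;g_1,\dots,g_N)=\sum_{m=0}^N(-1)^{|f_1|\sum_{j>m}(|g_j|-1)}\,\varepsilon(f_2;g_{m+1},\dots,g_N)\circ\varepsilon(f_1;g_1,\dots,g_m)$;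 * for $n\ge1$, $$\begin{aligned}d\,\varepsilon(f;g_1,\dots,g_n)={}&\varepsilon(df;g_1,\dots,g_n)-\sum_{j=1}^n(-1)^{|f|+\sum_{i>j}(|g_i|-1)}\varepsilon(f;g_1,\dots,dg_j,\dots,g_n)\\&-\sum_{i=1}^{n-1}(-1)^{|f|+\sum_{j>i}(|g_j|-1)}\varepsilon(f;g_1,\dots,g_{i+1}g_i,\dots,g_n)\\&-(-1)^{|f|(|g_n|-1)}(\mathrm{id}_{x_1}\otimes g_n)\circ\varepsilon(f;g_1,\dots,g_{n-1})\\&+(-1)^{|f|+\sum_{i\ge2}(|g_i|-1)}\varepsilon(f;g_2,\dots,g_n)\circ(\mathrm{id}_{x_0}\otimes g_1).\end{aligned}$$ Dg functors $F\colon C\to C'$, $G\colon D\to D'$ induce the dg functor $F\tilde\otimes G\colon C\tilde\otimes D\to C'\tilde\otimes D'$ which applies $F$ and $G$ to the objects and to the arguments of the generators. **Theorem.** For all dg categories $C,D,E$ there is a unique dg functor $$\alpha_{C,D,E}\colon(C\tilde\otimes D)\tilde\otimes E\to C\tilde\otimes(D\tilde\otimes E)$$ which is the identity $((x,y),z)\mapsto(x,(y,z))$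 on objects and which satisfies, for objects $x,y,z$ and homogeneous morphisms $f$, $g,g_i$, $h,h_i$ of $C$, $D$, $E$ respectively (chains composable, $m,N\ge1$): 1. $\alpha((f\otimes\mathrm{id}_y)\otimes\mathrm{id}_z)=f\otimes\mathrm{id}_{(y,z)}$, $\ \alpha((\mathrm{id}_x\otimes g)\otimes\mathrm{id}_z)=\mathrm{id}_x\otimes(g\otimes\mathrm{id}_z)$, $\ \alpha(\mathrm{id}_{(x,y)}\otimes h)=\mathrm{id}_x\otimes(\mathrm{id}_y\otimes h)$; 2. $\alpha(\varepsilon(f;g_1,\dots,g_m)\otimes\mathrm{id}_z)=\varepsilon(f;g_1\otimes\mathrm{id}_z,\dots,g_m\otimes\mathrm{id}_z)$; 3. $\alpha(\varepsilon(f\otimes\mathrm{id}_y;h_1,\dots,h_N))=\varepsilon(f;\mathrm{id}_y\otimes h_1,\dots,\mathrm{id}_y\otimes h_N)$ and $\alpha(\varepsilon(\mathrm{id}_x\otimes g;h_1,\dots,h_N))=\mathrm{id}_x\otimes\varepsilon(g;h_1,\dots,h_N)$; 4. $$\begin{aligned}&\alpha\big(\varepsilon(\varepsilon(f;g_1,\dots,g_m);h_1,\dots,h_N)\big)=\sum_{0\le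 i_1\le j_1\le i_2\le j_2\le\cdots\le i_m\le j_m\le N}(-1)^{\sum_{\ell=1}^m(|g_\ell|-1)\sum_{s>j_\ell}(|h_s|-1)}\\&\quad\varepsilon\big(f;h_1,\dots,h_{i_1},\varepsilon(g_1;h_{i_1+1},\dots,h_{j_1}),h_{j_1+1},\dots,h_{i_m},\varepsilon(g_m;h_{i_m+1},\dots,h_{j_m}),h_{j_m+1},\dots,h_N\big),\end{aligned}$$ where an $h_s$ standing alone means $\mathrm{id}\otimes h_s$, and $\varepsilon(g_\ell;\,)$ means $g_\ell\otimes\mathrm{id}$ when $i_\ell=j_\ell$. The functors $\alpha_{C,D,E}$ are natural in $C$, $D$ and $E$: for all dg functors $F\colon C\to C'$, $G\colon D\to D'$, $H\colon E\to E'$, $$\alpha_{C',D',E'}\circ\big((F\tilde\otimes G)\tilde\otimes H\big)=\big(F\tilde\otimes(G\tilde\otimes H)\big)\circ\alpha_{C,D,E}.$$ -/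

import Mathlib

universe u

/-- A (small) dg category over `k`, in cohomological grading: complexes of morphisms `Hom x y`,
given by their graded pieces `Hom x y n`, a bilinear composition of degree `0`, and a differential
of degree `1` which satisfies the graded Leibniz rule.  As usual, `comp h f g` is `f ∘ g`; the proof
`h : p + q = n` only records that the degrees add up. -/
structure DGCat (k : Type u) [CommRing k] where
  Obj : Type u
  Hom : Obj → Obj → ℤ → Type u
  [grp : ∀ x y n, AddCommGroup (Hom x y n)]
  [mod : ∀ x y n, Module k (Hom x y n)]
  idm : ∀ x, Hom x x 0
  comp : ∀ {x y z : Obj} {p q n : ℤ}, p + q = n →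
    (Hom y z p →ₗ[k] Hom x y q →ₗ[k] Hom x z n)
  d : ∀ {x y : Obj} {n : ℤ}, Hom x y n →ₗ[k] Hom x y (n + 1)
  idm_comp : ∀ {x y : Obj} {n : ℤ} (f : Hom x y n), comp (zero_add n) (idm y) f = f
  comp_idm : ∀ {x y : Obj} {n : ℤ} (f : Hom x y n), comp (add_zero n) f (idm x) = f
  assoc : ∀ {w x y z : Obj} {p q r pq qr n : ℤ} (h₁ : p + q = pq) (h₂ : pq + r = n)
    (h₃ : q + r = qr) (h₄ : p + qr = n) (f : Hom y z p) (g : Hom x y q) (e : Hom w x r),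
    comp h₂ (comp h₁ f g) e = comp h₄ f (comp h₃ g e)
  d_d : ∀ {x y : Obj} {n : ℤ} (f : Hom x y n), d (d f) = 0
  leibniz : ∀ {x y z : Obj} {p q n : ℤ} (h : p + q = n) (h₁ : (p + 1) + q = n + 1)
    (h₂ : p + (q + 1) = n + 1) (f : Hom y z p) (g : Hom x y q),
    d (comp h f g) = comp h₁ (d f) g + p.negOnePow • comp h₂ f (d g)

attribute [instance] DGCat.grp DGCat.mod

namespace DGCat

variable {k : Type u} [CommRing k]

/-- `DGFunctor C D φ` is the set of dg functors `C → D` which act on objects by `φ`. -/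
@[ext]
structure DGFunctor (C D : DGCat k) (φ : C.Obj → D.Obj) where
  map : ∀ {x y : C.Obj} {n : ℤ}, C.Hom x y n →ₗ[k] D.Hom (φ x) (φ y) n
  map_idm : ∀ x : C.Obj, map (C.idm x) = D.idm (φ x)
  map_comp : ∀ {x y z : C.Obj} {p q n : ℤ} (h : p + q = n) (f : C.Hom y z p) (g : C.Hom x y q),
    map (C.comp h f g) = D.comp h (map f) (map g)
  map_d : ∀ {x y : C.Obj} {n : ℤ} (f : C.Hom x y n), map (C.d f) = D.d (map f)

namespace DGFunctor

variable {C D : DGCat k} {φ : C.Obj → D.Obj}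

theorem map_units_smul (F : DGFunctor C D φ) {x y : C.Obj} {n : ℤ} (r : ℤˣ) (f : C.Hom x y n) :
    F.map (r • f) = r • F.map f := by
  rw [Units.smul_def, Units.smul_def]
  exact map_zsmul F.map (r : ℤ) f

theorem map_sum (F : DGFunctor C D φ) {x y : C.Obj} {n : ℤ} {ι : Type*} (l : List ι)
    (f : ι → C.Hom x y n) : F.map (l.map f).sum = (l.map fun i => F.map (f i)).sum := by
  rw [map_list_sum, List.map_map]
  rfl

end DGFunctor

/-- Chains `x = x₀ ⟶ x₁ ⟶ ⋯ ⟶ xₙ = y`, `n ≥ 0`, of composable homogeneous morphisms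
`g₁, …, gₙ` of a dg category.  The last morphism `gₙ` is the head: `cons h g r` is the chain `r`
followed by `g`.  The third index is the shifted degree `(|g₁| - 1) + ⋯ + (|gₙ| - 1)`. -/
inductive Chain (D : DGCat k) (x : D.Obj) : D.Obj → ℤ → Type u
  | nil {s : ℤ} (h : s = 0) : Chain D x x s
  | cons {y z : D.Obj} {q s t : ℤ} (h : (q - 1) + s = t) (g : D.Hom y z q)
      (r : Chain D x y s) : Chain D x z t

namespace Chain

variable {D E : DGCat k}

/-- The number `n` of morphisms of a chain. -/
def length {x : D.Obj} : {y : D.Obj} → {s : ℤ} → Chain D x y s → ℕ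
  | _, _, nil _ => 0
  | _, _, cons _ _ r => r.length + 1

/-- Change of the degree index along an equality. -/
def cast {s t : ℤ} (e : s = t) {x : D.Obj} : {y : D.Obj} → Chain D x y s → Chain D x y t
  | _, nil h => nil (e.symm.trans h)
  | _, cons h g r => cons (h.trans e) g r

/-- The image of a chain under a dg functor. -/
def map {φ : D.Obj → E.Obj} (F : DGFunctor D E φ) {x : D.Obj} :
    {y : D.Obj} → {s : ℤ} → Chain D x y s → Chain E (φ x) (φ y) s
  | _, _, nil h => nil h
  | _, _, cons h g r => cons h (F.map g) (r.map F)

/-- The concatenation: `append h c c'` is the chain `c'` followed by `c`. -/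
def append {x y : D.Obj} {b : ℤ} :
    {z : D.Obj} → {a s : ℤ} → a + b = s → Chain D y z a → Chain D x y b → Chain D x z s
  | _, _, _, h, nil h₀, c' => c'.cast (by omega)
  | _, _, _, h, cons (s := a') h₁ g r, c' =>
      cons (s := a' + b) (by omega) g (append rfl r c')

/-- A decomposition of a chain into an initial part `right` followed by a final part `left`. -/
@[ext]
structure Split (D : DGCat k) (x z : D.Obj) (s : ℤ) where
  mid : D.Obj
  a : ℤ
  b : ℤ
  left : Chain D mid z a
  right : Chain D x mid b
  h : a + b = s

/-- All `n + 1` decompositions of a chain of length `n`, namely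
`left = (gₘ₊₁, …, gₙ)`, `right = (g₁, …, gₘ)` for `0 ≤ m ≤ n`. -/
def splits {x : D.Obj} : {z : D.Obj} → {s : ℤ} → Chain D x z s → List (Split D x z s)
  | _, _, nil h => [⟨x, 0, 0, nil rfl, nil rfl, by omega⟩]
  | z, t, cons (q := q) h g r =>
      ⟨z, 0, t, nil rfl, cons h g r, by omega⟩ ::
        (splits r).map fun p =>
          ⟨p.mid, (q - 1) + p.a, p.b, cons rfl g p.left, p.right, by have := p.h; omega⟩

/-- The chains `(g₁, …, d gⱼ, …, gₙ)`, `1 ≤ j ≤ n`, each with the exponent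
`∑_{i > j} (|gᵢ| - 1)` of its Koszul sign. -/
def diffs {x : D.Obj} :
    {z : D.Obj} → {s : ℤ} → Chain D x z s → List (ℤ × Chain D x z (s + 1))
  | _, _, nil _ => []
  | _, _, cons (q := q) (s := s) h g r =>
      (0, cons (q := q + 1) (by omega) (D.d g) r) ::
        (diffs r).map fun w => ((q - 1) + w.1, cons (s := s + 1) (by omega) g w.2)

/-- For a chain `r = (g₁, …, gₙ₋₁)` and `g = gₙ`: the chain `(g₁, …, gₙ₋₂, gₙ ∘ gₙ₋₁)`
(no chain if `r` is empty). -/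
def mulHead {y z : D.Obj} {q : ℤ} (g : D.Hom y z q) {t : ℤ} {x : D.Obj} {s : ℤ} :
    (q - 1) + s = t → Chain D x y s → List (Chain D x z (t + 1))
  | _, nil _ => []
  | h, cons (q := q') h₁ g' r =>
      [cons (q := q + q') (by omega) (D.comp rfl g g') r]

/-- The chains `(g₁, …, gᵢ₊₁ ∘ gᵢ, …, gₙ)`, `1 ≤ i ≤ n - 1`, each with the exponent
`∑_{j ≥ i + 1} (|gⱼ| - 1)` of its Koszul sign. -/
def mults {x : D.Obj} :
    {z : D.Obj} → {s : ℤ} → Chain D x z s → List (ℤ × Chain D x z (s + 1))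
  | _, _, nil _ => []
  | _, _, cons (q := q) (s := s) h g r =>
      ((mulHead g h r).map fun c => (q - 1, c)) ++
        (mults r).map fun w => ((q - 1) + w.1, cons (s := s + 1) (by omega) g w.2)

/-- A chain written as a chain `rest` followed by one morphism `last`. -/
structure Uncons (D : DGCat k) (x z : D.Obj) (s : ℤ) where
  mid : D.Obj
  q : ℤ
  a : ℤ
  last : D.Hom mid z q
  rest : Chain D x mid a
  h : (q - 1) + a = s

/-- The decomposition of a non-empty chain into `gₙ` and `(g₁, …, gₙ₋₁)`, as a list with one
member; the empty list for the empty chain. -/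
def uncons {x : D.Obj} :
    {z : D.Obj} → {s : ℤ} → Chain D x z s → List (Uncons D x z s)
  | _, _, nil _ => []
  | _, _, cons h g r => [⟨_, _, _, g, r, h⟩]

/-- A chain written as one morphism `first` followed by a chain `rest`. -/
structure Unsnoc (D : DGCat k) (x z : D.Obj) (s : ℤ) where
  mid : D.Obj
  a : ℤ
  q : ℤ
  rest : Chain D mid z a
  first : D.Hom x mid q
  h : a + (q - 1) = s

/-- Helper for `unsnoc`: the decomposition of the chain consisting of `g` and the chain `r`, if
`r` is empty. -/
def unsnocHead {y z : D.Obj} {q : ℤ} (g : D.Hom y z q) {t : ℤ} {x : D.Obj} {s : ℤ} :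
    (q - 1) + s = t → Chain D x y s → List (Unsnoc D x z t)
  | h, nil h₀ => [⟨z, 0, q, nil rfl, g, by omega⟩]
  | _, cons _ _ _ => []

/-- The decomposition of a non-empty chain into `(g₂, …, gₙ)` and `g₁`, as a list with one
member; the empty list for the empty chain. -/
def unsnoc {x : D.Obj} :
    {z : D.Obj} → {s : ℤ} → Chain D x z s → List (Unsnoc D x z s)
  | _, _, nil _ => []
  | _, _, cons (q := q) h g r =>
      unsnocHead g h r ++
        (unsnoc r).map fun w =>
          ⟨w.mid, (q - 1) + w.a, w.q, cons rfl g w.rest, w.first, by have := w.h; omega⟩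

/-- Some morphism of the chain is an identity. -/
inductive HasId : {x y : D.Obj} → {s : ℤ} → Chain D x y s → Prop
  | here {x y : D.Obj} {s t : ℤ} (h : (0 - 1) + s = t) (r : Chain D x y s) :
      HasId (cons h (D.idm y) r)
  | there {x y z : D.Obj} {q s t : ℤ} (h : (q - 1) + s = t) (g : D.Hom y z q)
      {r : Chain D x y s} : HasId r → HasId (cons h g r)

/-- `IsAdd c c₁ c₂`: the three chains agree except in one place, where the morphism of `c` is the
sum of those of `c₁` and `c₂`. -/
inductive IsAdd : {x y : D.Obj} → {s : ℤ} → Chain D x y s → Chain D x y s → Chain D x y s → Prop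
  | here {x y z : D.Obj} {q s t : ℤ} (h : (q - 1) + s = t) (g₁ g₂ : D.Hom y z q)
      (r : Chain D x y s) : IsAdd (cons h (g₁ + g₂) r) (cons h g₁ r) (cons h g₂ r)
  | there {x y z : D.Obj} {q s t : ℤ} (h : (q - 1) + s = t) (g : D.Hom y z q)
      {r r₁ r₂ : Chain D x y s} :
      IsAdd r r₁ r₂ → IsAdd (cons h g r) (cons h g r₁) (cons h g r₂)

/-- `IsSMul a c c₁`: the two chains agree except in one place, where the morphism of `c` is `a`
times that of `c₁`. -/
inductive IsSMul (a : k) : {x y : D.Obj} → {s : ℤ} → Chain D x y s → Chain D x y s → Prop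
  | here {x y z : D.Obj} {q s t : ℤ} (h : (q - 1) + s = t) (g : D.Hom y z q)
      (r : Chain D x y s) : IsSMul a (cons h (a • g) r) (cons h g r)
  | there {x y z : D.Obj} {q s t : ℤ} (h : (q - 1) + s = t) (g : D.Hom y z q)
      {r r₁ : Chain D x y s} : IsSMul a r r₁ → IsSMul a (cons h g r) (cons h g r₁)

end Chain

/-- The generators and relations of the twisted tensor product of `C` and `D`, in a dg category
`T`: morphisms `f ⊗ id_y` (`left`), `id_x ⊗ g` (`right`) and `ε(f; g₁, …, gₙ)` (`eps`) of degree
`|f| + ∑ (|gⱼ| - 1)` between the objects `obj x y`, such that `f ↦ f ⊗ id_y` and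
`g ↦ id_x ⊗ g` are dg functors and all relations on the `ε(f; g₁, …, gₙ)` hold.  By convention
`ε(f; ) = f ⊗ id_y` for the empty chain. -/
structure TwistedData (C D T : DGCat k) where
  obj : C.Obj → D.Obj → T.Obj
  left : ∀ y : D.Obj, DGFunctor C T (fun x => obj x y)
  right : ∀ x : C.Obj, DGFunctor D T (fun y => obj x y)
  eps : ∀ {x x' : C.Obj} {y y' : D.Obj} {p s n : ℤ}, p + s = n → C.Hom x x' p →
    Chain D y y' s → T.Hom (obj x y) (obj x' y') n
  /-- The convention for the empty chain. -/
  eps_nil : ∀ {x x' : C.Obj} {p s : ℤ} (y : D.Obj) (h : p + s = p) (hs : s = 0)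
    (f : C.Hom x x' p), eps h f (.nil (x := y) hs) = (left y).map f
  /-- Linearity in each argument. -/
  eps_add : ∀ {x x' : C.Obj} {y y' : D.Obj} {p s n : ℤ} (h : p + s = n) (f f' : C.Hom x x' p)
    (c : Chain D y y' s), eps h (f + f') c = eps h f c + eps h f' c
  eps_smul : ∀ {x x' : C.Obj} {y y' : D.Obj} {p s n : ℤ} (h : p + s = n) (a : k)
    (f : C.Hom x x' p) (c : Chain D y y' s), eps h (a • f) c = a • eps h f c
  eps_isAdd : ∀ {x x' : C.Obj} {y y' : D.Obj} {p s n : ℤ} (h : p + s = n) (f : C.Hom x x' p)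
    (c c₁ c₂ : Chain D y y' s), c.IsAdd c₁ c₂ → eps h f c = eps h f c₁ + eps h f c₂
  eps_isSMul : ∀ {x x' : C.Obj} {y y' : D.Obj} {p s n : ℤ} (h : p + s = n) (f : C.Hom x x' p)
    (a : k) (c c₁ : Chain D y y' s), c.IsSMul a c₁ → eps h f c = a • eps h f c₁
  /-- `ε(f; g₁, …, gₙ) = 0` if some `gᵢ` is an identity. -/
  eps_hasId : ∀ {x x' : C.Obj} {y y' : D.Obj} {p s n : ℤ} (h : p + s = n) (f : C.Hom x x' p)
    (c : Chain D y y' s), c.HasId → eps h f c = 0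
  /-- `ε(id; g₁, …, gₙ) = 0` for `n ≥ 1`. -/
  eps_idm : ∀ {y y' : D.Obj} {s n : ℤ} (x : C.Obj) (h : 0 + s = n)
    (c : Chain D y y' s), 1 ≤ c.length → eps h (C.idm x) c = 0
  /-- `ε(f₂ f₁; g₁, …, g_N) =
  ∑ₘ (-1)^{|f₁| ∑_{j > m} (|gⱼ| - 1)} ε(f₂; gₘ₊₁, …, g_N) ∘ ε(f₁; g₁, …, gₘ)`. -/
  eps_comp : ∀ {x x' x'' : C.Obj} {y y' : D.Obj} {p₂ p₁ p s n : ℤ} (hp : p₂ + p₁ = p)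
    (h : p + s = n) (f₂ : C.Hom x' x'' p₂) (f₁ : C.Hom x x' p₁) (c : Chain D y y' s),
    eps h (C.comp hp f₂ f₁) c =
      (c.splits.map fun w => (p₁ * w.a).negOnePow •
        T.comp (p := p₂ + w.a) (q := p₁ + w.b) (by have := w.h; omega)
          (eps rfl f₂ w.left) (eps rfl f₁ w.right)).sum
  /-- `d ε(f; g₁, …, gₙ)` equals `ε(df; g₁, …, gₙ)`
  `- ∑ⱼ (-1)^{|f| + ∑_{i > j} (|gᵢ| - 1)} ε(f; g₁, …, dgⱼ, …, gₙ)`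
  `- ∑ᵢ (-1)^{|f| + ∑_{j > i} (|gⱼ| - 1)} ε(f; g₁, …, gᵢ₊₁ gᵢ, …, gₙ)`
  `- (-1)^{|f| (|gₙ| - 1)} (id ⊗ gₙ) ∘ ε(f; g₁, …, gₙ₋₁)`
  `+ (-1)^{|f| + ∑_{i ≥ 2} (|gᵢ| - 1)} ε(f; g₂, …, gₙ) ∘ (id ⊗ g₁)`, for `n ≥ 1`
  (for `n = 0`, all terms but the first one are absent). -/
  d_eps : ∀ {x x' : C.Obj} {y y' : D.Obj} {p s n : ℤ} (h : p + s = n) (f : C.Hom x x' p)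
    (c : Chain D y y' s),
    T.d (eps h f c) =
      eps (by omega) (C.d f) c
      - (c.diffs.map fun w => (p + w.1).negOnePow • eps (n := n + 1) (by omega) f w.2).sum
      - (c.mults.map fun w => (p + w.1).negOnePow • eps (n := n + 1) (by omega) f w.2).sum
      - (c.uncons.map fun w => (p * (w.q - 1)).negOnePow •
          T.comp (p := w.q) (q := p + w.a) (n := n + 1) (by have := w.h; omega)
            ((right x').map w.last) (eps rfl f w.rest)).sum
      + (c.unsnoc.map fun w => (p + w.a).negOnePow •
          T.comp (p := p + w.a) (q := w.q) (n := n + 1) (by have := w.h; omega)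
            (eps rfl f w.rest) ((right x).map w.first)).sum

/-- Formal expressions in the generators of the twisted tensor product, built with the operations
of a dg category. -/
inductive Expr (C D : DGCat k) : C.Obj × D.Obj → C.Obj × D.Obj → ℤ → Type u
  | zero (X Y : C.Obj × D.Obj) (n : ℤ) : Expr C D X Y n
  | add {X Y : C.Obj × D.Obj} {n : ℤ} (e e' : Expr C D X Y n) : Expr C D X Y n
  | smul {X Y : C.Obj × D.Obj} {n : ℤ} (a : k) (e : Expr C D X Y n) : Expr C D X Y n
  | idm (X : C.Obj × D.Obj) : Expr C D X X 0
  | comp {X Y Z : C.Obj × D.Obj} {p q n : ℤ} (h : p + q = n) (e : Expr C D Y Z p)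
      (e' : Expr C D X Y q) : Expr C D X Z n
  | d {X Y : C.Obj × D.Obj} {n : ℤ} (e : Expr C D X Y n) : Expr C D X Y (n + 1)
  | left (y : D.Obj) {x x' : C.Obj} {p : ℤ} (f : C.Hom x x' p) : Expr C D (x, y) (x', y) p
  | right (x : C.Obj) {y y' : D.Obj} {q : ℤ} (g : D.Hom y y' q) : Expr C D (x, y) (x, y') q
  | eps {x x' : C.Obj} {y y' : D.Obj} {p s n : ℤ} (h : p + s = n) (f : C.Hom x x' p)
      (c : Chain D y y' s) : Expr C D (x, y) (x', y') n

variable {C D T : DGCat k}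

/-- The value of a formal expression. -/
def TwistedData.eval (M : TwistedData C D T) :
    {X Y : C.Obj × D.Obj} → {n : ℤ} → Expr C D X Y n → T.Hom (M.obj X.1 X.2) (M.obj Y.1 Y.2) n
  | _, _, _, .zero _ _ _ => 0
  | _, _, _, .add e e' => M.eval e + M.eval e'
  | _, _, _, .smul a e => a • M.eval e
  | _, _, _, .idm X => T.idm (M.obj X.1 X.2)
  | _, _, _, .comp h e e' => T.comp h (M.eval e) (M.eval e')
  | _, _, _, .d e => T.d (M.eval e)
  | _, _, _, .left y f => (M.left y).map f
  | _, _, _, .right x g => (M.right x).map g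
  | _, _, _, .eps h f c => M.eps h f c

/-- Two expressions are identified if and only if their values agree in every dg category with
generators subject to the relations, that is, if and only if they are related by the smallest
dg congruence which contains the relations. -/
def Expr.setoid (C D : DGCat k) (X Y : C.Obj × D.Obj) (n : ℤ) : Setoid (Expr C D X Y n) where
  r e e' := ∀ (T : DGCat k) (M : TwistedData C D T), M.eval e = M.eval e'
  iseqv := ⟨fun _ _ _ => rfl, fun h T M => (h T M).symm, fun h h' T M => (h T M).trans (h' T M)⟩

/-- The morphisms of degree `n` of the twisted tensor product. -/
def TwHom (C D : DGCat k) (X Y : C.Obj × D.Obj) (n : ℤ) : Type u :=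
  Quotient (Expr.setoid C D X Y n)

namespace TwHom

variable {X Y Z : C.Obj × D.Obj} {n p q : ℤ}

/-- The class of an expression. -/
def mk (e : Expr C D X Y n) : TwHom C D X Y n := Quotient.mk _ e

/-- The value of a morphism in a dg category with generators subject to the relations. -/
def eval (M : TwistedData C D T) (a : TwHom C D X Y n) : T.Hom (M.obj X.1 X.2) (M.obj Y.1 Y.2) n :=
  Quotient.lift (fun e => M.eval e)
    (fun _ _ (h : ∀ (T : DGCat k) (M : TwistedData C D T), M.eval _ = M.eval _) => h T M) a

@[simp] theorem eval_mk (M : TwistedData C D T) (e : Expr C D X Y n) :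
    eval M (mk e) = M.eval e := rfl

theorem ext_eval {a b : TwHom C D X Y n}
    (h : ∀ (T : DGCat k) (M : TwistedData C D T), eval M a = eval M b) : a = b := by
  induction a using Quotient.inductionOn with | _ e =>
  induction b using Quotient.inductionOn with | _ e' =>
  exact Quotient.sound h

instance : Zero (TwHom C D X Y n) := ⟨mk (.zero X Y n)⟩

instance : Add (TwHom C D X Y n) :=
  ⟨Quotient.map₂ Expr.add fun _ _ h _ _ h' T M => congrArg₂ (· + ·) (h T M) (h' T M)⟩

/-- Scalar multiplication. -/
def smul (a : k) : TwHom C D X Y n → TwHom C D X Y n :=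
  Quotient.map (Expr.smul a) fun _ _ h T M => congrArg (fun b => a • b) (h T M)

instance : SMul k (TwHom C D X Y n) := ⟨smul⟩

instance : Neg (TwHom C D X Y n) := ⟨fun a => (-1 : k) • a⟩

/-- Composition. -/
def comp (h : p + q = n) : TwHom C D Y Z p → TwHom C D X Y q → TwHom C D X Z n :=
  Quotient.map₂ (Expr.comp h) fun _ _ h₁ _ _ h₂ T M =>
    congrArg₂ (fun a b => T.comp h a b) (h₁ T M) (h₂ T M)

/-- The differential. -/
def d : TwHom C D X Y n → TwHom C D X Y (n + 1) :=
  Quotient.map Expr.d fun _ _ h T M => congrArg (fun a => T.d a) (h T M)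

@[simp] theorem eval_zero (M : TwistedData C D T) : eval M (0 : TwHom C D X Y n) = 0 := rfl

@[simp] theorem eval_add (M : TwistedData C D T) (a b : TwHom C D X Y n) :
    eval M (a + b) = eval M a + eval M b := by
  induction a using Quotient.inductionOn
  induction b using Quotient.inductionOn
  rfl

@[simp] theorem eval_smul (M : TwistedData C D T) (r : k) (a : TwHom C D X Y n) :
    eval M (r • a) = r • eval M a := by
  induction a using Quotient.inductionOn
  rfl

@[simp] theorem eval_neg (M : TwistedData C D T) (a : TwHom C D X Y n) :
    eval M (-a) = -eval M a :=
  (eval_smul M (-1) a).trans (neg_one_smul k _)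

@[simp] theorem eval_comp (M : TwistedData C D T) (h : p + q = n) (a : TwHom C D Y Z p)
    (b : TwHom C D X Y q) : eval M (comp h a b) = T.comp h (eval M a) (eval M b) := by
  induction a using Quotient.inductionOn
  induction b using Quotient.inductionOn
  rfl

@[simp] theorem eval_d (M : TwistedData C D T) (a : TwHom C D X Y n) :
    eval M (d a) = T.d (eval M a) := by
  induction a using Quotient.inductionOn
  rfl

instance : AddCommGroup (TwHom C D X Y n) where
  add_assoc a b c := ext_eval fun T M => by simp [add_assoc]
  zero_add a := ext_eval fun T M => by simp
  add_zero a := ext_eval fun T M => by simp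
  add_comm a b := ext_eval fun T M => by simp [add_comm]
  neg_add_cancel a := ext_eval fun T M => by simp
  nsmul := nsmulRec
  zsmul := zsmulRec

instance : Module k (TwHom C D X Y n) where
  one_smul a := ext_eval fun T M => by simp
  mul_smul r s a := ext_eval fun T M => by simp [mul_smul]
  smul_zero r := ext_eval fun T M => by simp
  smul_add r a b := ext_eval fun T M => by simp
  add_smul r s a := ext_eval fun T M => by simp [add_smul]
  zero_smul a := ext_eval fun T M => by simp

/-- The value, as a linear map. -/
def evalₗ (M : TwistedData C D T) : TwHom C D X Y n →ₗ[k] T.Hom (M.obj X.1 X.2) (M.obj Y.1 Y.2) n where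
  toFun := eval M
  map_add' := eval_add M
  map_smul' := eval_smul M

theorem eval_units_smul (M : TwistedData C D T) (r : ℤˣ) (a : TwHom C D X Y n) :
    eval M (r • a) = r • eval M a := by
  rw [Units.smul_def, Units.smul_def]
  exact map_zsmul (evalₗ M) (r : ℤ) a

end TwHom

/-- The twisted tensor product `C ⊗̃ D`: the dg category with objects `Ob C × Ob D` generated by
the morphisms `f ⊗ id_y`, `id_x ⊗ g` and `ε(f; g₁, …, gₙ)` subject to the relations listed in
`TwistedData`. -/
def Tw (C D : DGCat k) : DGCat k where
  Obj := C.Obj × D.Obj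
  Hom := TwHom C D
  idm X := TwHom.mk (.idm X)
  comp h := LinearMap.mk₂ k (TwHom.comp h)
    (fun _ _ _ => TwHom.ext_eval fun T M => by simp)
    (fun _ _ _ => TwHom.ext_eval fun T M => by simp)
    (fun _ _ _ => TwHom.ext_eval fun T M => by simp)
    (fun _ _ _ => TwHom.ext_eval fun T M => by simp)
  d :=
    { toFun := TwHom.d
      map_add' := fun _ _ => TwHom.ext_eval fun T M => by simp
      map_smul' := fun _ _ => TwHom.ext_eval fun T M => by simp }
  idm_comp f := TwHom.ext_eval fun T M => by
    simpa [TwistedData.eval] using T.idm_comp (TwHom.eval M f)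
  comp_idm f := TwHom.ext_eval fun T M => by
    simpa [TwistedData.eval] using T.comp_idm (TwHom.eval M f)
  assoc h₁ h₂ h₃ h₄ f g e := TwHom.ext_eval fun T M => by
    simpa using T.assoc h₁ h₂ h₃ h₄ (TwHom.eval M f) (TwHom.eval M g) (TwHom.eval M e)
  d_d f := TwHom.ext_eval fun T M => by
    simpa using T.d_d (TwHom.eval M f)
  leibniz h h₁ h₂ f g := TwHom.ext_eval fun T M => by
    simpa [TwHom.eval_units_smul] using T.leibniz h h₁ h₂ (TwHom.eval M f) (TwHom.eval M g)

namespace Tw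

/-- The object `(x, y)` of `C ⊗̃ D`. -/
def pair (x : C.Obj) (y : D.Obj) : (Tw C D).Obj := (x, y)

/-- The map on the objects of `C ⊗̃ D` given by a function of two variables. -/
def onObj {S : Type u} (φ : C.Obj → D.Obj → S) (X : (Tw C D).Obj) : S := φ X.1 X.2

/-- The morphism of `C ⊗̃ D` given by an expression. -/
def mk {x x' : C.Obj} {y y' : D.Obj} {n : ℤ} (e : Expr C D (x, y) (x', y') n) :
    (Tw C D).Hom (pair x y) (pair x' y') n := TwHom.mk e

/-- The dg functor out of `C ⊗̃ D` determined by the images of the generators. -/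
def desc (M : TwistedData C D T) : DGFunctor (Tw C D) T (onObj M.obj) where
  map := TwHom.evalₗ M
  map_idm _ := rfl
  map_comp h f g := TwHom.eval_comp M h f g
  map_d f := TwHom.eval_d M f

theorem ext_desc {X Y : (Tw C D).Obj} {n : ℤ} {a b : (Tw C D).Hom X Y n}
    (h : ∀ (T : DGCat k) (M : TwistedData C D T), (desc M).map a = (desc M).map b) : a = b :=
  TwHom.ext_eval h

/-- The generators `f ⊗ id_y`, `id_x ⊗ g` and `ε(f; g₁, …, gₙ)` of `C ⊗̃ D`. -/
def gens (C D : DGCat k) : TwistedData C D (Tw C D) where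
  obj := pair
  left y :=
    { map :=
        { toFun := fun f => mk (.left y f)
          map_add' := fun f f' => ext_desc fun T M => by
            rw [map_add]; exact map_add (M.left y).map f f'
          map_smul' := fun a f => ext_desc fun T M => by
            rw [map_smul]; exact map_smul (M.left y).map a f }
      map_idm := fun x => ext_desc fun T M => (M.left y).map_idm x
      map_comp := fun h f g => ext_desc fun T M => (M.left y).map_comp h f g
      map_d := fun f => ext_desc fun T M => (M.left y).map_d f }
  right x :=
    { map :=
        { toFun := fun g => mk (.right x g)
          map_add' := fun f f' => ext_desc fun T M => by
            rw [map_add]; exact map_add (M.right x).map f f'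
          map_smul' := fun a f => ext_desc fun T M => by
            rw [map_smul]; exact map_smul (M.right x).map a f }
      map_idm := fun y => ext_desc fun T M => (M.right x).map_idm y
      map_comp := fun h f g => ext_desc fun T M => (M.right x).map_comp h f g
      map_d := fun f => ext_desc fun T M => (M.right x).map_d f }
  eps h f c := mk (.eps h f c)
  eps_nil y h hs f := ext_desc fun T M => M.eps_nil y h hs f
  eps_add h f f' c := ext_desc fun T M => by
    rw [map_add]; exact M.eps_add h f f' c
  eps_smul h a f c := ext_desc fun T M => by
    rw [map_smul]; exact M.eps_smul h a f c
  eps_isAdd h f c c₁ c₂ H := ext_desc fun T M => by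
    rw [map_add]; exact M.eps_isAdd h f c c₁ c₂ H
  eps_isSMul h f a c c₁ H := ext_desc fun T M => by
    rw [map_smul]; exact M.eps_isSMul h f a c c₁ H
  eps_hasId h f c H := ext_desc fun T M => by
    rw [map_zero]; exact M.eps_hasId h f c H
  eps_idm x h c H := ext_desc fun T M => by
    rw [map_zero]; exact M.eps_idm x h c H
  eps_comp hp h f₂ f₁ c := ext_desc fun T M => by
    rw [DGFunctor.map_sum]
    simp only [DGFunctor.map_units_smul, DGFunctor.map_comp]
    exact M.eps_comp hp h f₂ f₁ c
  d_eps h f c := ext_desc fun T M => by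
    rw [map_add, map_sub, map_sub, map_sub]
    simp only [DGFunctor.map_sum, DGFunctor.map_units_smul, DGFunctor.map_comp, DGFunctor.map_d]
    exact M.d_eps h f c

/-- The universal property of `C ⊗̃ D`: a dg functor out of it is determined by its values on the
generators. -/
theorem desc_unique (M : TwistedData C D T) (F : DGFunctor (Tw C D) T (onObj M.obj))
    (hl : ∀ {x x' : C.Obj} {n : ℤ} (y : D.Obj) (f : C.Hom x x' n),
      F.map (((gens C D).left y).map f) = (M.left y).map f)
    (hr : ∀ {y y' : D.Obj} {n : ℤ} (x : C.Obj) (g : D.Hom y y' n),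
      F.map (((gens C D).right x).map g) = (M.right x).map g)
    (he : ∀ {x x' : C.Obj} {y y' : D.Obj} {p s n : ℤ} (h : p + s = n) (f : C.Hom x x' p)
      (c : Chain D y y' s), F.map ((gens C D).eps h f c) = M.eps h f c) :
    F = desc M := by
  have key : ∀ {X Y : C.Obj × D.Obj} {n : ℤ} (e : Expr C D X Y n),
      F.map (x := X) (y := Y) (TwHom.mk e) = M.eval e := by
    intro X Y n e
    induction e with
    | zero X Y n =>
        have h0 : ∀ X Y : (Tw C D).Obj, F.map (0 : (Tw C D).Hom X Y n) = 0 :=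
          fun _ _ => map_zero F.map
        exact h0 X Y
    | add e e' h h' => exact (map_add F.map _ _).trans (congrArg₂ (· + ·) h h')
    | smul a e h => exact (map_smul F.map a _).trans (congrArg (fun b => a • b) h)
    | idm X => exact F.map_idm X
    | comp hh e e' h h' =>
        exact (F.map_comp hh _ _).trans (congrArg₂ (fun a b => T.comp hh a b) h h')
    | d e h => exact (F.map_d _).trans (congrArg (fun a => T.d a) h)
    | left y f => exact hl y f
    | right x g => exact hr x g
    | eps h f c => exact he h f c
  ext X Y n a
  induction a using Quotient.inductionOn with | _ e =>
  exact key e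

end Tw

namespace Chain

variable {D E : DGCat k} {φ : D.Obj → E.Obj} (F : DGFunctor D E φ)

theorem length_map {x y : D.Obj} {s : ℤ} (c : Chain D x y s) :
    (c.map F).length = c.length := by
  induction c with
  | nil h => rfl
  | cons h g r ih => exact congrArg (· + 1) ih

theorem HasId.map {x y : D.Obj} {s : ℤ} {c : Chain D x y s} (h : c.HasId) :
    (c.map F).HasId := by
  induction h with
  | here h r =>
      rw [Chain.map, F.map_idm]
      exact .here h _
  | there h g _ ih => exact .there h _ ih

theorem IsAdd.map {x y : D.Obj} {s : ℤ} {c c₁ c₂ : Chain D x y s} (h : c.IsAdd c₁ c₂) :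
    (c.map F).IsAdd (c₁.map F) (c₂.map F) := by
  induction h with
  | here h g₁ g₂ r =>
      rw [Chain.map, map_add]
      exact .here h _ _ _
  | there h g _ ih => exact .there h _ ih

theorem IsSMul.map {a : k} {x y : D.Obj} {s : ℤ} {c c₁ : Chain D x y s} (h : c.IsSMul a c₁) :
    (c.map F).IsSMul a (c₁.map F) := by
  induction h with
  | here h g r =>
      rw [Chain.map, map_smul]
      exact .here h _ _
  | there h g _ ih => exact .there h _ ih

/-- The image of a decomposition under a dg functor. -/
def Split.map {x z : D.Obj} {s : ℤ} (w : Split D x z s) : Split E (φ x) (φ z) s :=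
  ⟨φ w.mid, w.a, w.b, w.left.map F, w.right.map F, w.h⟩

theorem splits_map {x y : D.Obj} {s : ℤ} (c : Chain D x y s) :
    (c.map F).splits = c.splits.map (Split.map F) := by
  induction c with
  | nil h => rfl
  | cons h g r ih =>
      simp only [Chain.map, splits, ih, List.map_cons, List.map_map]
      rfl

theorem diffs_map {x y : D.Obj} {s : ℤ} (c : Chain D x y s) :
    (c.map F).diffs = c.diffs.map fun w => (w.1, w.2.map F) := by
  induction c with
  | nil h => rfl
  | cons h g r ih =>
      simp only [Chain.map, diffs, ih, List.map_cons, List.map_map, F.map_d]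
      rfl

theorem mulHead_map {y z : D.Obj} {q : ℤ} (g : D.Hom y z q) {t : ℤ} {x : D.Obj} {s : ℤ}
    (h : (q - 1) + s = t) (c : Chain D x y s) :
    mulHead (F.map g) h (c.map F) = (mulHead g h c).map fun c => c.map F := by
  cases c with
  | nil h₀ => rfl
  | cons h₁ g' r => simp [Chain.map, mulHead, F.map_comp]

theorem mults_map {x y : D.Obj} {s : ℤ} (c : Chain D x y s) :
    (c.map F).mults = c.mults.map fun w => (w.1, w.2.map F) := by
  induction c with
  | nil h => rfl
  | cons h g r ih =>
      simp only [Chain.map, mults, ih, mulHead_map, List.map_append, List.map_map]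
      rfl

/-- The image of a decomposition under a dg functor. -/
def Uncons.map {x z : D.Obj} {s : ℤ} (w : Uncons D x z s) : Uncons E (φ x) (φ z) s :=
  ⟨φ w.mid, w.q, w.a, F.map w.last, w.rest.map F, w.h⟩

theorem uncons_map {x y : D.Obj} {s : ℤ} (c : Chain D x y s) :
    (c.map F).uncons = c.uncons.map (Uncons.map F) := by
  cases c <;> rfl

/-- The image of a decomposition under a dg functor. -/
def Unsnoc.map {x z : D.Obj} {s : ℤ} (w : Unsnoc D x z s) : Unsnoc E (φ x) (φ z) s :=
  ⟨φ w.mid, w.a, w.q, w.rest.map F, F.map w.first, w.h⟩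

theorem unsnocHead_map {y z : D.Obj} {q : ℤ} (g : D.Hom y z q) {t : ℤ} {x : D.Obj} {s : ℤ}
    (h : (q - 1) + s = t) (c : Chain D x y s) :
    unsnocHead (F.map g) h (c.map F) = (unsnocHead g h c).map (Unsnoc.map F) := by
  cases c <;> rfl

theorem unsnoc_map {x y : D.Obj} {s : ℤ} (c : Chain D x y s) :
    (c.map F).unsnoc = c.unsnoc.map (Unsnoc.map F) := by
  induction c with
  | nil h => rfl
  | cons h g r ih =>
      simp only [Chain.map, unsnoc, ih, unsnocHead_map, List.map_append, List.map_map]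
      rfl

end Chain

/-- Restriction along dg functors of generators that satisfy the relations. -/
def TwistedData.comap {C C' D D' T : DGCat k} {φ : C.Obj → C'.Obj} {ψ : D.Obj → D'.Obj}
    (M : TwistedData C' D' T) (F : DGFunctor C C' φ) (G : DGFunctor D D' ψ) :
    TwistedData C D T where
  obj x y := M.obj (φ x) (ψ y)
  left y :=
    { map := (M.left (ψ y)).map ∘ₗ F.map
      map_idm := fun x => by simp [F.map_idm, (M.left (ψ y)).map_idm]
      map_comp := fun h f g => by simp [F.map_comp, (M.left (ψ y)).map_comp]
      map_d := fun f => by simp [F.map_d, (M.left (ψ y)).map_d] }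
  right x :=
    { map := (M.right (φ x)).map ∘ₗ G.map
      map_idm := fun x => by simp [G.map_idm, (M.right _).map_idm]
      map_comp := fun h f g => by simp [G.map_comp, (M.right _).map_comp]
      map_d := fun f => by simp [G.map_d, (M.right _).map_d] }
  eps h f c := M.eps h (F.map f) (c.map G)
  eps_nil y h hs f := M.eps_nil (ψ y) h hs (F.map f)
  eps_add h f f' c := by rw [map_add]; exact M.eps_add h _ _ _
  eps_smul h a f c := by rw [map_smul]; exact M.eps_smul h _ _ _
  eps_isAdd h f c c₁ c₂ H := M.eps_isAdd h _ _ _ _ (H.map G)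
  eps_isSMul h f a c c₁ H := M.eps_isSMul h _ _ _ _ (H.map G)
  eps_hasId h f c H := M.eps_hasId h _ _ (H.map G)
  eps_idm x h c H := by
    rw [F.map_idm]; exact M.eps_idm (φ x) h _ (by rwa [Chain.length_map])
  eps_comp hp h f₂ f₁ c := by
    rw [F.map_comp, M.eps_comp, Chain.splits_map, List.map_map]
    rfl
  d_eps h f c := by
    rw [M.d_eps, Chain.diffs_map, Chain.mults_map, Chain.uncons_map, Chain.unsnoc_map, F.map_d]
    simp only [List.map_map]
    rfl

namespace Tw

/-- The functoriality of the twisted tensor product: the dg functor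
`F ⊗̃ G : C ⊗̃ D → C' ⊗̃ D'`, which sends `(x, y)` to `(φ x, ψ y)`, `f ⊗ id_y` to `F f ⊗ id`,
`id_x ⊗ g` to `id ⊗ G g` and `ε(f; g₁, …, gₙ)` to `ε(F f; G g₁, …, G gₙ)`. -/
def map {C C' D D' : DGCat k} {φ : C.Obj → C'.Obj} {ψ : D.Obj → D'.Obj}
    (F : DGFunctor C C' φ) (G : DGFunctor D D' ψ) :
    DGFunctor (Tw C D) (Tw C' D') (onObj fun x y => pair (φ x) (ψ y)) :=
  desc ((gens C' D').comap F G)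

/-- The bijection `((x, y), z) ↦ (x, (y, z))` on objects. -/
def assocObj (C D E : DGCat k) : (Tw (Tw C D) E).Obj → (Tw C (Tw D E)).Obj :=
  onObj fun X z => onObj (fun x y => pair x (pair y z)) X

end Tw

/-- The chains of `D ⊗̃ E` obtained by inserting the morphisms `g₁, …, gₘ` of `D` into the chain
`h₁, …, h_N` of `E`: for all `0 ≤ i₁ ≤ j₁ ≤ i₂ ≤ j₂ ≤ ⋯ ≤ iₘ ≤ jₘ ≤ N` the chain
`h₁, …, h_{i₁}, ε(g₁; h_{i₁+1}, …, h_{j₁}), h_{j₁+1}, …, h_{iₘ}, ε(gₘ; h_{iₘ+1}, …, h_{jₘ}),`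
`h_{jₘ+1}, …, h_N` (where `h` stands for `id ⊗ h`, and `ε(g; ) = g ⊗ id`), together with the
exponent `∑_ℓ (|g_ℓ| - 1) ∑_{s > j_ℓ} (|h_s| - 1)` of its sign.  In the recursion, the first
splitting is at `jₘ`, the second one at `iₘ`. -/
def Chain.brace {D E : DGCat k} {y : D.Obj} {z : E.Obj} :
    {y' : D.Obj} → {z' : E.Obj} → {s t n : ℤ} → s + t = n →
    Chain D y y' s → Chain E z z' t → List (ℤ × Chain (Tw D E) (Tw.pair y z) (Tw.pair y' z') n)
  | _, _, _, _, _, e, .nil _, c => [(0, (c.map ((Tw.gens D E).right y)).cast (by omega))]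
  | y', _, _, _, _, e, .cons (q := q) (s := s') h g r, c =>
      c.splits.flatMap fun w => w.right.splits.flatMap fun v =>
        (Chain.brace (n := s' + v.b) rfl r v.right).map fun b =>
          ((q - 1) * w.a + s' * (w.a + v.a) + b.1,
            Chain.append (b := ((q + v.a) - 1) + (s' + v.b))
              (by have := w.h; have := v.h; omega)
              (w.left.map ((Tw.gens D E).right y'))
              (.cons rfl ((Tw.gens D E).eps rfl g v.left) b.2))

/-- The values on the generators which characterize the associativity dg functor
`(C ⊗̃ D) ⊗̃ E → C ⊗̃ (D ⊗̃ E)`. -/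
structure IsAssociator {C D E : DGCat k}
    (α : DGFunctor (Tw (Tw C D) E) (Tw C (Tw D E)) (Tw.assocObj C D E)) : Prop where
  /-- `α((f ⊗ id_y) ⊗ id_z) = f ⊗ (id_y ⊗ id_z)`. -/
  left_left : ∀ {x x' : C.Obj} {p : ℤ} (f : C.Hom x x' p) (y : D.Obj) (z : E.Obj),
    α.map (((Tw.gens (Tw C D) E).left z).map (((Tw.gens C D).left y).map f)) =
      ((Tw.gens C (Tw D E)).left (Tw.pair y z)).map f
  /-- `α((id_x ⊗ g) ⊗ id_z) = id_x ⊗ (g ⊗ id_z)`. -/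
  right_left : ∀ (x : C.Obj) {y y' : D.Obj} {q : ℤ} (g : D.Hom y y' q) (z : E.Obj),
    α.map (((Tw.gens (Tw C D) E).left z).map (((Tw.gens C D).right x).map g)) =
      ((Tw.gens C (Tw D E)).right x).map (((Tw.gens D E).left z).map g)
  /-- `α((id_x ⊗ id_y) ⊗ h) = id_x ⊗ (id_y ⊗ h)`. -/
  right_right : ∀ (x : C.Obj) (y : D.Obj) {z z' : E.Obj} {r : ℤ} (h : E.Hom z z' r),
    α.map (((Tw.gens (Tw C D) E).right (Tw.pair x y)).map h) =
      ((Tw.gens C (Tw D E)).right x).map (((Tw.gens D E).right y).map h)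
  /-- `α(ε(f; g₁, …, gₘ) ⊗ id_z) = ε(f; g₁ ⊗ id_z, …, gₘ ⊗ id_z)`, `m ≥ 1`. -/
  eps_left : ∀ {x x' : C.Obj} {y y' : D.Obj} {p s n : ℤ} (e : p + s = n) (f : C.Hom x x' p)
    (g : Chain D y y' s) (z : E.Obj), 1 ≤ g.length →
    α.map (((Tw.gens (Tw C D) E).left z).map ((Tw.gens C D).eps e f g)) =
      (Tw.gens C (Tw D E)).eps e f (g.map ((Tw.gens D E).left z))
  /-- `α(ε(f ⊗ id_y; h₁, …, h_N)) = ε(f; id_y ⊗ h₁, …, id_y ⊗ h_N)`, `N ≥ 1`. -/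
  left_eps : ∀ {x x' : C.Obj} {z z' : E.Obj} {p t n : ℤ} (e : p + t = n) (f : C.Hom x x' p)
    (y : D.Obj) (h : Chain E z z' t), 1 ≤ h.length →
    α.map ((Tw.gens (Tw C D) E).eps e (((Tw.gens C D).left y).map f) h) =
      (Tw.gens C (Tw D E)).eps e f (h.map ((Tw.gens D E).right y))
  /-- `α(ε(id_x ⊗ g; h₁, …, h_N)) = id_x ⊗ ε(g; h₁, …, h_N)`, `N ≥ 1`. -/
  right_eps : ∀ (x : C.Obj) {y y' : D.Obj} {z z' : E.Obj} {q t n : ℤ} (e : q + t = n)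
    (g : D.Hom y y' q) (h : Chain E z z' t), 1 ≤ h.length →
    α.map ((Tw.gens (Tw C D) E).eps e (((Tw.gens C D).right x).map g) h) =
      ((Tw.gens C (Tw D E)).right x).map ((Tw.gens D E).eps e g h)
  /-- `α(ε(ε(f; g₁, …, gₘ); h₁, …, h_N))` is the sum over all
  `0 ≤ i₁ ≤ j₁ ≤ ⋯ ≤ iₘ ≤ jₘ ≤ N` of
  `(-1)^{∑_ℓ (|g_ℓ| - 1) ∑_{s > j_ℓ} (|h_s| - 1)}` times
  `ε(f; h₁, …, h_{i₁}, ε(g₁; h_{i₁+1}, …, h_{j₁}), h_{j₁+1}, …)`, for `m, N ≥ 1`. -/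
  eps_eps : ∀ {x x' : C.Obj} {y y' : D.Obj} {z z' : E.Obj} {p s ps t st n : ℤ} (e₁ : p + s = ps)
    (e₂ : ps + t = n) (e₃ : s + t = st) (e₄ : p + st = n) (f : C.Hom x x' p)
    (g : Chain D y y' s) (h : Chain E z z' t), 1 ≤ g.length → 1 ≤ h.length →
    α.map ((Tw.gens (Tw C D) E).eps e₂ ((Tw.gens C D).eps e₁ f g) h) =
      ((Chain.brace e₃ g h).map fun b =>
        b.1.negOnePow • (Tw.gens C (Tw D E)).eps e₄ f b.2).sum

end DGCat

/-! The functor `- ⊗̃ E` has a right adjoint. Let `Coh E T` be the dg category whose objects are the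
dg functors `E → T` and whose morphisms are cochains on chains of `E` with values in `T`, linear in
each argument and zero on identities, with the cup product as composition and the Hochschild
differential. The relation for `ε(f₂ f₁; …)` says that `f ↦ ε(f; -)` respects composition, and the
relation for `d ε(f; …)` says that it respects differentials. So generators subject to the
relations, with values in `T`, amount to a dg functor `A → Coh E T`; `TwistedData.toCoh` and
`TwistedData.ofCoh` are the two directions.

Applied twice with `T = C ⊗̃ (D ⊗̃ E)`, this reduces the existence of `α` to generators for `C` and
`D` in `Coh E T`. The required formula leaves no choice: `ε(f; g₁, …, gₘ)` must be the cochain which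
sends `h` to the signed sum of `ε(f; b)` over all chains `b` obtained by inserting `g` into `h`. The
content is that these cochains satisfy the relations (`TwistedData.insert`).

This becomes a statement on bar constructions. Chains of a dg category form a dg coalgebra under
cutting; it is treated dually, through sums over cuts (`splitSum`) and the transposed differential
(`dif`). Insertion, as a map from Bar D ⊗ Bar E to Bar (D ⊗̃ E), is the coalgebra map whose
component of length one sends `(g) ⊗ l` to `ε(g; l)`, sends `() ⊗ (h)` to `id ⊗ h`, and vanishes
otherwise. Compatibility with cuts (`braceSum_splitSum`) yields the relation for `ε(f₂ f₁; …)`, and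
compatibility with differentials (`braceSum_dif`) the one for `d ε(f; …)`. Both rest on the
recursion `braceSum_cons`: the last morphism of an inserted chain is either `ε(gₘ; …)` or the last
`h` standing alone. In `braceSum_dif` the terms cancel because of the relations in `D ⊗̃ E`, in the
form of `pd_cochain`, `cochain_comp` and the Maurer-Cartan equation `pd_tau`.

For uniqueness, the first argument of `ε(a; h₁, …)` may be any morphism of `C ⊗̃ D`, but the
relations express the cases of a sum, a composite and a differential through smaller ones, so only
generators `a` matter (`Agree`, `hom_ext₂`). Naturality is then checked on generators; the only
nontrivial point is that dg functors commute with insertion (`brace_map`). -/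

namespace DGCat

variable {k : Type u} [CommRing k]

/-! ### Transport along equalities of degrees. -/

section Degrees

variable {T : DGCat k}

/-- Transport of a morphism along an equality of degrees. -/
def hc {x y : T.Obj} {m n : ℤ} (h : m = n) : T.Hom x y m →ₗ[k] T.Hom x y n :=
  h ▸ LinearMap.id

/-- The differential, with a flexible degree of its values. -/
def dh {x y : T.Obj} {m n : ℤ} (h : m + 1 = n) : T.Hom x y m →ₗ[k] T.Hom x y n :=
  h ▸ T.d

theorem dh_rfl {x y : T.Obj} {m : ℤ} (f : T.Hom x y m) : dh rfl f = T.d f := rfl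

theorem dh_dh {x y : T.Obj} {l m n : ℤ} (h : l + 1 = m) (h' : m + 1 = n) (f : T.Hom x y l) :
    dh h' (dh h f) = 0 := by
  subst h h'
  exact T.d_d f

theorem dh_comp {x y z : T.Obj} {p q n n' p' q' : ℤ} (h : p + q = n) (hn : n + 1 = n')
    (hp : p + 1 = p') (hq : q + 1 = q') (f : T.Hom y z p) (g : T.Hom x y q) :
    dh hn (T.comp h f g) = T.comp (by omega) (dh hp f) g +
      p.negOnePow • T.comp (by omega) f (dh hq g) := by
  subst h hn hp hq
  exact T.leibniz _ _ _ f g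

/-- The Leibniz rule for `id ∘ id = id` reads `d id = d id + d id`. -/
theorem d_idm (x : T.Obj) : T.d (T.idm x) = 0 := by
  have h := T.leibniz (zero_add 0) (by omega) (by omega) (T.idm x) (T.idm x)
  rw [T.idm_comp, T.comp_idm, T.idm_comp] at h
  simpa using h

theorem DGFunctor.map_hc {S : DGCat k} {φ : S.Obj → T.Obj} (F : DGFunctor S T φ) {x y : S.Obj}
    {m n : ℤ} (h : m = n) (f : S.Hom x y m) : F.map (hc h f) = hc h (F.map f) := by
  subst h; rfl

theorem DGFunctor.map_dh {S : DGCat k} {φ : S.Obj → T.Obj} (F : DGFunctor S T φ) {x y : S.Obj}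
    {m n : ℤ} (h : m + 1 = n) (f : S.Hom x y m) : F.map (dh h f) = dh h (F.map f) := by
  subst h; exact F.map_d f

theorem hc_comp {x y z : T.Obj} {p q n n' : ℤ} (h : p + q = n) (hn : n = n')
    (f : T.Hom y z p) (g : T.Hom x y q) :
    hc hn (T.comp h f g) = T.comp (h.trans hn) f g := by
  subst hn; rfl

theorem comp_hc_left {x y z : T.Obj} {p p' q n : ℤ} (e : p = p') (h : p' + q = n)
    (f : T.Hom y z p) (g : T.Hom x y q) :
    T.comp h (hc e f) g = T.comp (by omega) f g := by
  subst e; rfl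

theorem comp_hc_right {x y z : T.Obj} {p q q' n : ℤ} (e : q = q') (h : p + q' = n)
    (f : T.Hom y z p) (g : T.Hom x y q) :
    T.comp h f (hc e g) = T.comp (by omega) f g := by
  subst e; rfl

theorem comp_comp_mid {x y z w : T.Obj} {p q r m m' n : ℤ} (h : p + m = n) (h₁ : q + r = m)
    (h' : p + m' = n) (h₁' : q + r = m') (f : T.Hom z w p) (g : T.Hom y z q) (e : T.Hom x y r) :
    T.comp h f (T.comp h₁ g e) = T.comp h' f (T.comp h₁' g e) := by
  subst h₁ h₁'; rfl

theorem dh_hc {x y : T.Obj} {l m n : ℤ} (e : l = m) (h : m + 1 = n) (f : T.Hom x y l) :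
    dh h (hc e f) = dh (by omega) f := by
  subst e; rfl

theorem hc_dh {x y : T.Obj} {l m n : ℤ} (h : l + 1 = m) (e : m = n) (f : T.Hom x y l) :
    hc e (dh h f) = dh (h.trans e) f := by
  subst e; rfl

end Degrees

/-- Koszul signs are compared through the parity of the difference of their exponents. -/
theorem negOnePow_congr {a b : ℤ} (h : Even (a - b)) : a.negOnePow = b.negOnePow :=
  (Int.negOnePow_eq_iff a b).2 h

theorem map_usmul {V W F : Type*} [AddCommGroup V] [AddCommGroup W] [FunLike F V W]
    [AddMonoidHomClass F V W] (f : F) (e : ℤˣ) (v : V) : f (e • v) = e • f v := by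
  rw [Units.smul_def, Units.smul_def]
  exact map_zsmul f (e : ℤ) v

theorem comp_usmul_left {T : DGCat k} {x y z : T.Obj} {p q n : ℤ} (h : p + q = n) (e : ℤˣ)
    (f : T.Hom y z p) (g : T.Hom x y q) : T.comp h (e • f) g = e • T.comp h f g :=
  map_usmul ((T.comp h).flip g) e f

theorem comp_usmul_right {T : DGCat k} {x y z : T.Obj} {p q n : ℤ} (h : p + q = n) (e : ℤˣ)
    (f : T.Hom y z p) (g : T.Hom x y q) : T.comp h f (e • g) = e • T.comp h f g :=
  map_usmul (T.comp h f) e g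

section Lsum

variable {V ι : Type*} [AddCommGroup V]

theorem sum_map_units_smul (l : List ι) (e : ℤˣ) (f : ι → V) :
    (l.map fun i => e • f i).sum = e • (l.map f).sum := by
  induction l with
  | nil => simp
  | cons a l ih => simp [ih]

theorem sum_map_zero' (l : List ι) : (l.map fun _ => (0 : V)).sum = 0 := by
  induction l with
  | nil => rfl
  | cons a l ih => simp

theorem sum_map_flatMap {κ : Type*} (l : List ι) (f : ι → List κ) (g : κ → V) :
    ((l.flatMap f).map g).sum = (l.map fun i => ((f i).map g).sum).sum := by
  induction l with
  | nil => rfl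
  | cons a l ih => simp [ih]

end Lsum

/-! ### The bar coalgebra, dually: sums over cuts and the transposed differential. -/

namespace Chain

variable {D : DGCat k} {x y z : D.Obj} {V W : Type*} [AddCommGroup V] [AddCommGroup W]

/-- Functions of the two parts of a decomposition of a chain. -/
abbrev SplitFn (D : DGCat k) (x z : D.Obj) (s : ℤ) (V : Type*) :=
  ∀ (m : D.Obj) (a b : ℤ), a + b = s → Chain D m z a → Chain D x m b → V

/-- The sum of the values of a function over all decompositions of a chain. -/
def splitSum {s : ℤ} (c : Chain D x z s) (F : SplitFn D x z s V) : V :=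
  (c.splits.map fun w => F w.mid w.a w.b w.h w.left w.right).sum

theorem splitSum_nil {s : ℤ} (h : s = 0) (F : SplitFn D x x s V) :
    splitSum (.nil h) F = F x 0 0 (by omega) (.nil rfl) (.nil rfl) := by
  simp [splitSum, splits]

theorem splitSum_cons {q s t : ℤ} (h : (q - 1) + s = t) (g : D.Hom y z q) (r : Chain D x y s)
    (F : SplitFn D x z t V) :
    splitSum (.cons h g r) F = F z 0 t (zero_add t) (.nil rfl) (.cons h g r) +
      splitSum r fun m a b e l r' =>
        F m ((q - 1) + a) b (by omega) (.cons rfl g l) r' := by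
  simp [splitSum, splits, Function.comp_def]

theorem splitSum_add {s : ℤ} (c : Chain D x z s) (F G : SplitFn D x z s V) :
    splitSum c (fun m a b e l r => F m a b e l r + G m a b e l r) =
      splitSum c F + splitSum c G := by
  simp only [splitSum]; exact List.sum_map_add

theorem splitSum_zero {s : ℤ} (c : Chain D x z s) :
    splitSum c (fun _ _ _ _ _ _ => (0 : V)) = 0 := sum_map_zero' _

theorem splitSum_usmul {s : ℤ} (c : Chain D x z s) (e : ℤˣ) (F : SplitFn D x z s V) :
    splitSum c (fun m a b h l r => e • F m a b h l r) = e • splitSum c F :=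
  sum_map_units_smul _ _ _

theorem map_splitSum {F' : Type*} [FunLike F' V W] [AddMonoidHomClass F' V W] (f : F') {s : ℤ}
    (c : Chain D x z s) (F : SplitFn D x z s V) :
    f (splitSum c F) = splitSum c fun m a b h l r => f (F m a b h l r) := by
  simp only [splitSum, map_list_sum, List.map_map]
  rfl

/-- The information on lengths is kept for inductions on the length of `c`: when the left part is
non-empty, the right part is shorter. -/
theorem splitSum_congr' {s : ℤ} (c : Chain D x z s) {F G : SplitFn D x z s V}
    (h : ∀ m a b e l r, l.length + r.length = c.length → F m a b e l r = G m a b e l r) :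
    splitSum c F = splitSum c G := by
  induction c with
  | nil hs =>
    rw [splitSum_nil, splitSum_nil]
    exact h _ _ _ _ _ _ rfl
  | cons hs g r ih =>
    rw [splitSum_cons, splitSum_cons, h _ _ _ _ _ _ (by simp [length])]
    congr 1
    apply ih
    intro m a b e l r hl
    apply h
    simp only [length]; omega

theorem splitSum_congr {s : ℤ} (c : Chain D x z s) {F G : SplitFn D x z s V}
    (h : ∀ m a b e l r, F m a b e l r = G m a b e l r) :
    splitSum c F = splitSum c G := splitSum_congr' c fun m a b e l r _ => h m a b e l r

theorem splitSum_right_nil {s : ℤ} (c : Chain D x z s) (F : SplitFn D x z s V)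
    (hF : ∀ {m y a b q b'} (e : a + b = s) (l : Chain D m z a) (h : (q - 1) + b' = b)
      (g : D.Hom y m q) (r : Chain D x y b'), F m a b e l (.cons h g r) = 0) :
    splitSum c F = F x s 0 (by omega) c (.nil rfl) := by
  induction c with
  | nil hs => subst hs; rw [splitSum_nil]
  | @cons y z q s' s h g r ih =>
    rw [splitSum_cons, hF, ih _ fun e l => hF _ _]
    subst h
    exact zero_add _

/-- Coassociativity of the decomposition of chains. -/
theorem splitSum_assoc {s : ℤ} (c : Chain D x z s)
    (F : ∀ (m₁ m₂ : D.Obj) (a b e : ℤ), a + b + e = s → Chain D m₂ z a → Chain D m₁ m₂ b →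
      Chain D x m₁ e → V) :
    splitSum c (fun m₁ ab e h l r => splitSum l fun m₂ a b h' l₁ l₂ =>
      F m₁ m₂ a b e (by omega) l₁ l₂ r) =
    splitSum c (fun m₂ a be h l r => splitSum r fun m₁ b e h' r₁ r₂ =>
      F m₁ m₂ a b e (by omega) l r₁ r₂) := by
  induction c with
  | nil h => simp only [splitSum_nil]
  | cons h g r ih =>
    simp only [splitSum_cons, splitSum_nil, splitSum_add]
    rw [add_assoc (G := V)]
    congr 2
    exact ih fun m₁ m₂ a b e h l => F m₁ m₂ _ b e (by omega) (.cons rfl g l)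

theorem splitSum_comm {E : DGCat k} {x' z' : E.Obj} {s t : ℤ} (c : Chain D x z s)
    (c' : Chain E x' z' t) (F : ∀ (m : D.Obj) (a b : ℤ), a + b = s → Chain D m z a →
      Chain D x m b → SplitFn E x' z' t V) :
    splitSum c (fun m a b h l r => splitSum c' (F m a b h l r)) =
    splitSum c' (fun m' a' b' h' l' r' => splitSum c fun m a b h l r =>
      F m a b h l r m' a' b' h' l' r') := by
  induction c with
  | nil h => simp only [splitSum_nil]
  | cons h g r ih =>
    simp only [splitSum_cons, splitSum_add, ih]

/-- The functional `r ↦ φ (g₁, …, gₙ₋₁, g ∘ gₙ)` on chains `r = (g₁, …, gₙ)`; its value is `0` on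
the empty chain. -/
def mulFn {q s t : ℤ} (g : D.Hom y z q) (h : q + s = t) (φ : Chain D x z t → V) :
    Chain D x y s → V
  | .nil _ => 0
  | .cons (q := q') h₁ g' r => φ (.cons (q := q + q') (by omega) (D.comp rfl g g') r)

theorem mulFn_nil {q s t : ℤ} (g : D.Hom x z q) (h : q + s = t) (φ : Chain D x z t → V)
    (hs : s = 0) : mulFn g h φ (.nil hs) = 0 := rfl

/-- The degree `m` of the composite is left free, so that iterated composites whose degrees are
bracketed differently can be compared without transport. -/
theorem mulFn_cons {w : D.Obj} {q q' m s t r' : ℤ} (g : D.Hom y z q) (h : q + s = t)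
    (φ : Chain D x z t → V) (h₁ : (q' - 1) + r' = s) (g' : D.Hom w y q') (r : Chain D x w r')
    (hm : q + q' = m) :
    mulFn g h φ (.cons h₁ g' r) = φ (.cons (q := m) (by omega) (D.comp hm g g') r) := by
  subst hm; rfl

/-- The transpose of the differential of the bar construction. -/
def dif : {z : D.Obj} → {s t : ℤ} → s + 1 = t → (Chain D x z t → V) → Chain D x z s → V
  | _, _, _, _, _, .nil _ => 0
  | _, _, t, h, φ, .cons (q := q) (s := s') h₁ g r =>
      φ (.cons (q := q + 1) (by omega) (D.d g) r) + (q - 1).negOnePow •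
        (mulFn g (by omega) φ r +
          dif (s := s') (t := s' + 1) rfl (fun r' => φ (.cons (by omega) g r')) r)

theorem dif_nil {s t : ℤ} (h : s + 1 = t) (φ : Chain D x x t → V) (hs : s = 0) :
    dif h φ (.nil hs) = 0 := rfl

theorem dif_cons {q q' s s' t t' : ℤ} (h : s + 1 = t) (φ : Chain D x z t → V)
    (h₁ : (q - 1) + s' = s) (g : D.Hom y z q) (r : Chain D x y s') (hq : q + 1 = q')
    (ht : s' + 1 = t') :
    dif h φ (.cons h₁ g r) = φ (.cons (q := q') (by omega) (dh hq g) r) + (q - 1).negOnePow •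
      (mulFn g (by omega) φ r + dif ht (fun r' => φ (.cons (by omega) g r')) r) := by
  subst hq ht; rfl

theorem mulFn_add {q s t : ℤ} (g : D.Hom y z q) (h : q + s = t) (φ ψ : Chain D x z t → V)
    (r : Chain D x y s) :
    mulFn g h (fun c => φ c + ψ c) r = mulFn g h φ r + mulFn g h ψ r := by
  cases r <;> simp [mulFn]

theorem mulFn_map {F : Type*} [FunLike F V W] [AddMonoidHomClass F V W] (f : F) {q s t : ℤ}
    (g : D.Hom y z q) (h : q + s = t) (φ : Chain D x z t → V) (r : Chain D x y s) :
    f (mulFn g h φ r) = mulFn g h (fun c => f (φ c)) r := by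
  cases r <;> simp [mulFn]

theorem dif_map {F : Type*} [FunLike F V W] [AddMonoidHomClass F V W] (f : F) {s t : ℤ}
    (h : s + 1 = t) (φ : Chain D x z t → V) (c : Chain D x z s) :
    f (dif h φ c) = dif h (fun c => f (φ c)) c := by
  induction c generalizing t with
  | nil hs => simp [dif]
  | cons h₁ g r ih => simp [dif, mulFn_map, ih]

theorem dif_zero {s t : ℤ} (h : s + 1 = t) (c : Chain D x z s) :
    dif h (fun _ => (0 : V)) c = 0 := by
  simpa using (dif_map (0 : V →+ V) h (fun _ => (0 : V)) c).symm

theorem dif_add {s t : ℤ} (h : s + 1 = t) (φ ψ : Chain D x z t → V) (c : Chain D x z s) :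
    dif h (fun c => φ c + ψ c) c = dif h φ c + dif h ψ c := by
  induction c generalizing t with
  | nil hs => simp [dif]
  | cons h₁ g r ih =>
    simp only [dif, mulFn_add, ih, smul_add]
    abel

theorem dif_usmul {s t : ℤ} (h : s + 1 = t) (e : ℤˣ) (φ : Chain D x z t → V)
    (c : Chain D x z s) : dif h (fun c => e • φ c) c = e • dif h φ c :=
  (dif_map (DistribSMul.toAddMonoidHom V e) h φ c).symm

theorem dif_sum {ι : Type*} (l : List ι) {s t : ℤ} (h : s + 1 = t) (φ : ι → Chain D x z t → V)
    (c : Chain D x z s) :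
    dif h (fun c => (l.map fun i => φ i c).sum) c = (l.map fun i => dif h (φ i) c).sum := by
  induction l with
  | nil => simp [dif_zero]
  | cons i l ih => simp [dif_add, ih]

/-- `dif` is a coderivation with respect to the decomposition of chains. -/
theorem dif_splitSum {s t : ℤ} (h : s + 1 = t) (c : Chain D x z s) (F : SplitFn D x z t V) :
    dif h (fun c' => splitSum c' F) c = splitSum c fun m a b e l r =>
      dif (t := a + 1) rfl (fun l' => F m (a + 1) b (by omega) l' r) l +
        a.negOnePow • dif (t := b + 1) rfl (fun r' => F m a (b + 1) (by omega) l r') r := by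
  induction c generalizing t with
  | nil hs => simp [dif, splitSum_nil]
  | @cons y z q s' s h₁ g r ih =>
    subst h
    simp only [dif]
    simp only [splitSum_cons, dif_add, ih, dif_nil, Int.negOnePow_zero, one_smul, zero_add]
    -- Merging `g` with its neighbour destroys the cut between them; this is why the cut of `r` with
    -- empty left part contributes `0` through `mulFn_nil`. The first term is the cut after the
    -- merged morphism.
    have key : mulFn g (by omega) (fun c' => splitSum c' F) r =
        mulFn g (by omega) (F z 0 (s + 1) (by omega) (.nil rfl)) r + splitSum r fun m a b e l r' =>
          mulFn g (t := (q - 1) + a + 1) (by omega) (fun l' => F m ((q - 1) + a + 1) b (by omega) l' r') l := by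
      cases r with
      | nil hs => simp [mulFn, splitSum_nil]
      | @cons w y q' s'' s' h₂ g' r =>
        rw [mulFn_cons (hm := rfl), splitSum_cons, splitSum_cons, mulFn_cons (hm := rfl)]
        rw [mulFn_nil, zero_add (M := V)]
        congr 1
        apply splitSum_congr
        intro m a b e l r
        rw [mulFn_cons (hm := rfl)]
        have : ∀ {a₁ a₂ : ℤ} (h₁ : (q + q' - 1) + a = a₁) (h₂ : (q + q' - 1) + a = a₂) (e₁ e₂),
            F m a₁ b e₁ (.cons h₁ (D.comp rfl g g') l) r = F m a₂ b e₂ (.cons h₂ (D.comp rfl g g') l) r := by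
          intro a₁ a₂ h₁ h₂ e₁ e₂
          subst h₁ h₂; rfl
        apply this
    rw [key]
    simp only [dif, splitSum_add, smul_add, ← splitSum_usmul, smul_smul, ← Int.negOnePow_add]
    -- Both sides have the same terms; only the expressions for the degree of the left part differ.
    -- The same applies to the next equality.
    have : (splitSum r fun m a b e l r' => F m (q + 1 - 1 + a) b (by omega) (.cons rfl (D.d g) l) r')
       = splitSum r fun m a b e l r' => F m (q - 1 + a + 1) b (by omega) (.cons (by omega) (D.d g) l) r' := by
      apply splitSum_congr
      intro m a b e l r
      have : ∀ {a₁ a₂ : ℤ} (h₁ : (q + 1 - 1) + a = a₁) (h₂ : (q + 1 - 1) + a = a₂) (e₁ e₂),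
            F m a₁ b e₁ (.cons h₁ (D.d g) l) r = F m a₂ b e₂ (.cons h₂ (D.d g) l) r := by
          intro a₁ a₂ h₁ h₂ e₁ e₂
          subst h₁ h₂; rfl
      apply this
    rw [this]
    have : (splitSum r fun m a b e l r' => (q - 1).negOnePow • dif (t := a + 1) rfl (fun l' => F m (q - 1 + (a + 1)) b (by omega) (.cons rfl g l') r') l) =
       splitSum r fun m a b e l r' => (q - 1).negOnePow • dif (t := a + 1) rfl (fun l' => F m (q - 1 + a + 1) b (by omega) (.cons (by omega) g l') r') l := by
      apply splitSum_congr
      intro m a b e l r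
      have : ∀ {a₁ a₂ : ℤ} (h₁ : (q - 1) + (a + 1) = a₁) (h₂ : (q - 1) + (a + 1) = a₂) (e₁ e₂),
            dif (t := a + 1) rfl (fun l' => F m a₁ b e₁ (.cons h₁ g l') r) l = dif (t := a + 1) rfl (fun l' => F m a₂ b e₂ (.cons h₂ g l') r) l := by
          intro a₁ a₂ h₁ h₂ e₁ e₂
          subst h₁ h₂; rfl
      congr 1
      apply this
    rw [this]
    abel

end Chain
end DGCat

/-! ### Multilinear normalized functionals, and the square of the bar differential. -/

namespace DGCat

variable {k : Type u} [CommRing k]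

/-- The morphism is an identity. -/
inductive IsIdm {D : DGCat k} : {y z : D.Obj} → {q : ℤ} → D.Hom y z q → Prop
  | mk (y : D.Obj) : IsIdm (D.idm y)

/-- Linear functions of a morphism which vanish on identities. -/
structure NLin {D : DGCat k} {y z : D.Obj} {q : ℤ} {V : Type*} [AddCommGroup V] [Module k V]
    (f : D.Hom y z q → V) : Prop where
  lin : IsLinearMap k f
  idm : ∀ g, IsIdm g → f g = 0

namespace NLin

variable {D : DGCat k} {y z : D.Obj} {q : ℤ} {V W : Type*} [AddCommGroup V] [Module k V]
  [AddCommGroup W] [Module k W]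

theorem zero : NLin (fun _ : D.Hom y z q => (0 : V)) :=
  ⟨(0 : D.Hom y z q →ₗ[k] V).isLinear, fun _ _ => rfl⟩

theorem add {f g : D.Hom y z q → V} (hf : NLin f) (hg : NLin g) : NLin (fun a => f a + g a) :=
  ⟨(hf.lin.mk' f + hg.lin.mk' g).isLinear, fun a h => by rw [hf.idm a h, hg.idm a h, add_zero]⟩

theorem map {f : D.Hom y z q → V} (hf : NLin f) (L : V →ₗ[k] W) : NLin (fun a => L (f a)) :=
  ⟨(L ∘ₗ hf.lin.mk' f).isLinear, fun a h => by rw [hf.idm a h, map_zero]⟩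

theorem usmul {f : D.Hom y z q → V} (hf : NLin f) (e : ℤˣ) : NLin (fun a => e • f a) := by
  refine ⟨⟨fun a b => ?_, fun r a => ?_⟩, fun a h => ?_⟩
  · rw [hf.lin.map_add, smul_add]
  · rw [hf.lin.map_smul, smul_comm]
  · rw [hf.idm a h, smul_zero]

theorem listSum {ι : Type*} (l : List ι) {f : ι → D.Hom y z q → V} (h : ∀ i, NLin (f i)) :
    NLin (fun a => (l.map fun i => f i a).sum) := by
  induction l with
  | nil => exact zero
  | cons i l ih => simpa using (h i).add ih

theorem splitSum {E : DGCat k} {x' z' : E.Obj} {s : ℤ} (c : Chain E x' z' s)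
    {F : D.Hom y z q → Chain.SplitFn E x' z' s V}
    (h : ∀ m a b e l r, NLin (fun g => F g m a b e l r)) :
    NLin (fun g => c.splitSum (F g)) :=
  listSum _ fun w => h w.mid w.a w.b w.h w.left w.right

end NLin

namespace Chain

/-- A chain with a missing morphism. -/
inductive Ctx (D : DGCat k) (x y z : D.Obj) (q : ℤ) : D.Obj → ℤ → Type u
  | hole {s t : ℤ} (h : (q - 1) + s = t) (r : Chain D x y s) : Ctx D x y z q z t
  | cons {v w : D.Obj} {q' s t : ℤ} (h : (q' - 1) + s = t) (g : D.Hom v w q')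
      (κ : Ctx D x y z q v s) : Ctx D x y z q w t

variable {D : DGCat k} {x y z w : D.Obj} {q : ℤ} {V W : Type*} [AddCommGroup V] [Module k V]
  [AddCommGroup W] [Module k W]

/-- The chain obtained by filling in the missing morphism. -/
def Ctx.plug (g : D.Hom y z q) : {w : D.Obj} → {t : ℤ} → Ctx D x y z q w t → Chain D x w t
  | _, _, .hole h r => .cons h g r
  | _, _, .cons h g' κ => .cons h g' (κ.plug g)

theorem IsAdd.exists_plug {s : ℤ} {x w : D.Obj} {c c₁ c₂ : Chain D x w s} (h : c.IsAdd c₁ c₂) :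
    ∃ (y z : D.Obj) (q : ℤ) (κ : Ctx D x y z q w s) (g₁ g₂ : D.Hom y z q),
      c = κ.plug (g₁ + g₂) ∧ c₁ = κ.plug g₁ ∧ c₂ = κ.plug g₂ := by
  induction h with
  | here h g₁ g₂ r => exact ⟨_, _, _, .hole h r, g₁, g₂, rfl, rfl, rfl⟩
  | there h g _ ih =>
    obtain ⟨y, z, q, κ, g₁, g₂, rfl, rfl, rfl⟩ := ih
    exact ⟨_, _, _, .cons h g κ, g₁, g₂, rfl, rfl, rfl⟩

theorem IsSMul.exists_plug {a : k} {s : ℤ} {x w : D.Obj} {c c₁ : Chain D x w s}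
    (h : c.IsSMul a c₁) :
    ∃ (y z : D.Obj) (q : ℤ) (κ : Ctx D x y z q w s) (g : D.Hom y z q),
      c = κ.plug (a • g) ∧ c₁ = κ.plug g := by
  induction h with
  | here h g r => exact ⟨_, _, _, .hole h r, g, rfl, rfl⟩
  | there h g _ ih =>
    obtain ⟨y, z, q, κ, g₁, rfl, rfl⟩ := ih
    exact ⟨_, _, _, .cons h g κ, g₁, rfl, rfl⟩

theorem HasId.exists_plug {s : ℤ} {x w : D.Obj} {c : Chain D x w s} (h : c.HasId) :
    ∃ (y : D.Obj) (κ : Ctx D x y y 0 w s), c = κ.plug (D.idm y) := by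
  induction h with
  | here h r => exact ⟨_, .hole h r, rfl⟩
  | there h g _ ih =>
    obtain ⟨y, κ, rfl⟩ := ih
    exact ⟨_, .cons h g κ, rfl⟩

theorem Ctx.isAdd {t : ℤ} (κ : Ctx D x y z q w t) (g₁ g₂ : D.Hom y z q) :
    (κ.plug (g₁ + g₂)).IsAdd (κ.plug g₁) (κ.plug g₂) := by
  induction κ with
  | hole h r => exact .here h g₁ g₂ r
  | cons h g κ ih => exact .there h g ih

theorem Ctx.isSMul {t : ℤ} (κ : Ctx D x y z q w t) (a : k) (g : D.Hom y z q) :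
    (κ.plug (a • g)).IsSMul a (κ.plug g) := by
  induction κ with
  | hole h r => exact .here h g r
  | cons h g κ ih => exact .there h g ih

theorem Ctx.hasId {t : ℤ} (κ : Ctx D x y z q w t) {g : D.Hom y z q} (hg : IsIdm g) :
    (κ.plug g).HasId := by
  induction κ with
  | hole h r => cases hg; exact .here h r
  | cons h g κ ih => exact .there h g ih

/-- Functions of chains which are linear in each morphism and vanish if some morphism is an
identity. -/
def Good {t : ℤ} (φ : Chain D x w t → V) : Prop :=
  ∀ ⦃y z : D.Obj⦄ ⦃q : ℤ⦄ (κ : Ctx D x y z q w t), NLin (fun g => φ (κ.plug g))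

namespace Good

variable {t : ℤ} {φ ψ : Chain D x w t → V}

/-- Contexts with one hole replace the inductive relations on chains, so that linearity in one
argument becomes linearity of an actual map. -/
theorem of_rel (hadd : ∀ c c₁ c₂ : Chain D x w t, c.IsAdd c₁ c₂ → φ c = φ c₁ + φ c₂)
    (hsmul : ∀ (a : k) (c c₁ : Chain D x w t), c.IsSMul a c₁ → φ c = a • φ c₁)
    (hid : ∀ c : Chain D x w t, c.HasId → φ c = 0) : Good φ := fun _ _ _ κ =>
  ⟨⟨fun g₁ g₂ => hadd _ _ _ (κ.isAdd g₁ g₂), fun a g => hsmul a _ _ (κ.isSMul a g)⟩,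
    fun _ hg => hid _ (κ.hasId hg)⟩

theorem isAdd (hφ : Good φ) {c c₁ c₂ : Chain D x w t} (h : c.IsAdd c₁ c₂) :
    φ c = φ c₁ + φ c₂ := by
  obtain ⟨y, z, q, κ, g₁, g₂, rfl, rfl, rfl⟩ := h.exists_plug
  exact (hφ κ).lin.map_add g₁ g₂

theorem isSMul (hφ : Good φ) {a : k} {c c₁ : Chain D x w t} (h : c.IsSMul a c₁) :
    φ c = a • φ c₁ := by
  obtain ⟨y, z, q, κ, g, rfl, rfl⟩ := h.exists_plug
  exact (hφ κ).lin.map_smul a g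

theorem hasId (hφ : Good φ) {c : Chain D x w t} (h : c.HasId) : φ c = 0 := by
  obtain ⟨y, κ, rfl⟩ := h.exists_plug
  exact (hφ κ).idm _ (.mk y)

theorem zero : Good (fun _ : Chain D x w t => (0 : V)) := fun _ _ _ _ => NLin.zero

theorem add (hφ : Good φ) (hψ : Good ψ) : Good (fun c => φ c + ψ c) :=
  fun _ _ _ κ => (hφ κ).add (hψ κ)

theorem map (hφ : Good φ) (L : V →ₗ[k] W) : Good (fun c => L (φ c)) :=
  fun _ _ _ κ => (hφ κ).map L

theorem smul (a : k) (hφ : Good φ) : Good (fun c => a • φ c) := hφ.map (LinearMap.lsmul k V a)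

theorem usmul (e : ℤˣ) (hφ : Good φ) : Good (fun c => e • φ c) :=
  fun _ _ _ κ => (hφ κ).usmul e

theorem neg (hφ : Good φ) : Good (fun c => - φ c) := hφ.map (-LinearMap.id)

theorem sub (hφ : Good φ) (hψ : Good ψ) : Good (fun c => φ c - ψ c) := by
  simpa [sub_eq_add_neg] using hφ.add hψ.neg

theorem head {v : D.Obj} {q s : ℤ} (hφ : Good φ) (h : (q - 1) + s = t) (r : Chain D x v s) :
    NLin (fun g : D.Hom v w q => φ (.cons h g r)) := hφ (.hole h r)

theorem tail {v : D.Obj} {q s : ℤ} (hφ : Good φ) (h : (q - 1) + s = t) (g : D.Hom v w q) :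
    Good (fun r : Chain D x v s => φ (.cons h g r)) := fun _ _ _ κ => hφ (.cons h g κ)

theorem splitSum {F : SplitFn D x w t V}
    (hl : ∀ m a b e (r : Chain D x m b), Good (fun l => F m a b e l r))
    (hr : ∀ m a b e (l : Chain D m w a), Good (fun r => F m a b e l r)) :
    Good (fun c => c.splitSum F) := by
  intro y z q κ
  induction κ with
  | hole h r =>
    simp only [Ctx.plug, splitSum_cons]
    exact ((hr _ _ _ _ _).head _ _).add (NLin.splitSum _ fun m a b e l r => (hl _ _ _ _ _).head _ _)
  | cons h g κ ih =>
    simp only [Ctx.plug, splitSum_cons]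
    exact (hr _ _ _ _ _ (.cons h g κ)).add
      (ih (F := fun m a b e l r' => F m _ b _ (.cons rfl g l) r')
        (fun m a b e r => (hl _ _ _ _ _).tail _ _) (fun m a b e l => hr _ _ _ _ _))

end Good

/-- The Leibniz rule for `g ∘ g'` yields the term with `dg` and the one with `dg'`; the term which
merges a third morphism agrees on both sides by associativity. -/
theorem mulFn_dif {z : D.Obj} {q q' s s' t t' : ℤ} (g : D.Hom y z q) (h : q + s = t)
    (ht : t + 1 = t') (hq : q + 1 = q') (hs : s + 1 = s') {φ : Chain D x z t' → V} (hφ : Good φ)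
    (r : Chain D x y s) :
    mulFn g h (dif ht φ) r = mulFn (dh hq g) (by omega) φ r +
      q.negOnePow • dif hs (mulFn g (by omega) φ) r := by
  subst hq hs ht
  cases r with
  | nil hs => simp [mulFn, dif]
  | @cons v _ p s' _ h₁ g' r =>
    rw [mulFn_cons (hm := rfl), dif_cons (hq := rfl) (ht := rfl),
      mulFn_cons (hm := show _ = q + p + 1 by omega),
      dif_cons (hq := rfl) (ht := rfl), mulFn_cons (hm := show _ = q + p + 1 by omega)]
    rw [dh_comp rfl rfl rfl rfl, (hφ.head _ _).lin.map_add]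
    -- Merging `g ∘ g'` with the next morphism is merging `g` with the result of merging `g'`.
    have e : mulFn (D.comp rfl g g') (by omega) φ r =
        mulFn g' (by omega) (mulFn g (show q + (s + 1) = t + 1 by omega) φ) r := by
      cases r with
      | nil hs => rfl
      | cons h₂ g'' r =>
        rw [mulFn_cons (hm := rfl), mulFn_cons (hm := rfl), mulFn_cons (hm := (add_assoc _ _ _).symm)]
        rw [D.assoc]
    rw [e]
    have e2 : ∀ f : D.Hom v z (q + p + 1), φ (.cons (by omega) (q.negOnePow • f) r) = q.negOnePow • φ (.cons (by omega) f r) :=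
      fun f => map_usmul (((hφ.head (show (q + p + 1) - 1 + s' = t + 1 by omega) r).lin.mk' _)) _ f
    rw [e2]
    simp only [smul_add, smul_smul, ← Int.negOnePow_add]
    rw [show (q + (p - 1)).negOnePow = (q + p - 1).negOnePow from negOnePow_congr (by grind)]
    rw [add_assoc]
    rfl

/-- The differential of the bar construction has square zero. -/
theorem dif_dif {z : D.Obj} {s t u : ℤ} (h : s + 1 = t) (h' : t + 1 = u) {φ : Chain D x z u → V}
    (hφ : Good φ) (c : Chain D x z s) : dif h (dif h' φ) c = 0 := by
  induction c generalizing t u with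
  | nil hs => rfl
  | @cons y z q s' s h₁ g r ih =>
    rw [dif_cons (hq := rfl) (ht := rfl), dif_cons (hq := rfl) (ht := rfl), dh_dh]
    -- The term with `d (d g)` is the value of `φ` at a zero argument.
    have e0 := (hφ.head (q := q + 1 + 1) (by omega) r).lin.map_zero
    rw [e0, zero_add]
    have e1 : (fun r' : Chain D x y (s' + 1) => dif h' φ (.cons (by omega) g r')) = fun r' =>
        φ (.cons (q := q + 1) (by omega) (dh rfl g) r') + (q - 1).negOnePow •
          (mulFn g (by omega) φ r' + dif rfl (fun r'' => φ (.cons (by omega) g r'')) r') := by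
      ext r'
      rw [dif_cons (hq := rfl) (ht := rfl)]
    rw [e1, mulFn_dif g (by omega) h' rfl rfl hφ, dif_add, dif_usmul, dif_add,
      ih rfl rfl (hφ.tail _ g), add_zero]
    simp only [smul_add, smul_smul, ← Int.negOnePow_add]
    -- With these signs each remaining term occurs twice, with opposite signs.
    rw [show (q + 1 - 1).negOnePow = -(q - 1).negOnePow by rw [← Int.negOnePow_succ]; congr 1; ring,
      show (q - 1 + (q - 1)).negOnePow = - (q - 1 + q).negOnePow by rw [← Int.negOnePow_succ]; apply negOnePow_congr; grind]
    simp only [Units.neg_smul]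
    abel

end Chain
end DGCat

/-! ### Cochains, cup products and the differential twisted by dg functors. -/

namespace DGCat

variable {k : Type u} [CommRing k]

open Chain

/-- Cochains of degree `p`: families of functions which send a chain `y → y'` in `E` of shifted
degree `s` to a morphism `F y → G y'` in `T` of degree `p + s`. -/
def Coch (E T : DGCat k) (F G : E.Obj → T.Obj) (p : ℤ) : Type u :=
  ∀ (y y' : E.Obj) (s : ℤ) (n : {n : ℤ // p + s = n}), Chain E y y' s → T.Hom (F y) (G y') n.1

namespace Coch

variable {E T : DGCat k} {F G H K : E.Obj → T.Obj} {p q n : ℤ}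

instance : AddCommGroup (Coch E T F G p) := inferInstanceAs (AddCommGroup (∀ _ _ _ _, _ → _))
instance : Module k (Coch E T F G p) := inferInstanceAs (Module k (∀ _ _ _ _, _ → _))

/-- The value of a cochain on a chain. -/
def ev (φ : Coch E T F G p) {y y' : E.Obj} {s n : ℤ} (h : p + s = n) (c : Chain E y y' s) :
    T.Hom (F y) (G y') n := φ y y' s ⟨n, h⟩ c

@[ext]
theorem ext {φ ψ : Coch E T F G p}
    (h : ∀ (y y' : E.Obj) (s n : ℤ) (e : p + s = n) (c : Chain E y y' s), φ.ev e c = ψ.ev e c) :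
    φ = ψ := by
  funext y y' s n c
  exact h y y' s n.1 n.2 c

/-- The cochain with the given values. -/
def of (f : ∀ {y y' : E.Obj} {s n : ℤ}, p + s = n → Chain E y y' s → T.Hom (F y) (G y') n) :
    Coch E T F G p := fun _ _ _ n c => f n.2 c

@[simp] theorem add_ev (φ ψ : Coch E T F G p) {y y' : E.Obj} {s n : ℤ} (h : p + s = n)
    (c : Chain E y y' s) : (φ + ψ).ev h c = φ.ev h c + ψ.ev h c := rfl

@[simp] theorem sub_ev (φ ψ : Coch E T F G p) {y y' : E.Obj} {s n : ℤ} (h : p + s = n)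
    (c : Chain E y y' s) : (φ - ψ).ev h c = φ.ev h c - ψ.ev h c := rfl

@[simp] theorem neg_ev (φ : Coch E T F G p) {y y' : E.Obj} {s n : ℤ} (h : p + s = n)
    (c : Chain E y y' s) : (-φ).ev h c = -φ.ev h c := rfl

@[simp] theorem zero_ev {y y' : E.Obj} {s n : ℤ} (h : p + s = n)
    (c : Chain E y y' s) : (0 : Coch E T F G p).ev h c = 0 := rfl

@[simp] theorem smul_ev (a : k) (φ : Coch E T F G p) {y y' : E.Obj} {s n : ℤ} (h : p + s = n)
    (c : Chain E y y' s) : (a • φ).ev h c = a • φ.ev h c := rfl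

/-- The evaluation of cochains, as a linear map. -/
def evₗ {y y' : E.Obj} {s n : ℤ} (h : p + s = n) (c : Chain E y y' s) :
    Coch E T F G p →ₗ[k] T.Hom (F y) (G y') n where
  toFun φ := φ.ev h c
  map_add' _ _ := rfl
  map_smul' _ _ := rfl

theorem evₗ_apply (φ : Coch E T F G p) {y y' : E.Obj} {s n : ℤ} (h : p + s = n)
    (c : Chain E y y' s) : evₗ h c φ = φ.ev h c := rfl

@[simp] theorem usmul_ev (a : ℤˣ) (φ : Coch E T F G p) {y y' : E.Obj} {s n : ℤ} (h : p + s = n)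
    (c : Chain E y y' s) : (a • φ).ev h c = a • φ.ev h c := map_usmul (evₗ h c) a φ

theorem hc_ev (φ : Coch E T F G p) {y y' : E.Obj} {s n m : ℤ} (h : p + s = n) (e : n = m)
    (c : Chain E y y' s) : hc e (φ.ev h c) = φ.ev (h.trans e) c := by
  subst e; rfl

/-- The cup product of cochains. -/
def cup (h : p + q = n) (φ : Coch E T G H p) (ψ : Coch E T F G q) : Coch E T F H n :=
  of fun e c => c.splitSum fun _ a b e' l r => (q * a).negOnePow •
    T.comp (p := p + a) (q := q + b) (by omega) (φ.ev rfl l) (ψ.ev rfl r)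

theorem cup_ev (h : p + q = n) (φ : Coch E T G H p) (ψ : Coch E T F G q) {y y' : E.Obj} {s m : ℤ}
    (e : n + s = m) (c : Chain E y y' s) : (cup h φ ψ).ev e c =
      c.splitSum fun _ a b e' l r => (q * a).negOnePow •
        T.comp (p := p + a) (q := q + b) (by omega) (φ.ev rfl l) (ψ.ev rfl r) := rfl

theorem comp_ev {x y z : E.Obj} {a b p' q' m : ℤ} (h : p' + q' = m) (hp : p + a = p')
    (hq : q + b = q') (φ : Coch E T G H p) (ψ : Coch E T F G q) (l : Chain E y z a)
    (r : Chain E x y b) : T.comp (p := p + a) (q := q + b) (by omega) (φ.ev rfl l) (ψ.ev rfl r) =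
      T.comp h (φ.ev hp l) (ψ.ev hq r) := by
  subst hp hq; rfl

theorem cup_add_left (h : p + q = n) (φ φ' : Coch E T G H p) (ψ : Coch E T F G q) :
    cup h (φ + φ') ψ = cup h φ ψ + cup h φ' ψ := by
  ext
  simp only [cup_ev, add_ev, map_add, LinearMap.add_apply, smul_add, splitSum_add]

theorem cup_add_right (h : p + q = n) (φ : Coch E T G H p) (ψ ψ' : Coch E T F G q) :
    cup h φ (ψ + ψ') = cup h φ ψ + cup h φ ψ' := by
  ext
  simp only [cup_ev, add_ev, map_add, smul_add, splitSum_add]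

theorem cup_smul_left (h : p + q = n) (a : k) (φ : Coch E T G H p) (ψ : Coch E T F G q) :
    cup h (a • φ) ψ = a • cup h φ ψ := by
  ext y y' s m e c
  rw [smul_ev, cup_ev, cup_ev, ← LinearMap.lsmul_apply (R := k) (M := T.Hom (F y) (H y') m) a,
    map_splitSum]
  apply splitSum_congr
  intros
  rw [smul_ev, map_smul, LinearMap.smul_apply, LinearMap.lsmul_apply, smul_comm]

theorem cup_smul_right (h : p + q = n) (a : k) (φ : Coch E T G H p) (ψ : Coch E T F G q) :
    cup h φ (a • ψ) = a • cup h φ ψ := by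
  ext y y' s m e c
  rw [smul_ev, cup_ev, cup_ev, ← LinearMap.lsmul_apply (R := k) (M := T.Hom (F y) (H y') m) a,
    map_splitSum]
  apply splitSum_congr
  intros
  rw [smul_ev, map_smul, LinearMap.lsmul_apply, smul_comm]

/-- The cup product as a bilinear map. -/
def cupₗ (h : p + q = n) :
    Coch E T G H p →ₗ[k] Coch E T F G q →ₗ[k] Coch E T F H n :=
  LinearMap.mk₂ k (cup h) (cup_add_left h) (cup_smul_left h) (cup_add_right h) (cup_smul_right h)

theorem cup_usmul_left (h : p + q = n) (a : ℤˣ) (φ : Coch E T G H p) (ψ : Coch E T F G q) :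
    cup h (a • φ) ψ = a • cup h φ ψ := map_usmul ((cupₗ h).flip ψ) a φ

theorem cup_usmul_right (h : p + q = n) (a : ℤˣ) (φ : Coch E T G H p) (ψ : Coch E T F G q) :
    cup h φ (a • ψ) = a • cup h φ ψ := map_usmul (cupₗ h φ) a ψ

theorem cup_neg_left (h : p + q = n) (φ : Coch E T G H p) (ψ : Coch E T F G q) :
    cup h (-φ) ψ = -cup h φ ψ := map_neg ((cupₗ h).flip ψ) φ

theorem cup_neg_right (h : p + q = n) (φ : Coch E T G H p) (ψ : Coch E T F G q) :
    cup h φ (-ψ) = -cup h φ ψ := map_neg (cupₗ h φ) ψ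

theorem cup_zero_left (h : p + q = n) (ψ : Coch E T F G q) :
    cup h (0 : Coch E T G H p) ψ = 0 := map_zero ((cupₗ h).flip ψ)

theorem cup_zero_right (h : p + q = n) (φ : Coch E T G H p) :
    cup h φ (0 : Coch E T F G q) = 0 := map_zero (cupₗ h φ)

/-- Coassociativity of cuts together with associativity in `T`; both sides are compared with one sum
over pairs of cuts. -/
theorem cup_assoc {p₁ p₂ p₃ p₁₂ p₂₃ : ℤ} (h₁ : p₁ + p₂ = p₁₂) (h₂ : p₁₂ + p₃ = n)
    (h₃ : p₂ + p₃ = p₂₃) (h₄ : p₁ + p₂₃ = n) (φ : Coch E T H K p₁) (ψ : Coch E T G H p₂)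
    (χ : Coch E T F G p₃) : cup h₂ (cup h₁ φ ψ) χ = cup h₄ φ (cup h₃ ψ χ) := by
  ext y y' s m e c
  have := splitSum_assoc c fun m₁ m₂ a b e _ l₁ l₂ r => (p₃ * (a + b) + p₂ * a).negOnePow •
    T.comp (p := p₁ + a) (q := p₂₃ + (b + e)) (n := m) (by omega) (φ.ev rfl l₁)
      (T.comp (p := p₂ + b) (q := p₃ + e) (by omega) (ψ.ev rfl l₂) (χ.ev rfl r))
  refine Eq.trans ?_ (this.trans ?_)
  · rw [cup_ev]
    apply splitSum_congr
    intro m₁ ab e h l r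
    rw [cup_ev, ← LinearMap.flip_apply, map_splitSum, ← splitSum_usmul]
    apply splitSum_congr
    intro m₂ a b h' l₁ l₂
    rw [LinearMap.flip_apply, comp_usmul_left, smul_smul, ← Int.negOnePow_add]
    congr 1
    · rw [h']
    · apply T.assoc
  · rw [cup_ev]
    apply splitSum_congr
    intro m₁ a be h l r
    rw [cup_ev, map_splitSum, ← splitSum_usmul]
    apply splitSum_congr
    intro m₂ b e h' l₁ l₂
    rw [comp_usmul_right, smul_smul, ← Int.negOnePow_add]
    congr 1
    · exact negOnePow_congr (by grind)
    · apply comp_comp_mid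

/-- The part of the differential of cochains which does not involve the functors. -/
def pd (φ : Coch E T F G p) : Coch E T F G (p + 1) :=
  of fun e c => dh (m := _) (by omega) (φ.ev rfl c) +
    p.negOnePow • dif rfl (fun c' => φ.ev (by omega) c') c

theorem pd_ev (φ : Coch E T F G p) {y y' : E.Obj} {s m : ℤ} (e : p + 1 + s = m)
    (c : Chain E y y' s) : φ.pd.ev e c = dh (by omega) (φ.ev rfl c) +
    p.negOnePow • dif rfl (fun c' => φ.ev (by omega) c') c := rfl

theorem pd_ev' (φ : Coch E T F G p) {y y' : E.Obj} {s m l s' : ℤ} (e : p + 1 + s = m) (hl : p + s = l)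
    (hs : s + 1 = s') (c : Chain E y y' s) : φ.pd.ev e c = dh (by omega) (φ.ev hl c) +
    p.negOnePow • dif hs (fun c' => φ.ev (by omega) c') c := by
  subst hl hs; rfl

theorem pd_add (φ ψ : Coch E T F G p) : (φ + ψ).pd = φ.pd + ψ.pd := by
  ext
  simp only [pd_ev, add_ev, map_add, dif_add, smul_add]
  abel_nf

theorem pd_smul (a : k) (φ : Coch E T F G p) : (a • φ).pd = a • φ.pd := by
  ext y y' s m e c
  have := dif_map (LinearMap.lsmul k (T.Hom (F y) (G y') m) a) rfl (fun c' => φ.ev (by omega) c') c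
  simp only [LinearMap.lsmul_apply] at this
  simp only [pd_ev, smul_ev, map_smul, smul_add, ← this]
  rw [smul_comm]

theorem pd_usmul (a : ℤˣ) (φ : Coch E T F G p) : (a • φ).pd = a • φ.pd :=
  map_usmul (LinearMap.mk (AddHom.mk pd pd_add) pd_smul : Coch E T F G p →ₗ[k] Coch E T F G (p + 1)) a φ

theorem pd_neg (φ : Coch E T F G p) : (-φ).pd = -φ.pd := by
  simpa using pd_usmul (-1) φ

/-- The bar differential is a coderivation (`dif_splitSum`) and the differential of `T` satisfies
the Leibniz rule. -/
theorem pd_cup (h : p + q = n) (φ : Coch E T G H p) (ψ : Coch E T F G q) :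
    (cup h φ ψ).pd = cup (by omega) φ.pd ψ + p.negOnePow • cup (by omega) φ ψ.pd := by
  ext y y' s m e c
  rw [pd_ev, add_ev, usmul_ev, cup_ev, cup_ev, cup_ev, map_splitSum]
  have e1 : (fun c' : Chain E y y' (s + 1) => (cup h φ ψ).ev (n := m) (by omega) c') =
    fun c' => splitSum c' fun _ a b e' l r => (q * a).negOnePow •
        T.comp (p := p + a) (q := q + b) (by omega) (φ.ev rfl l) (ψ.ev rfl r) := rfl
  rw [e1, dif_splitSum, ← splitSum_usmul, ← splitSum_usmul, ← splitSum_add, ← splitSum_add]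
  apply splitSum_congr
  intro w a b e' l r
  rw [map_usmul, dh_comp (p' := p + 1 + a) (q' := q + 1 + b) (hp := by omega) (hq := by omega), dif_usmul, dif_usmul,
    pd_ev' _ _ rfl rfl, pd_ev' _ _ rfl rfl, map_add (T.comp _), map_add,
    LinearMap.add_apply, comp_usmul_left, comp_usmul_right]
  -- Composition with a fixed morphism is additive and therefore commutes with `dif`.
  have e2 : dif rfl (fun l' : Chain E w y' (a + 1) => T.comp (p := p + (a + 1)) (q := q + b) (n := m)
      (by omega) (φ.ev rfl l') (ψ.ev rfl r)) l =
      T.comp (p := p + 1 + a) (by omega) (dif rfl (fun l' => φ.ev (by omega) l') l) (ψ.ev rfl r) := by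
    rw [← LinearMap.flip_apply, dif_map]
    congr 1
    ext l'
    exact comp_ev (z := y') (y := w) _ _ _ _ _ _ _
  have e3 : dif rfl (fun r' : Chain E y w (b + 1) => T.comp (p := p + a) (q := q + (b + 1)) (n := m)
      (by omega) (φ.ev rfl l) (ψ.ev rfl r')) r =
      T.comp (q := q + 1 + b) (by omega) (φ.ev rfl l) (dif rfl (fun l' => ψ.ev (by omega) l') r) := by
    rw [dif_map]
    congr 1
    ext l'
    exact comp_ev (z := y') (y := w) _ _ _ _ _ _ _
  rw [e2, e3]
  simp only [smul_add, smul_smul, ← Int.negOnePow_add]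
  subst h
  rw [show (p + q + q * (a + 1)).negOnePow = (q * a + p).negOnePow from negOnePow_congr (by grind),
    show (q * a + (p + a)).negOnePow = (p + (q + 1) * a).negOnePow from negOnePow_congr (by grind),
    show (p + q + (a + q * a)).negOnePow = (p + (q + 1) * a + q).negOnePow from negOnePow_congr (by grind)]
  abel_nf

/-- The evaluation functionals of a cochain are good. -/
def IsGood (φ : Coch E T F G p) : Prop :=
  ∀ ⦃y y' : E.Obj⦄ ⦃s n : ℤ⦄ (h : p + s = n), Good fun c : Chain E y y' s => φ.ev h c

namespace IsGood

variable {φ ψ : Coch E T F G p}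

theorem zero : IsGood (0 : Coch E T F G p) := fun _ _ _ _ _ => Good.zero
theorem add (hφ : IsGood φ) (hψ : IsGood ψ) : IsGood (φ + ψ) := fun _ _ _ _ h => (hφ h).add (hψ h)
theorem sub (hφ : IsGood φ) (hψ : IsGood ψ) : IsGood (φ - ψ) := fun _ _ _ _ h => (hφ h).sub (hψ h)
theorem smul (a : k) (hφ : IsGood φ) : IsGood (a • φ) := fun _ _ _ _ h => (hφ h).smul a
theorem usmul (a : ℤˣ) (hφ : IsGood φ) : IsGood (a • φ) := by
  intro y y' s n h
  simpa using (hφ h).usmul a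

theorem listSum {ι : Type*} (l : List ι) {φ : ι → Coch E T F G p} (h : ∀ i, IsGood (φ i)) :
    IsGood (l.map φ).sum := by
  induction l with
  | nil => exact zero
  | cons i l ih => simpa using (h i).add ih

theorem cup {φ : Coch E T G H p} {ψ : Coch E T F G q} (h : p + q = n) (hφ : IsGood φ)
    (hψ : IsGood ψ) : IsGood (cup h φ ψ) := by
  intro y y' s m e
  refine Good.splitSum (V := T.Hom (F y) (H y') m) (F := fun _ a b e' l r => (q * a).negOnePow •
    T.comp (p := p + a) (q := q + b) (by omega) (φ.ev rfl l) (ψ.ev rfl r))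
    (fun w a b e r => ?_) (fun w a b e l => ?_)
  · exact ((hφ (rfl : p + a = _)).map ((T.comp (p := p + a) (q := q + b) (n := m) (by omega)).flip (ψ.ev rfl r))).usmul _
  · exact ((hψ (rfl : q + b = _)).map (T.comp (p := p + a) (q := q + b) (n := m) (by omega) (φ.ev rfl l))).usmul _

end IsGood

/-- The differential of `T` and the bar differential each have square zero, and the mixed terms
cancel since the sign changes with the degree of the cochain. -/
theorem pd_pd {φ : Coch E T F G p} (hφ : IsGood φ) : φ.pd.pd = 0 := by
  ext y y' s m e c
  have e1 : (fun c' : Chain E y y' (s + 1) => φ.pd.ev (n := m) (by omega) c') = fun c' =>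
      dh (m := p + 1 + s) (by omega) (φ.ev (by omega) c') +
        p.negOnePow • dif rfl (fun c'' => φ.ev (by omega) c'') c' := by
    ext c'
    exact pd_ev' _ _ _ _ _
  rw [pd_ev, pd_ev' _ _ rfl rfl, e1, dif_add, dif_usmul, dif_dif _ _ (hφ _), map_add, map_usmul,
    dh_dh, dif_map, Int.negOnePow_succ]
  simp

/-- The Maurer-Cartan cochain of a dg functor `F`: it sends a chain which consists of one morphism
`g` to `F g`, and all other chains to `0`. -/
def tauEv {φ : E.Obj → T.Obj} (F : DGFunctor E T φ) {y : E.Obj} : {y' : E.Obj} → {s n : ℤ} →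
    1 + s = n → Chain E y y' s → T.Hom (φ y) (φ y') n
  | _, _, _, _, .nil _ => 0
  | _, _, _, h, .cons h₁ g (.nil h₀) => hc (by omega) (F.map g)
  | _, _, _, _, .cons _ _ (.cons _ _ _) => 0

/-- The Maurer-Cartan cochain of a dg functor. -/
def tau {φ : E.Obj → T.Obj} (F : DGFunctor E T φ) : Coch E T φ φ 1 := of (tauEv F)

section tau

variable {φ : E.Obj → T.Obj} (Φ : DGFunctor E T φ)

theorem tau_nil {y : E.Obj} {s n : ℤ} (h : 1 + s = n) (h₀ : s = 0) :
    (tau Φ).ev h (.nil (x := y) h₀) = 0 := rfl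

theorem tau_single {y z : E.Obj} {q s s' n : ℤ} (h : 1 + s = n) (h₁ : (q - 1) + s' = s)
    (g : E.Hom y z q) (h₀ : s' = 0) :
    (tau Φ).ev h (.cons h₁ g (.nil h₀)) = hc (by omega) (Φ.map g) := rfl

theorem tau_cons_cons {x y z w : E.Obj} {q s s' n q' s'' : ℤ} (h : 1 + s = n)
    (h₁ : (q - 1) + s' = s) (g : E.Hom z w q) (h₂ : (q' - 1) + s'' = s') (g' : E.Hom y z q')
    (r : Chain E x y s'') : (tau Φ).ev h (.cons h₁ g (.cons h₂ g' r)) = 0 := rfl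

/-- This Maurer-Cartan equation is the definition of a dg functor: on chains of length one it is
compatibility with differentials, on chains of length two compatibility with composition, and on all
others both sides vanish. -/
theorem pd_tau : (tau Φ).pd = -cup rfl (tau Φ) (tau Φ) := by
  ext y y' s n e c
  rw [pd_ev, neg_ev, cup_ev]
  cases c with
  | nil hs =>
    simp [splitSum_nil, dif_nil, tau_nil]
  | @cons y z q s' _ h₁ g r =>
    rw [dif_cons (hq := rfl) (ht := rfl), splitSum_cons]
    cases r with
    | nil hs =>
      subst hs
      simp [splitSum_nil, tau_nil, mulFn_nil, dif_nil, tau_single, Φ.map_dh, hc_dh, dh_hc]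
    | @cons w _ q' s' _ h₂ g' r =>
      rw [mulFn_cons (hm := rfl), dif_cons (hq := rfl) (ht := rfl), splitSum_cons]
      cases r with
      | nil hs =>
        subst hs
        simp [splitSum_nil, tau_nil, mulFn_nil, dif_nil, tau_single, Φ.map_comp, comp_hc_left, comp_hc_right, hc_comp, tau_cons_cons]
      | cons h₃ g'' r =>
        simp [tau_nil, tau_cons_cons, mulFn_cons (hm := rfl), dif_zero, splitSum_zero]

/-- The differential of cochains with respect to dg functors. -/
def dC {ψ : E.Obj → T.Obj} (Ψ : DGFunctor E T ψ) (Φ : DGFunctor E T φ) (f : Coch E T φ ψ p) :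
    Coch E T φ ψ (p + 1) :=
  f.pd + (cup (add_comm 1 p) (tau Ψ) f - p.negOnePow • cup rfl f (tau Φ))

variable {ψ χ : E.Obj → T.Obj} (Ψ : DGFunctor E T ψ) (X : DGFunctor E T χ)

theorem dC_add (f g : Coch E T φ ψ p) : dC Ψ Φ (f + g) = dC Ψ Φ f + dC Ψ Φ g := by
  simp only [dC, pd_add, cup_add_left, cup_add_right, smul_add]
  abel_nf

theorem dC_smul (a : k) (f : Coch E T φ ψ p) : dC Ψ Φ (a • f) = a • dC Ψ Φ f := by
  simp only [dC, pd_smul, cup_smul_left, cup_smul_right, smul_add, smul_sub]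
  rw [smul_comm a]

/-- Beyond `pd_cup`, the two terms in which the cochain `tau Ψ` of the middle functor stands between
`f` and `g` cancel by associativity. -/
theorem dC_cup (h : p + q = n) (f : Coch E T ψ χ p) (g : Coch E T φ ψ q) :
    dC X Φ (cup h f g) = cup (by omega) (dC X Ψ f) g +
      p.negOnePow • cup (by omega) f (dC Ψ Φ g) := by
  simp only [dC, pd_cup, sub_eq_add_neg, cup_add_left, cup_add_right, smul_add, cup_neg_left,
    cup_neg_right, cup_usmul_left, cup_usmul_right, smul_neg, smul_smul, ← Int.negOnePow_add, h]
  rw [cup_assoc (add_comm 1 p) (by omega) h (add_comm 1 n), cup_assoc h rfl rfl (by omega),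
    cup_assoc (n := n + 1) rfl (by omega) (add_comm 1 q) (by omega)]
  abel_nf

/-- The square of a differential twisted by Maurer-Cartan elements: `pd` squares to zero, and
`pd_tau` cancels the quadratic terms in `tau`. -/
theorem dC_dC {f : Coch E T φ ψ p} (hf : IsGood f) : dC Ψ Φ (dC Ψ Φ f) = 0 := by
  have e1 : cup (add_comm 1 (p + 1)) (tau Ψ) (cup (add_comm 1 p) (tau Ψ) f) =
    cup (by omega) (cup rfl (tau Ψ) (tau Ψ)) f := (cup_assoc _ _ _ _ _ _ _).symm
  have e2 : cup (show p + 1 + 1 = p + 1 + 1 from rfl) (cup rfl f (tau Φ)) (tau Φ) =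
    cup (by omega) f (cup rfl (tau Φ) (tau Φ)) := cup_assoc _ _ _ _ _ _ _
  have e3 : cup (show p + 1 + 1 = p + 1 + 1 from rfl) (cup (add_comm 1 p) (tau Ψ) f) (tau Φ) =
    cup (by omega) (tau Ψ) (cup rfl f (tau Φ)) := cup_assoc _ _ _ _ _ _ _
  have e4 : p.negOnePow * p.negOnePow = 1 := by simp [← sq]
  simp only [dC, pd_add, sub_eq_add_neg, pd_neg, pd_usmul, pd_cup, pd_pd hf, pd_tau, cup_neg_left,
    cup_neg_right, Int.negOnePow_succ, Int.negOnePow_one, smul_smul, cup_add_left, cup_add_right,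
    cup_usmul_left, cup_usmul_right, smul_add, smul_neg, Units.neg_smul, neg_mul, one_smul, e1, e2,
    e3, e4]
  abel_nf

end tau

end Coch
end DGCat

/-! ### The dg category of dg functors and coherent natural transformations. -/

namespace DGCat

variable {k : Type u} [CommRing k]

open Chain

namespace Coch

variable {E T : DGCat k} {F G H K : E.Obj → T.Obj} {p q n : ℤ}

/-- The values of the identity cochain. -/
def oneEv (F : E.Obj → T.Obj) {y : E.Obj} : {y' : E.Obj} → {s n : ℤ} → 0 + s = n →
    Chain E y y' s → T.Hom (F y) (F y') n
  | _, _, _, h, .nil _ => hc (by omega) (T.idm (F y))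
  | _, _, _, _, .cons _ _ _ => 0

/-- The identity cochain. -/
def one (E T : DGCat k) (F : E.Obj → T.Obj) : Coch E T F F 0 := of (oneEv F)

theorem one_nil {y : E.Obj} {s n : ℤ} (h : 0 + s = n) (h₀ : s = 0) :
    (one E T F).ev h (.nil (x := y) h₀) = hc (by omega) (T.idm (F y)) := rfl

theorem one_cons {x y z : E.Obj} {q s s' n : ℤ} (h : 0 + s = n)
    (h₁ : (q - 1) + s' = s) (g : E.Hom y z q) (r : Chain E x y s') :
    (one E T F).ev h (.cons h₁ g r) = 0 := rfl

theorem idm_comp' {x y : T.Obj} {m n : ℤ} (h : 0 + m = n) (f : T.Hom x y m) :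
    T.comp h (T.idm y) f = hc (by omega) f := by
  obtain rfl : m = n := by omega
  exact T.idm_comp f

theorem comp_idm' {x y : T.Obj} {m n : ℤ} (h : m + 0 = n) (f : T.Hom x y m) :
    T.comp h f (T.idm x) = hc (by omega) f := by
  obtain rfl : m = n := by omega
  exact T.comp_idm f

theorem one_cup (h : 0 + n = n) (φ : Coch E T F G n) : cup h (one E T G) φ = φ := by
  ext y y' s m e c
  rw [cup_ev]
  cases c with
  | nil hs =>
    subst hs
    simp only [splitSum_nil, one_nil, comp_hc_left, idm_comp', hc_ev]
    simp
  | cons h g r =>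
    simp only [splitSum_cons, one_nil, one_cons, comp_hc_left, idm_comp', hc_ev]
    simp [splitSum_zero]

theorem cup_one (h : n + 0 = n) (φ : Coch E T F G n) : cup h φ (one E T F) = φ := by
  ext y y' s m e c
  rw [cup_ev, splitSum_right_nil]
  · simp only [one_nil, comp_hc_right, comp_idm', hc_ev]
    simp
  · intros
    simp [one_cons]

/-- The identity cochain is supported on the empty chain, which has no argument to vary. -/
theorem isGood_one : IsGood (one E T F) := by
  intro y y' s n h y z q κ
  cases κ <;> exact NLin.zero

theorem pd_one : (one E T F).pd = 0 := by
  ext y y' s m e c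
  rw [pd_ev]
  cases c with
  | nil hs =>
    subst hs
    simp [one_nil, dif_nil]
    have : ∀ {m n : ℤ} (h : m + 1 = n) (e : 0 = m), dh h (hc e (T.idm (F y))) = 0 := by
      intro m n h e
      subst h e
      exact d_idm _
    exact this (by omega) rfl
  | cons h g r =>
    rw [dif_cons (hq := rfl) (ht := rfl)]
    simp only [one_cons, dif_zero, map_zero]
    cases r <;> simp [mulFn, one_cons]

theorem dC_one {φ : E.Obj → T.Obj} (Φ : DGFunctor E T φ) : dC Φ Φ (one E T φ) = 0 := by
  simp [dC, pd_one, one_cup, cup_one]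

end Coch

/-- A dg functor together with its action on objects. -/
structure Fn (E T : DGCat k) : Type u where
  obj : E.Obj → T.Obj
  fn : DGFunctor E T obj

/-- The cochains which, together with their differentials, are linear in each argument and vanish
on identities. -/
def CohHom {E T : DGCat k} (Φ Ψ : Fn E T) (p : ℤ) : Submodule k (Coch E T Φ.obj Ψ.obj p) where
  -- Goodness of the differential is part of the condition, so that stability under the differential
  -- follows from `dC_dC` alone.
  carrier := {f | f.IsGood ∧ (Coch.dC Ψ.fn Φ.fn f).IsGood}
  add_mem' ha hb := ⟨ha.1.add hb.1, by rw [Coch.dC_add]; exact ha.2.add hb.2⟩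
  zero_mem' := ⟨.zero, by
    rw [show (0 : Coch E T Φ.obj Ψ.obj p) = (0 : k) • 0 by simp, Coch.dC_smul, zero_smul]
    exact .zero⟩
  smul_mem' a f h := ⟨h.1.smul a, by rw [Coch.dC_smul]; exact h.2.smul a⟩

namespace CohHom

variable {E T : DGCat k} {Φ Ψ X : Fn E T} {p q n : ℤ}

/-- The composition of coherent natural transformations. -/
def comp (h : p + q = n) : CohHom Ψ X p →ₗ[k] CohHom Φ Ψ q →ₗ[k] CohHom Φ X n :=
  LinearMap.mk₂ k
    (fun f g => ⟨Coch.cup h f.1 g.1, f.2.1.cup h g.2.1, by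
      rw [Coch.dC_cup Φ.fn Ψ.fn X.fn]
      exact (f.2.2.cup _ g.2.1).add ((f.2.1.cup _ g.2.2).usmul _)⟩)
    (fun _ _ _ => Subtype.ext (Coch.cup_add_left h _ _ _))
    (fun _ _ _ => Subtype.ext (Coch.cup_smul_left h _ _ _))
    (fun _ _ _ => Subtype.ext (Coch.cup_add_right h _ _ _))
    (fun _ _ _ => Subtype.ext (Coch.cup_smul_right h _ _ _))

/-- The differential of coherent natural transformations. -/
def d : CohHom Φ Ψ n →ₗ[k] CohHom Φ Ψ (n + 1) where
  toFun f := ⟨Coch.dC Ψ.fn Φ.fn f.1, f.2.2, by rw [Coch.dC_dC _ _ f.2.1]; exact .zero⟩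
  map_add' _ _ := Subtype.ext (Coch.dC_add _ _ _ _)
  map_smul' _ _ := Subtype.ext (Coch.dC_smul _ _ _ _)

/-- The identity of a dg functor. -/
def idm (Φ : Fn E T) : CohHom Φ Φ 0 :=
  ⟨Coch.one E T Φ.obj, Coch.isGood_one, by rw [Coch.dC_one]; exact .zero⟩

end CohHom

/-- The dg category of dg functors from `E` to `T` and coherent natural transformations. -/
def Coh (E T : DGCat k) : DGCat k where
  Obj := Fn E T
  Hom Φ Ψ p := CohHom Φ Ψ p
  idm := CohHom.idm
  comp := CohHom.comp
  d := CohHom.d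
  idm_comp f := Subtype.ext (Coch.one_cup (zero_add _) f.1)
  comp_idm f := Subtype.ext (Coch.cup_one (add_zero _) f.1)
  assoc h₁ h₂ h₃ h₄ f g e := Subtype.ext (Coch.cup_assoc h₁ h₂ h₃ h₄ f.1 g.1 e.1)
  d_d f := Subtype.ext (Coch.dC_dC _ _ f.2.1)
  leibniz {Φ Ψ X p q n} h h₁ h₂ f g := Subtype.ext <| by
    refine (Coch.dC_cup Φ.fn Ψ.fn X.fn h f.1 g.1).trans ?_
    rw [Units.smul_def, Units.smul_def]
    rfl

namespace Coh

variable {E T : DGCat k} {p q n : ℤ}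

/-- The action of a dg functor on objects. -/
abbrev obj (Φ : (Coh E T).Obj) : E.Obj → T.Obj := Fn.obj Φ

/-- The dg functor underlying an object of `Coh E T`. -/
abbrev fn (Φ : (Coh E T).Obj) : DGFunctor E T (obj Φ) := Fn.fn Φ

/-- A dg functor as an object of `Coh E T`. -/
abbrev of {φ : E.Obj → T.Obj} (F : DGFunctor E T φ) : (Coh E T).Obj := Fn.mk φ F

variable {Φ Ψ X : (Coh E T).Obj}

/-- The cochain underlying a morphism of `Coh E T`. -/
def val : (Coh E T).Hom Φ Ψ n →ₗ[k] Coch E T (obj Φ) (obj Ψ) n := (CohHom Φ Ψ n).subtype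

theorem val_injective {f g : (Coh E T).Hom Φ Ψ n} (h : val f = val g) : f = g :=
  Subtype.ext h

/-- The morphism of `Coh E T` given by a cochain. -/
def mk (f : Coch E T (obj Φ) (obj Ψ) n) (hf : f.IsGood)
    (hd : (Coch.dC (fn Ψ) (fn Φ) f).IsGood) : (Coh E T).Hom Φ Ψ n :=
  (⟨f, hf, hd⟩ : CohHom Φ Ψ n)

@[simp] theorem val_mk (f : Coch E T (obj Φ) (obj Ψ) n) (hf : f.IsGood)
    (hd : (Coch.dC (fn Ψ) (fn Φ) f).IsGood) : val (mk f hf hd) = f := rfl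

theorem isGood_val (f : (Coh E T).Hom Φ Ψ n) : (val f).IsGood :=
  (show CohHom Φ Ψ n from f).2.1

theorem val_idm : val ((Coh E T).idm Φ) = Coch.one E T (obj Φ) := rfl

theorem val_comp (h : p + q = n) (f : (Coh E T).Hom Ψ X p) (g : (Coh E T).Hom Φ Ψ q) :
    val ((Coh E T).comp h f g) = Coch.cup h (val f) (val g) := rfl

theorem val_d (f : (Coh E T).Hom Φ Ψ n) :
    val ((Coh E T).d f) = Coch.dC (fn Ψ) (fn Φ) (val f) := rfl

end Coh

end DGCat

/-! ### Generators with relations as dg functors into `Coh E T`. -/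

namespace DGCat

variable {k : Type u} [CommRing k]

open Chain

namespace Chain

variable {D : DGCat k} {x y z : D.Obj} {V : Type*} [AddCommGroup V]

/-- The link between the recursive `dif` and the lists `diffs` and `mults` in the relation `d_eps`.
-/
theorem dif_eq_sum {s : ℤ} (φ : Chain D x z (s + 1) → V) (c : Chain D x z s) :
    dif rfl φ c = (c.diffs.map fun w => w.1.negOnePow • φ w.2).sum +
      (c.mults.map fun w => w.1.negOnePow • φ w.2).sum := by
  induction c with
  | nil h => simp [dif, diffs, mults]
  | @cons y z q s t h g r ih =>
    have e : ∀ r : Chain D x y s, mulFn g (by omega) φ r = ((mulHead g h r).map φ).sum := by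
      intro r
      cases r <;> simp [mulFn, mulHead]
    have e2 : dif rfl (fun r' : Chain D x y (s + 1) => φ (.cons (by omega) g r')) r = _ := ih _
    rw [dif_cons (hq := rfl) (ht := rfl), e, e2]
    simp only [diffs, mults, List.map_cons, List.map_append, List.map_map, List.sum_cons,
      List.sum_append, Function.comp_def, Int.negOnePow_zero, one_smul, Int.negOnePow_add, mul_smul,
      sum_map_units_smul, smul_add]
    rw [dh_rfl]
    abel

theorem splitSum_left_nil {s : ℤ} (c : Chain D x z s) (F : SplitFn D x z s V)
    (hF : ∀ {m y a b q a'} (e : a + b = s) (h : (q - 1) + a' = a) (g : D.Hom y z q)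
      (l : Chain D m y a') (r : Chain D x m b), F m a b e (.cons h g l) r = 0) :
    splitSum c F = F z 0 s (by omega) (.nil rfl) c := by
  cases c with
  | nil hs => subst hs; rw [splitSum_nil]
  | cons h g r => simp [splitSum_cons, hF, splitSum_zero]

/-- Meant for left factors supported on chains of length at most one, such as `tau` and its images
under insertion. -/
theorem splitSum_left_short {s : ℤ} (c : Chain D x z s) (F : SplitFn D x z s V)
    (h₁ : ∀ {m y y' a b q a' q' a''} (e : a + b = s) (h : (q - 1) + a' = a) (g : D.Hom y z q)
      (h' : (q' - 1) + a'' = a') (g' : D.Hom y' y q')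
      (l : Chain D m y' a'') (r : Chain D x m b), F m a b e (.cons h g (.cons h' g' l)) r = 0) :
    splitSum c F = F z 0 s (by omega) (.nil rfl) c +
      (c.uncons.map fun w => F w.mid (w.q - 1) w.a w.h
        (.cons (add_zero _) w.last (.nil rfl)) w.rest).sum := by
  cases c with
  | nil hs => subst hs; simp [splitSum_nil, uncons]
  | @cons y z q s' _ h g r =>
    rw [splitSum_cons, splitSum_left_nil]
    · congr 1
      simp only [uncons, List.map_cons, List.map_nil, List.sum_cons, List.sum_nil, add_zero]
      have : ∀ {a : ℤ} (ha : q - 1 = a) (h₁ : (q - 1) + 0 = a) (e : a + s' = s),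
        F y a s' e (.cons h₁ g (.nil rfl)) r =
          F y (q - 1) s' h (.cons (add_zero _) g (.nil rfl)) r := by
        intro a ha h₁ e
        subst ha; rfl
      apply this
      omega
    · intros; apply h₁

theorem splitSum_left_single {s : ℤ} (c : Chain D x z s) (F : SplitFn D x z s V)
    (h₀ : ∀ {b} (e : 0 + b = s) (r : Chain D x z b), F z 0 b e (.nil rfl) r = 0)
    (h₁ : ∀ {m y y' a b q a' q' a''} (e : a + b = s) (h : (q - 1) + a' = a) (g : D.Hom y z q)
      (h' : (q' - 1) + a'' = a') (g' : D.Hom y' y q')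
      (l : Chain D m y' a'') (r : Chain D x m b), F m a b e (.cons h g (.cons h' g' l)) r = 0) :
    splitSum c F = (c.uncons.map fun w => F w.mid (w.q - 1) w.a w.h
      (.cons (add_zero _) w.last (.nil rfl)) w.rest).sum := by
  rw [splitSum_left_short c F h₁, h₀, zero_add]

theorem splitSum_right_short {s : ℤ} (c : Chain D x z s) (F : SplitFn D x z s V)
    (h₁ : ∀ {m y y' a b q b' q' b''} (e : a + b = s) (l : Chain D m z a) (h : (q - 1) + b' = b)
      (g : D.Hom y m q) (h' : (q' - 1) + b'' = b') (g' : D.Hom y' y q')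
      (r : Chain D x y' b''), F m a b e l (.cons h g (.cons h' g' r)) = 0) :
    splitSum c F = F x s 0 (by omega) c (.nil rfl) +
      (c.unsnoc.map fun w => F w.mid w.a (w.q - 1) w.h w.rest
        (.cons (add_zero _) w.first (.nil rfl))).sum := by
  induction c with
  | nil hs => subst hs; simp [splitSum_nil, unsnoc]
  | @cons y z q s' s h g r ih =>
    rw [splitSum_cons, ih _ fun e l => h₁ _ _]
    simp only [unsnoc, List.map_append, List.sum_append, List.map_map]
    rw [← add_assoc (G := V), ← add_assoc (G := V)]
    congr 1
    cases r with
    | nil hs =>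
      subst hs
      obtain rfl : s = q - 1 := by omega
      simp [unsnocHead]
      have : ∀ {a : ℤ} (ha : q - 1 = a) (h₁ : (q - 1) + 0 = a) (e : a + 0 = q - 1),
          F x a 0 e (.cons h₁ g (.nil rfl)) (.nil rfl) =
            F x (q - 1) 0 (add_zero _) (.cons (add_zero _) g (.nil rfl)) (.nil rfl) := by
        intro a ha h₁ e
        subst ha; rfl
      rw [this (by omega)]
      exact add_comm (G := V) _ _
    | cons h' g' r =>
      subst h
      simp [unsnocHead, h₁]

theorem splitSum_right_single {s : ℤ} (c : Chain D x z s) (F : SplitFn D x z s V)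
    (h₀ : ∀ {a b} (e : a + b = s) (l : Chain D x z a) (hb : b = 0), F x a b e l (.nil hb) = 0)
    (h₁ : ∀ {m y y' a b q b' q' b''} (e : a + b = s) (l : Chain D m z a) (h : (q - 1) + b' = b)
      (g : D.Hom y m q) (h' : (q' - 1) + b'' = b') (g' : D.Hom y' y q')
      (r : Chain D x y' b''), F m a b e l (.cons h g (.cons h' g' r)) = 0) :
    splitSum c F = (c.unsnoc.map fun w => F w.mid w.a (w.q - 1) w.h w.rest
      (.cons (add_zero _) w.first (.nil rfl))).sum := by
  rw [splitSum_right_short c F h₁, h₀, zero_add]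

end Chain

namespace Coch

variable {E T : DGCat k} {φ ψ : E.Obj → T.Obj} {p : ℤ}

/-- The cup products with `tau` see only cuts which detach one morphism at an end; these are the two
outer terms of the relation `d_eps`. -/
theorem dC_ev (Ψ : DGFunctor E T ψ) (Φ : DGFunctor E T φ) (f : Coch E T φ ψ p) {y y' : E.Obj}
    {s n : ℤ} (h : p + s = n) (c : Chain E y y' s) :
    (dC Ψ Φ f).ev (n := n + 1) (by omega) c = T.d (f.ev h c)
      + (c.diffs.map fun w => (p + w.1).negOnePow • f.ev (n := n + 1) (by omega) w.2).sum
      + (c.mults.map fun w => (p + w.1).negOnePow • f.ev (n := n + 1) (by omega) w.2).sum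
      + (c.uncons.map fun w => (p * (w.q - 1)).negOnePow •
          T.comp (p := w.q) (q := p + w.a) (n := n + 1) (by have := w.h; omega)
            (Ψ.map w.last) (f.ev rfl w.rest)).sum
      - (c.unsnoc.map fun w => (p + w.a).negOnePow •
          T.comp (p := p + w.a) (q := w.q) (n := n + 1) (by have := w.h; omega)
            (f.ev rfl w.rest) (Φ.map w.first)).sum := by
  rw [dC, add_ev, sub_ev, usmul_ev, pd_ev' _ _ h rfl, dif_eq_sum, cup_ev, cup_ev,
    splitSum_left_single, splitSum_right_single]
  · simp only [tau_single, comp_hc_left, comp_hc_right, Int.negOnePow_add, mul_smul,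
      sum_map_units_smul, smul_add, one_mul, dh_rfl]
    abel
  · intros; simp [tau_nil]
  · intros; simp [tau_cons_cons]
  · intros; simp [tau_nil]
  · intros; simp [tau_cons_cons]

end Coch

/-- The composition of dg functors. -/
def DGFunctor.comp {A B C : DGCat k} {φ : A.Obj → B.Obj} {ψ : B.Obj → C.Obj}
    (G : DGFunctor B C ψ) (F : DGFunctor A B φ) : DGFunctor A C (fun x => ψ (φ x)) where
  map := G.map ∘ₗ F.map
  map_idm x := by simp [F.map_idm, G.map_idm]
  map_comp h f g := by simp [F.map_comp, G.map_comp]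
  map_d f := by simp [F.map_d, G.map_d]

/-- The evaluation of coherent natural transformations at an object. -/
def Coh.evalAt {E T : DGCat k} (y : E.Obj) : DGFunctor (Coh E T) T (fun Φ => Coh.obj Φ y) where
  map {_ _ n} := Coch.evₗ (add_zero n) (.nil (x := y) rfl) ∘ₗ Coh.val
  map_idm Φ := rfl
  map_comp {Φ Ψ X p q n} h f g := by
    change (Coch.cup h _ _).ev _ _ = _
    rw [Coch.cup_ev, splitSum_nil, mul_zero, Int.negOnePow_zero, one_smul]
    exact Coch.comp_ev _ _ _ _ _ _ _
  map_d {Φ Ψ n} f := by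
    change (Coch.dC _ _ _).ev _ _ = _
    refine (Coch.dC_ev (n := n) _ _ _ (add_zero n) _).trans ?_
    simp [diffs, mults, uncons, unsnoc]
    rfl

namespace TwistedData

variable {A E T : DGCat k}

/-- The functions `(g₁, …, gₙ) ↦ ε(f; g₁, …, gₙ)`. -/
def cochain (M : TwistedData A E T) {x x' : A.Obj} {p : ℤ} (f : A.Hom x x' p) :
    Coch E T (M.obj x) (M.obj x') p := Coch.of fun h c => M.eps h f c

theorem cochain_ev (M : TwistedData A E T) {x x' : A.Obj} {p : ℤ} (f : A.Hom x x' p)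
    {y y' : E.Obj} {s n : ℤ} (h : p + s = n) (c : Chain E y y' s) :
    (M.cochain f).ev h c = M.eps h f c := rfl

theorem isGood_cochain (M : TwistedData A E T) {x x' : A.Obj} {p : ℤ} (f : A.Hom x x' p) :
    (M.cochain f).IsGood := fun _ _ _ _ h =>
  .of_rel (M.eps_isAdd h f) (M.eps_isSMul h f) (M.eps_hasId h f)

/-- The relation `d_eps`, solved for `ε(df; …)`. -/
theorem dC_cochain (M : TwistedData A E T) {x x' : A.Obj} {p : ℤ} (f : A.Hom x x' p) :
    Coch.dC (M.right x') (M.right x) (M.cochain f) = M.cochain (A.d f) := by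
  ext y y' s n e c
  obtain rfl : n = p + s + 1 := by omega
  rw [Coch.dC_ev _ _ _ rfl, cochain_ev, cochain_ev, M.d_eps]
  simp only [cochain_ev]
  abel

theorem eps_zero (M : TwistedData A E T) {x x' : A.Obj} {y y' : E.Obj} {p s n : ℤ} (h : p + s = n)
    (c : Chain E y y' s) : M.eps h (0 : A.Hom x x' p) c = 0 := by
  simpa using M.eps_smul h 0 0 c

/-- The dg functor from `A` to coherent natural transformations which corresponds to generators
that satisfy the relations. -/
def toCoh (M : TwistedData A E T) : DGFunctor A (Coh E T) (fun x => Coh.of (M.right x)) where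
  map :=
    { toFun := fun f => Coh.mk (M.cochain f) (M.isGood_cochain f)
        (by rw [dC_cochain]; exact M.isGood_cochain _)
      map_add' := fun f g => Coh.val_injective (by ext; exact M.eps_add _ f g _)
      map_smul' := fun a f => Coh.val_injective (by ext; exact M.eps_smul _ a f _) }
  map_idm x := Coh.val_injective <| by
    ext y y' s n e c
    change M.eps e (A.idm x) c = (Coch.one E T (M.obj x)).ev e c
    cases c with
    | nil hs =>
      subst hs
      obtain rfl : n = 0 := by omega
      rw [Coch.one_nil, M.eps_nil, (M.left y).map_idm]
      rfl
    | cons h g r =>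
      rw [Coch.one_cons, M.eps_idm]
      simp [length]
  map_comp h f g := Coh.val_injective <| by
    ext y y' s n e c
    exact M.eps_comp h e f g c
  map_d f := Coh.val_injective (M.dC_cochain f).symm

/-- The generators given by a dg functor to coherent natural transformations. -/
def ofCoh {ob : A.Obj → (Coh E T).Obj} (Φ : DGFunctor A (Coh E T) ob) : TwistedData A E T where
  obj x y := Coh.obj (ob x) y
  left y := (Coh.evalAt y).comp Φ
  right x := Coh.fn (ob x)
  eps h f c := (Coh.val (Φ.map f)).ev h c
  eps_nil y h hs f := by subst hs; rfl
  eps_add h f f' c := by rw [map_add, map_add]; rfl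
  eps_smul h a f c := by rw [map_smul, map_smul]; rfl
  eps_isAdd h f c c₁ c₂ H := (Coh.isGood_val (Φ.map f) h).isAdd H
  eps_isSMul h f a c c₁ H := (Coh.isGood_val (Φ.map f) h).isSMul H
  eps_hasId h f c H := (Coh.isGood_val (Φ.map f) h).hasId H
  eps_idm x h c H := by
    rw [Φ.map_idm, Coh.val_idm]
    cases c with
    | nil hs => simp [length] at H
    | cons _ g r => rfl
  eps_comp hp h f₂ f₁ c := by rw [Φ.map_comp, Coh.val_comp]; rfl
  d_eps h f c := by
    rw [Φ.map_d, Coh.val_d, Coch.dC_ev _ _ _ h]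
    abel

/-- The image of generators under a dg functor. -/
def postcomp {T' : DGCat k} {φ : T.Obj → T'.Obj} (M : TwistedData A E T) (F : DGFunctor T T' φ) :
    TwistedData A E T' where
  obj x y := φ (M.obj x y)
  left y := F.comp (M.left y)
  right x := F.comp (M.right x)
  eps h f c := F.map (M.eps h f c)
  eps_nil y h hs f := by rw [M.eps_nil]; rfl
  eps_add h f f' c := by rw [M.eps_add, map_add]
  eps_smul h a f c := by rw [M.eps_smul, map_smul]
  eps_isAdd h f c c₁ c₂ H := by rw [M.eps_isAdd h f c c₁ c₂ H, map_add]
  eps_isSMul h f a c c₁ H := by rw [M.eps_isSMul h f a c c₁ H, map_smul]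
  eps_hasId h f c H := by rw [M.eps_hasId h f c H, map_zero]
  eps_idm x h c H := by rw [M.eps_idm x h c H, map_zero]
  eps_comp hp h f₂ f₁ c := by
    rw [M.eps_comp, F.map_sum]
    simp only [F.map_units_smul, F.map_comp]
  d_eps h f c := by
    rw [← F.map_d, M.d_eps, map_add, map_sub, map_sub, map_sub]
    simp only [F.map_sum, F.map_units_smul, F.map_comp]
    rfl

end TwistedData

end DGCat

/-! ### Insertion of chains of `D` into chains of `E`, and its recursion. -/

namespace DGCat

variable {k : Type u} [CommRing k]

open Chain

namespace Chain

variable {D : DGCat k} {x y z : D.Obj} {V W : Type*} [AddCommGroup V] [AddCommGroup W]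

theorem cons_hc {q q' s t : ℤ} (e : q = q') (h : (q' - 1) + s = t) (g : D.Hom y z q)
    (r : Chain D x y s) : Chain.cons h (hc e g) r = .cons (by omega) g r := by
  subst e; rfl

theorem append_cons {w : D.Obj} {q a a' b s s' : ℤ} (h : a + b = s) (h₁ : (q - 1) + a' = a)
    (g : D.Hom y z q) (r : Chain D w y a') (c : Chain D x w b) (h₂ : a' + b = s') :
    append h (.cons h₁ g r) c = .cons (by omega) g (append h₂ r c) := by
  subst h₂; rfl

/-- Functions of chains which vanish if some morphism is zero. -/
def Zer {t : ℤ} (φ : Chain D x z t → V) : Prop :=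
  ∀ ⦃y w : D.Obj⦄ ⦃q : ℤ⦄ (κ : Ctx D x y w q z t), φ (κ.plug 0) = 0

theorem Good.zer [Module k V] {t : ℤ} {φ : Chain D x z t → V} (h : Good φ) : Zer φ :=
  fun _ _ _ κ => (h κ).lin.map_zero

namespace Zer

variable {t : ℤ} {φ : Chain D x z t → V}

theorem head (hφ : Zer φ) {v : D.Obj} {q s : ℤ} (h : (q - 1) + s = t) (r : Chain D x v s) :
    φ (.cons (q := q) h 0 r) = 0 := hφ (.hole h r)

theorem tail (hφ : Zer φ) {v : D.Obj} {q s : ℤ} (h : (q - 1) + s = t) (g : D.Hom v z q) :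
    Zer (fun r : Chain D x v s => φ (.cons h g r)) := fun _ _ _ κ => hφ (.cons h g κ)

theorem splitSum {F : SplitFn D x z t V}
    (hl : ∀ m a b e (r : Chain D x m b), Zer (fun l => F m a b e l r))
    (hr : ∀ m a b e (l : Chain D m z a), Zer (fun r => F m a b e l r)) :
    Zer (fun c => c.splitSum F) := by
  intro y w q κ
  induction κ with
  | hole h r =>
    simp only [Ctx.plug, splitSum_cons]
    refine (congrArg₂ (· + ·) ((hr _ _ _ _ _).head _ _) ?_).trans (add_zero 0)
    refine (splitSum_congr r fun m a b e l r' => ?_).trans (splitSum_zero r)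
    exact (hl _ _ _ _ _).head _ _
  | cons h g κ ih =>
    simp only [Ctx.plug, splitSum_cons]
    refine (congrArg₂ (· + ·) (hr _ _ _ _ _ (.cons h g κ)) ?_).trans (add_zero 0)
    exact (ih (F := fun m a b e l r' => F m _ b _ (.cons rfl g l) r')
      (fun m a b e r => (hl _ _ _ _ _).tail _ _) (fun m a b e l => hr _ _ _ _ _))

end Zer

end Chain

namespace TwistedData

variable {D E A : DGCat k} (N : TwistedData D E A) {V W : Type*} [AddCommGroup V] [AddCommGroup W]
  {y y' y₁ y₂ : D.Obj} {z z' : E.Obj} {s t n p q : ℤ}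

/-- The chains obtained by inserting a chain of `D` into a chain of `E`, together with the exponents
of their signs. -/
def brace {y : D.Obj} {z : E.Obj} : {y' : D.Obj} → {z' : E.Obj} → {s t n : ℤ} → s + t = n →
    Chain D y y' s → Chain E z z' t → List (ℤ × Chain A (N.obj y z) (N.obj y' z') n)
  | _, _, _, _, _, _, .nil _, c => [(0, (c.map (N.right y)).cast (by omega))]
  | y', _, _, _, _, _, .cons (q := q) (s := s') _ g r, c =>
      c.splits.flatMap fun w => w.right.splits.flatMap fun v =>
        (brace (n := s' + v.b) rfl r v.right).map fun b =>
          ((q - 1) * w.a + s' * (w.a + v.a) + b.1,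
            Chain.append (b := ((q + v.a) - 1) + (s' + v.b))
              (by have := w.h; have := v.h; omega)
              (w.left.map (N.right y'))
              (.cons rfl (N.eps rfl g v.left) b.2))

/-- The signed sum of the values of a function on the chains obtained by inserting a chain of `D`
into a chain of `E`. -/
def braceSum (e : s + t = n) (g : Chain D y y' s) (c : Chain E z z' t)
    (φ : Chain A (N.obj y z) (N.obj y' z') n → V) : V :=
  ((N.brace e g c).map fun b => b.1.negOnePow • φ b.2).sum

theorem braceSum_add (e : s + t = n) (g : Chain D y y' s) (c : Chain E z z' t)
    (φ ψ : Chain A (N.obj y z) (N.obj y' z') n → V) :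
    N.braceSum e g c (fun b => φ b + ψ b) = N.braceSum e g c φ + N.braceSum e g c ψ := by
  simp only [braceSum, smul_add, List.sum_map_add]

theorem braceSum_zero (e : s + t = n) (g : Chain D y y' s) (c : Chain E z z' t) :
    N.braceSum e g c (fun _ => (0 : V)) = 0 := by
  simp only [braceSum, smul_zero, sum_map_zero']

theorem map_braceSum {F : Type*} [FunLike F V W] [AddMonoidHomClass F V W] (f : F)
    (e : s + t = n) (g : Chain D y y' s) (c : Chain E z z' t)
    (φ : Chain A (N.obj y z) (N.obj y' z') n → V) :
    f (N.braceSum e g c φ) = N.braceSum e g c (fun b => f (φ b)) := by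
  simp only [braceSum, map_list_sum, List.map_map, Function.comp_def, map_usmul]

theorem braceSum_usmul (e : s + t = n) (g : Chain D y y' s) (c : Chain E z z' t) (u : ℤˣ)
    (φ : Chain A (N.obj y z) (N.obj y' z') n → V) :
    N.braceSum e g c (fun b => u • φ b) = u • N.braceSum e g c φ :=
  (N.map_braceSum (DistribSMul.toAddMonoidHom V u) e g c φ).symm

theorem braceSum_nil (e : s + t = n) (h : s = 0) (c : Chain E z z' t)
    (φ : Chain A (N.obj y z) (N.obj y z') n → V) :
    N.braceSum e (.nil h) c φ = φ ((c.map (N.right y)).cast (by omega)) := by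
  simp [braceSum, brace]

/-- The values of `φ` on chains whose last morphism is a value of the cochain `α`. -/
def insSum (α : Coch E A (N.obj y₁) (N.obj y₂) p) (r : Chain D y y₁ s) (h : (p - 1) + s + t = n)
    (φ : Chain A (N.obj y z) (N.obj y₂ z') n → V) (c : Chain E z z' t) : V :=
  splitSum c fun m a b e l c' => (s * a).negOnePow •
    N.braceSum rfl r c' (fun b' : Chain A (N.obj y z) (N.obj y₁ m) (s + b) =>
      φ (.cons (q := p + a) (by omega) (α.ev rfl l) b'))

theorem insSum_tau_nil (r : Chain D y y₁ s) (h : (1 - 1) + s + t = n) (ht : t = 0)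
    {φ : Chain A (N.obj y z) (N.obj y₁ z) n → V} (hφ : Zer φ) :
    N.insSum (Coch.tau (N.right y₁)) r h φ (.nil ht) = 0 := by
  rw [insSum, splitSum_nil]
  simp only [Coch.tau_nil, hφ.head, braceSum_zero, smul_zero]

/-- Only the cut which detaches the last morphism of `E` survives, so this summand collects the
insertions that end with a lone `h`. -/
theorem insSum_tau_cons {z₁ : E.Obj} {t' : ℤ} (r : Chain D y y₁ s) (h : (1 - 1) + s + t = n)
    (h₁ : (q - 1) + t' = t) (g : E.Hom z₁ z' q) (c : Chain E z z₁ t')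
    {φ : Chain A (N.obj y z) (N.obj y₁ z') n → V} (hφ : Zer φ) :
    N.insSum (Coch.tau (N.right y₁)) r h φ (.cons h₁ g c) =
      (s * (q - 1)).negOnePow • N.braceSum rfl r c
        (fun b => φ (.cons (by omega) ((N.right y₁).map g) b)) := by
  rw [insSum, splitSum_left_single]
  · simp [uncons, Coch.tau_single, cons_hc]
  · intros
    simp only [Coch.tau_nil, hφ.head, braceSum_zero, smul_zero]
  · intros
    simp only [Coch.tau_cons_cons, hφ.head, braceSum_zero, smul_zero]

theorem braceSum_cons_aux {s' : ℤ} (e : s + t = n) (h₁ : (q - 1) + s' = s) (g : D.Hom y₁ y' q)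
    (r : Chain D y y₁ s') (c : Chain E z z' t) (φ : Chain A (N.obj y z) (N.obj y' z') n → V) :
    N.braceSum e (.cons h₁ g r) c φ =
      splitSum c fun m a b e₁ l c' => splitSum c' fun m' a' b' e₂ l' c'' =>
        ((q - 1) * a + s' * (a + a')).negOnePow • N.braceSum rfl r c'' fun b'' =>
          φ (Chain.append (b := ((q + a') - 1) + (s' + b')) (by omega) (l.map (N.right y'))
              (.cons rfl (N.eps rfl g l') b'')) := by
  simp only [braceSum, brace, sum_map_flatMap, List.map_map, Function.comp_def, splitSum,
    Int.negOnePow_add, mul_smul, sum_map_units_smul]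

/-- The recursion for `braceSum`, according to the last morphism. -/
theorem braceSum_cons {s' : ℤ} (e : s + t = n) (h₁ : (q - 1) + s' = s) (g : D.Hom y₁ y' q)
    (r : Chain D y y₁ s') (c : Chain E z z' t) {φ : Chain A (N.obj y z) (N.obj y' z') n → V}
    (hφ : Zer φ) :
    N.braceSum e (.cons h₁ g r) c φ = N.insSum (N.cochain g) r (by omega) φ c +
      N.insSum (Coch.tau (N.right y')) (.cons h₁ g r) (by omega) φ c := by
  -- The part of the double sum with nothing after the last inserted morphism: the chain ends with
  -- `ε(g; …)`.
  have key : ∀ {z' : E.Obj} {t n : ℤ} (e : s + t = n) (c : Chain E z z' t)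
      (φ : Chain A (N.obj y z) (N.obj y' z') n → V),
      (splitSum c fun m' a' b' e₂ l' c'' =>
        ((q - 1) * 0 + s' * (0 + a')).negOnePow • N.braceSum rfl r c'' fun b'' =>
          φ (Chain.append (b := ((q + a') - 1) + (s' + b')) (by omega)
            ((Chain.nil (rfl : (0 : ℤ) = 0)).map (N.right y'))
              (.cons rfl (N.eps rfl g l') b''))) = N.insSum (N.cochain g) r (by omega) φ c := by
    intro z' t n e c φ
    rw [insSum]
    apply splitSum_congr
    intro m a b e l c'
    simp only [mul_zero, zero_add]
    rfl
  cases c with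
  | nil ht =>
    rw [insSum_tau_nil _ _ _ _ hφ, add_zero, braceSum_cons_aux, splitSum_nil, ← key]
    subst ht
    rfl
    exact e
  | cons h₂ f c =>
    rw [insSum_tau_cons _ _ _ _ _ _ hφ, braceSum_cons_aux, splitSum_cons]
    congr 1
    · exact key e _ φ
    -- Otherwise the last morphism of `E` stands alone, and what precedes it is an insertion into
    -- the shorter chain.
    · rw [braceSum_cons_aux, ← splitSum_usmul]
      apply splitSum_congr
      intro m a b e₁ l c'
      rw [← splitSum_usmul]
      apply splitSum_congr
      intro m' a' b' e₂ l' c''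
      rw [smul_smul, ← Int.negOnePow_add]
      congr 1
      · exact negOnePow_congr (by grind)
      · congr 1
        ext b
        rw [Chain.map, append_cons (h₂ := _)]

end TwistedData
end DGCat

/-! ### Multilinearity of insertion, and insertion of cup products. -/

namespace DGCat

variable {k : Type u} [CommRing k]

open Chain

theorem NLin.comp {D A : DGCat k} {y z : D.Obj} {y' z' : A.Obj} {q q' : ℤ} {V : Type*}
    [AddCommGroup V] [Module k V] {f : A.Hom y' z' q' → V} (hf : NLin f)
    (L : D.Hom y z q →ₗ[k] A.Hom y' z' q') (hL : ∀ g, IsIdm g → f (L g) = 0) :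
    NLin (fun g => f (L g)) :=
  ⟨(hf.lin.mk' f ∘ₗ L).isLinear, hL⟩

theorem DGFunctor.isIdm_map {D A : DGCat k} {φ : D.Obj → A.Obj} (F : DGFunctor D A φ) {y z : D.Obj}
    {q : ℤ} {g : D.Hom y z q} (hg : IsIdm g) : IsIdm (F.map g) := by
  cases hg
  rw [F.map_idm]
  exact .mk _

namespace Chain

variable {D A : DGCat k} {x y z : D.Obj} {V : Type*} [AddCommGroup V]

@[simp] theorem cast_rfl {s : ℤ} (h : s = s) (c : Chain D x y s) : c.cast h = c := by
  cases c <;> rfl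

theorem Good.chainMap [Module k V] {φ : D.Obj → A.Obj} (F : DGFunctor D A φ) {s t : ℤ} (e : s = t)
    {f : Chain A (φ x) (φ y) t → V} (hf : Good f) :
    Good (fun c : Chain D x y s => f ((c.map F).cast e)) := by
  subst e
  simp only [cast_rfl]
  exact .of_rel (fun _ _ _ h => hf.isAdd (h.map F)) (fun _ _ _ h => hf.isSMul (h.map F))
    (fun _ h => hf.hasId (h.map F))

theorem dif_chainMap {φ : D.Obj → A.Obj} (F : DGFunctor D A φ) {s s' t t' : ℤ} (e : s = t)
    (h : t + 1 = t') (hs : s + 1 = s') (f : Chain A (φ x) (φ y) t' → V) (c : Chain D x y s) :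
    dif h f ((c.map F).cast e) = dif hs (fun c => f ((c.map F).cast (by omega))) c := by
  subst e h
  obtain rfl := hs
  simp only [cast_rfl]
  rw [dif_eq_sum, dif_eq_sum, diffs_map, mults_map]
  simp only [List.map_map]
  rfl

theorem dif_splitSum_comm {E : DGCat k} {z₁ z₂ : E.Obj} {s s' t : ℤ} (h : s + 1 = s')
    (c : Chain E z₁ z₂ t) (F : Chain D x y s' → SplitFn E z₁ z₂ t V) (r : Chain D x y s) :
    dif h (fun r' => splitSum c (F r')) r =
      splitSum c fun m a b e l c' => dif h (fun r' => F r' m a b e l c') r :=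
  dif_sum _ _ _ _

/-- The functional `mulFn g h φ` need not be normalized, as `g ∘ id = g`. Vanishing at zero
arguments is what survives, and it suffices for `braceSum_cons`. -/
theorem zer_mulFn [Module k V] {q s t : ℤ} (g : D.Hom y z q) (h : q + s = t)
    {φ : Chain D x z t → V} (hφ : Good φ) : Zer (mulFn g h φ) := by
  intro v w q' κ
  cases κ with
  | hole h₁ r =>
    rw [Ctx.plug, mulFn_cons (hm := rfl), map_zero]
    exact hφ.zer.head _ _
  | cons h₁ g' κ =>
    rw [Ctx.plug, mulFn_cons (hm := rfl)]
    exact (hφ.tail _ _).zer κ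

end Chain

namespace TwistedData

variable {D E A : DGCat k} (N : TwistedData D E A) {V W : Type*} [AddCommGroup V] [Module k V]
  [AddCommGroup W]
  {y y' y₁ y₂ : D.Obj} {z z' : E.Obj} {s t n p q : ℤ}

theorem braceSum_cons_congr {x' : A.Obj} {q' n n' m : ℤ} (e : s + t = n)
    (e' : s + t = n') (r : Chain D y y₁ s) (c : Chain E z z' t) (φ : Chain A (N.obj y z) x' m → W)
    (hq : q = q') (h : (q - 1) + n = m) (f : A.Hom (N.obj y₁ z') x' q) :
    N.braceSum e r c (fun b => φ (.cons h f b)) =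
      N.braceSum e' r c (fun b => φ (.cons (q := q') (s := n') (by omega) (hc hq f) b)) := by
  subst hq e e'
  rfl

theorem nlin_braceSum_cons {x' : A.Obj} {n m : ℤ} (e : s + t = n) (r : Chain D y y₁ s)
    (c : Chain E z z' t) {φ : Chain A (N.obj y z) x' m → V} (hφ : Good φ) (h : (q - 1) + n = m) :
    NLin (fun f : A.Hom (N.obj y₁ z') x' q => N.braceSum e r c fun b => φ (.cons h f b)) :=
  NLin.listSum _ fun b => (hφ.head h b.2).usmul _

/-- At an identity there are two cases: `ε(id; )` is an identity, which `f` kills, and `ε(id; l)` is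
zero for non-empty `l`. -/
theorem nlin_eps {q' : ℤ} {y₁ y₂ : D.Obj} (h : q + t = q') (l : Chain E z z' t)
    {f : A.Hom (N.obj y₁ z) (N.obj y₂ z') q' → V} (hf : NLin f) :
    NLin (fun g : D.Hom y₁ y₂ q => f (N.eps h g l)) := by
  refine ⟨⟨fun a b => ?_, fun r a => ?_⟩, fun g hg => ?_⟩
  · rw [N.eps_add, hf.lin.map_add]
  · rw [N.eps_smul, hf.lin.map_smul]
  · cases hg
    cases l with
    | nil h₀ =>
      subst h₀
      obtain rfl : q' = 0 := by omega
      rw [N.eps_nil]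
      exact hf.idm _ ((N.left _).isIdm_map (.mk _))
    | cons h₁ g r =>
      rw [N.eps_idm _ _ _ (by simp [length])]
      exact hf.lin.map_zero

theorem nlin_ev {F G : E.Obj → A.Obj} {α : Coch E A F G p} (hα : α.IsGood) {q' : ℤ}
    (h : p + t = q') {f : A.Hom (F z) (G z') q' → V} (hf : NLin f) :
    Good (fun l : Chain E z z' t => f (α.ev h l)) :=
  (hα h).map (hf.lin.mk' f)

theorem good_insSum {α : Coch E A (N.obj y₁) (N.obj y₂) p} (hα : α.IsGood) (r : Chain D y y₁ s)
    (h : (p - 1) + s + t = n) {φ : Chain A (N.obj y z) (N.obj y₂ z') n → V} (hφ : Good φ)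
    (H : ∀ {m : E.Obj} {b n : ℤ} (e : s + b = n) (ψ : Chain A (N.obj y z) (N.obj y₁ m) n → V),
      Good ψ → Good (fun c => N.braceSum e r c ψ)) :
    Good (fun c : Chain E z z' t => N.insSum α r h φ c) := by
  refine Good.splitSum (V := V) (F := fun m a b e l c' => (s * a).negOnePow •
    N.braceSum rfl r c' (fun b' : Chain A (N.obj y z) (N.obj y₁ m) (s + b) =>
      φ (.cons (q := p + a) (by omega) (α.ev rfl l) b'))) (fun m a b e c' => ?_) fun m a b e l => ?_
  · exact (nlin_ev hα rfl (N.nlin_braceSum_cons rfl r c' hφ _)).usmul _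
  · exact (H _ _ (hφ.tail _ _)).usmul _

theorem good_braceSum_right (e : s + t = n) (g : Chain D y y' s)
    {φ : Chain A (N.obj y z) (N.obj y' z') n → V} (hφ : Good φ) :
    Good (fun c : Chain E z z' t => N.braceSum e g c φ) := by
  induction g generalizing z' t n with
  | nil h =>
    simp only [braceSum_nil]
    exact hφ.chainMap _ _
  | @cons y₁ y' q s' s h g r ih =>
    intro z₁ z₂ q₁ κ
    have H : ∀ {z' : E.Obj} {t n : ℤ} (h : (q - 1) + s' + t = n)
        {φ : Chain A (N.obj y z) (N.obj y' z') n → V}, Good φ →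
        Good fun c : Chain E z z' t => N.insSum (N.cochain g) r h φ c := by
      intro z' t n h φ hφ
      exact N.good_insSum (N.isGood_cochain g) r _ hφ fun e ψ hψ => ih e hψ
    -- The summand with `ε(g; …)` is settled by the induction over the chain of `D`. The other one
    -- removes the last morphism of `E`, which calls for an induction over the position of the hole.
    induction κ generalizing n with
    | hole h₂ c =>
      simp only [N.braceSum_cons _ _ _ _ _ hφ.zer]
      refine (H _ hφ _).add ?_
      -- Here the hole is the removed morphism itself, and `id ⊗ -` sends identities to identities.
      simp only [Ctx.plug, insSum_tau_cons _ _ _ _ _ _ hφ.zer]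
      exact ((N.nlin_braceSum_cons _ _ _ hφ _).comp ((N.right y').map)
        fun f hf => (N.nlin_braceSum_cons _ _ _ hφ _).idm _ ((N.right y').isIdm_map hf)).usmul _
    | cons h₂ f κ ih' =>
      simp only [N.braceSum_cons _ _ _ _ _ hφ.zer]
      refine (H _ hφ _).add ?_
      simp only [Ctx.plug, insSum_tau_cons _ _ _ _ _ _ hφ.zer]
      exact (ih' _ (hφ.tail _ _)).usmul _

theorem good_braceSum_left (e : s + t = n) (c : Chain E z z' t)
    {φ : Chain A (N.obj y z) (N.obj y' z') n → V} (hφ : Good φ) :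
    Good (fun g : Chain D y y' s => N.braceSum e g c φ) := by
  intro y₁ y₂ q κ
  induction κ generalizing z' t n with
  | hole h r =>
    -- As the lone last `h` leaves the chain of `D` unchanged, an inner induction over the chain of
    -- `E` is needed.
    induction c generalizing n with
    | nil ht =>
      simp only [Ctx.plug, N.braceSum_cons _ _ _ _ _ hφ.zer, insSum_tau_nil _ _ _ _ hφ.zer]
      exact (NLin.splitSum _ fun m a b e l r' =>
        (N.nlin_eps _ _ (N.nlin_braceSum_cons _ _ _ hφ _)).usmul _).add .zero
    | cons h₂ f c ih =>
      simp only [Ctx.plug, N.braceSum_cons _ _ _ _ _ hφ.zer, insSum_tau_cons _ _ _ _ _ _ hφ.zer]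
      exact (NLin.splitSum _ fun m a b e l r' =>
        (N.nlin_eps _ _ (N.nlin_braceSum_cons _ _ _ hφ _)).usmul _).add
        ((ih _ (hφ.tail _ _)).usmul _)
  | cons h g κ ih =>
    induction c generalizing n with
    | nil ht =>
      simp only [Ctx.plug, N.braceSum_cons _ _ _ _ _ hφ.zer, insSum_tau_nil _ _ _ _ hφ.zer]
      exact (NLin.splitSum _ fun m a b e l r' => (ih _ _ (hφ.tail _ _)).usmul _).add .zero
    | cons h₂ f c ih' =>
      simp only [Ctx.plug, N.braceSum_cons _ _ _ _ _ hφ.zer, insSum_tau_cons _ _ _ _ _ _ hφ.zer]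
      exact (NLin.splitSum _ fun m a b e l r' => (ih _ _ (hφ.tail _ _)).usmul _).add
        ((ih' _ (hφ.tail _ _)).usmul _)

theorem insSum_add (α β : Coch E A (N.obj y₁) (N.obj y₂) p) (r : Chain D y y₁ s)
    (h : (p - 1) + s + t = n) {φ : Chain A (N.obj y z) (N.obj y₂ z') n → V} (hφ : Good φ)
    (c : Chain E z z' t) :
    N.insSum (α + β) r h φ c = N.insSum α r h φ c + N.insSum β r h φ c := by
  simp only [insSum, ← splitSum_add, ← smul_add, Coch.add_ev]
  apply splitSum_congr
  intro m a b e l c'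
  rw [(N.nlin_braceSum_cons rfl r c' hφ _).lin.map_add]

theorem insSum_usmul (u : ℤˣ) (α : Coch E A (N.obj y₁) (N.obj y₂) p) (r : Chain D y y₁ s)
    (h : (p - 1) + s + t = n) {φ : Chain A (N.obj y z) (N.obj y₂ z') n → V} (hφ : Good φ)
    (c : Chain E z z' t) :
    N.insSum (u • α) r h φ c = u • N.insSum α r h φ c := by
  simp only [insSum, ← splitSum_usmul, Coch.usmul_ev]
  apply splitSum_congr
  intro m a b e l c'
  rw [smul_comm u]
  congr 1
  exact map_usmul ((N.nlin_braceSum_cons rfl r c' hφ _).lin.mk' _) u _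

theorem insSum_neg (α : Coch E A (N.obj y₁) (N.obj y₂) p) (r : Chain D y y₁ s)
    (h : (p - 1) + s + t = n) {φ : Chain A (N.obj y z) (N.obj y₂ z') n → V} (hφ : Good φ)
    (c : Chain E z z' t) : N.insSum (-α) r h φ c = - N.insSum α r h φ c := by
  simpa using N.insSum_usmul (-1) α r h hφ c

/-- The insertion of a cup product. -/
theorem insSum_cup {p₁ p₂ s₁ : ℤ} (hp : p + p₁ = p₂) (hs : (p₁ - 1) + s₁ = s)
    (α : Coch E A (N.obj y₁) (N.obj y₂) p) {y₀ : D.Obj} (β : Coch E A (N.obj y₀) (N.obj y₁) p₁)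
    (r : Chain D y y₀ s₁) (h : p + s + t = n)
    {φ : Chain A (N.obj y z) (N.obj y₂ z') n → V} (hφ : Good φ) (c : Chain E z z' t) :
    (splitSum c fun m a b e l c' => (s * a + a).negOnePow •
      N.insSum (n := s + b) β r (by omega) (mulFn (α.ev rfl l) (by omega) φ) c') =
    N.insSum (Coch.cup hp α β) r (by omega) φ c := by
  -- Both sides are sums over two cuts, for the arguments of `α`, those of `β`, and the rest.
  have := splitSum_assoc c fun m₁ m₂ a b e _ l₁ l₂ c' =>
    (s₁ * (a + b) + p₁ * a).negOnePow • N.braceSum rfl r c'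
      (fun b' : Chain A (N.obj y z) (N.obj y₀ m₁) (s₁ + e) =>
        φ (.cons (q := p₂ + (a + b)) (by omega)
          (A.comp (by omega) (α.ev rfl l₁) (β.ev rfl l₂)) b'))
  refine Eq.trans ?_ (this.symm.trans ?_)
  · apply splitSum_congr
    intro m a b e l c'
    rw [insSum, ← splitSum_usmul]
    apply splitSum_congr
    intro m' a' b' e' l' c''
    rw [smul_smul, ← Int.negOnePow_add]
    congr 1
    · exact negOnePow_congr (by subst hs; grind)
    · congr 1
      ext b
      rw [mulFn_cons (hm := _)]
  · rw [insSum]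
    apply splitSum_congr
    intro m a b e l c'
    rw [Coch.cup_ev]
    -- Linearity in the head of the chain moves the sum which defines the cup product out of `φ`.
    have := map_splitSum ((N.nlin_braceSum_cons rfl r c' hφ (show p₂ + a - 1 + (s₁ + b) = n by omega)).lin.mk' _) l fun _ a' b' e' l₁ l₂ => (p₁ * a').negOnePow •
        A.comp (p := p + a') (q := p₁ + b') (by omega) (α.ev rfl l₁) (β.ev rfl l₂)
    refine Eq.trans ?_ (congrArg _ this.symm)
    rw [← splitSum_usmul]
    apply splitSum_congr
    intro m' a' b' e' l₁ l₂
    rw [map_usmul, smul_smul, ← Int.negOnePow_add]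
    have key : ∀ {a₁ : ℤ} (_ : a' + b' = a₁) (h₁ : p₂ + a₁ - 1 + (s₁ + b) = n)
        (h₂ : p₂ + (a' + b') - 1 + (s₁ + b) = n) (h₃ : p + a' + (p₁ + b') = p₂ + a₁)
        (h₄ : p + a' + (p₁ + b') = p₂ + (a' + b')),
        N.braceSum rfl r c' (fun b'' : Chain A (N.obj y z) (N.obj y₀ m) (s₁ + b) =>
          φ (.cons h₂ (A.comp h₄ (α.ev rfl l₁) (β.ev rfl l₂)) b'')) =
        N.braceSum rfl r c' (fun b'' : Chain A (N.obj y z) (N.obj y₀ m) (s₁ + b) =>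
          φ (.cons h₁ (A.comp h₃ (α.ev rfl l₁) (β.ev rfl l₂)) b'')) := by
      intro a₁ ha h₁ h₂ h₃ h₄
      subst ha
      rfl
    refine congrArg₂ (· • ·) (by rw [e']) (key e' (by omega) (by omega) (by omega) (by omega))

end TwistedData
end DGCat

/-! ### Insertion commutes with the bar differentials. -/

namespace DGCat

variable {k : Type u} [CommRing k]

open Chain

namespace TwistedData

variable {D E A : DGCat k} (N : TwistedData D E A) {V W : Type*} [AddCommGroup V] [Module k V]
  [AddCommGroup W]
  {y y' y₁ y₂ : D.Obj} {z z' : E.Obj} {s t n p q : ℤ}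

/-- The compatibility of the insertion of a cochain with the differential of the bar construction,
for chains for which `braceSum` is compatible with it. -/
theorem insSum_dif {n' : ℤ} (α : Coch E A (N.obj y₁) (N.obj y₂) p) (r : Chain D y y₁ s)
    (h : (p - 1) + s + t = n) (hn : n + 1 = n') {φ : Chain A (N.obj y z) (N.obj y₂ z') n' → V}
    (hφ : Good φ) (c : Chain E z z' t)
    (H : ∀ (m : E.Obj) (a b : ℤ) (e : a + b = t) (l : Chain E m z' a) (c' : Chain E z m b),
      l.length + c'.length = c.length →
      N.braceSum (n := s + b) rfl r c' (dif rfl fun b' : Chain A (N.obj y z) (N.obj y₁ m) (s + b + 1) =>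
        φ (.cons (q := p + a) (by omega) (α.ev rfl l) b')) =
      dif rfl (fun r' : Chain D y y₁ (s + 1) => N.braceSum (by omega) r' c'
        fun b' : Chain A (N.obj y z) (N.obj y₁ m) (s + b + 1) =>
          φ (.cons (q := p + a) (by omega) (α.ev rfl l) b')) r +
      s.negOnePow • dif rfl (fun c'' : Chain E z m (b + 1) => N.braceSum (by omega) r c''
        fun b' : Chain A (N.obj y z) (N.obj y₁ m) (s + b + 1) =>
          φ (.cons (q := p + a) (by omega) (α.ev rfl l) b')) c') :
    N.insSum α r h (dif hn φ) c =
      (p - 1 + s).negOnePow • dif rfl (fun c' : Chain E z z' (t + 1) =>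
        N.insSum α r (by omega) φ c') c + N.insSum α.pd r (by omega) φ c +
      (p - 1).negOnePow • (dif rfl (fun r' : Chain D y y₁ (s + 1) =>
        N.insSum α r' (by omega) φ c) r +
      splitSum c fun m a b e l c' => (s * a + a).negOnePow •
        N.braceSum (n := s + b) rfl r c' (mulFn (α.ev rfl l) (by omega) φ)) := by
  simp only [insSum]
  rw [dif_splitSum, dif_splitSum_comm]
  simp only [← splitSum_usmul, ← splitSum_add]
  apply splitSum_congr'
  intro m a b e l c' hl
  -- The bar differential of a chain with head `α(l)` acts on the head, merges it with the next
  -- morphism, or acts on the rest; the hypothesis `H` applies to the last term.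
  have e₁ : N.braceSum rfl r c' (fun b' : Chain A (N.obj y z) (N.obj y₁ m) (s + b) =>
      dif hn φ (.cons (q := p + a) (by omega) (α.ev rfl l) b')) =
      N.braceSum rfl r c' (fun b' : Chain A (N.obj y z) (N.obj y₁ m) (s + b) =>
        φ (.cons (q := p + 1 + a) (by omega) (dh (by omega) (α.ev rfl l)) b')) +
      (p + a - 1).negOnePow • (N.braceSum rfl r c' (mulFn (α.ev rfl l) (by omega) φ) +
        N.braceSum rfl r c' (dif rfl fun b' : Chain A (N.obj y z) (N.obj y₁ m) (s + b + 1) =>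
          φ (.cons (q := p + a) (by omega) (α.ev rfl l) b'))) := by
    rw [← braceSum_add, ← braceSum_usmul, ← braceSum_add]
    congr 1
    ext b'
    rw [dif_cons (hq := show p + a + 1 = p + 1 + a by omega) (ht := rfl)]
  -- The differential of `l` is moved inside `α`; with the differential of the value `α(l)` it makes
  -- up `α.pd`.
  have e₂ : dif rfl (fun l' : Chain E m z' (a + 1) => (s * (a + 1)).negOnePow •
      N.braceSum rfl r c' (fun b' : Chain A (N.obj y z) (N.obj y₁ m) (s + b) =>
        φ (.cons (q := p + (a + 1)) (by omega) (α.ev rfl l') b'))) l =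
      (s * (a + 1)).negOnePow • N.braceSum rfl r c'
        (fun b' : Chain A (N.obj y z) (N.obj y₁ m) (s + b) =>
          φ (.cons (q := p + 1 + a) (by omega) (dif rfl (fun l' => α.ev (by omega) l') l) b')) := by
    rw [dif_usmul]
    congr 1
    refine Eq.trans ?_ (dif_map ((N.nlin_braceSum_cons rfl r c' hφ (q := p + 1 + a) _).lin.mk' _)
      rfl (fun l' => α.ev (by omega) l') l).symm
    congr 1
    ext l'
    refine (N.braceSum_cons_congr (q' := p + 1 + a) rfl rfl r c' φ (by omega) _ _).trans ?_
    rw [Coch.hc_ev]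
    rfl
  have e₃ : dif rfl (fun c'' : Chain E z m (b + 1) => (s * a).negOnePow •
      N.braceSum rfl r c'' (fun b' : Chain A (N.obj y z) (N.obj y₁ m) (s + (b + 1)) =>
        φ (.cons (q := p + a) (by omega) (α.ev rfl l) b'))) c' = (s * a).negOnePow •
      dif rfl (fun c'' : Chain E z m (b + 1) => N.braceSum (by omega) r c''
        fun b' : Chain A (N.obj y z) (N.obj y₁ m) (s + b + 1) =>
          φ (.cons (q := p + a) (by omega) (α.ev rfl l) b')) c' := by
    rw [dif_usmul]
    congr 2
    ext c''
    exact N.braceSum_cons_congr rfl _ r c'' φ rfl _ _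
  have e₄ : dif rfl (fun r' : Chain D y y₁ (s + 1) => ((s + 1) * a).negOnePow •
      N.braceSum rfl r' c' (fun b' : Chain A (N.obj y z) (N.obj y₁ m) (s + 1 + b) =>
        φ (.cons (q := p + a) (by omega) (α.ev rfl l) b'))) r = ((s + 1) * a).negOnePow •
      dif rfl (fun r' : Chain D y y₁ (s + 1) => N.braceSum (by omega) r' c'
        fun b' : Chain A (N.obj y z) (N.obj y₁ m) (s + b + 1) =>
          φ (.cons (q := p + a) (by omega) (α.ev rfl l) b')) r := by
    rw [dif_usmul]
    congr 2
    ext r'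
    exact N.braceSum_cons_congr rfl _ r' c' φ rfl _ _
  have e₅ : N.braceSum rfl r c' (fun b' : Chain A (N.obj y z) (N.obj y₁ m) (s + b) =>
      φ (.cons (q := p + 1 + a) (by omega) (α.pd.ev rfl l) b')) =
      N.braceSum rfl r c' (fun b' : Chain A (N.obj y z) (N.obj y₁ m) (s + b) =>
        φ (.cons (q := p + 1 + a) (by omega) (dh (by omega) (α.ev rfl l)) b')) +
      p.negOnePow • N.braceSum rfl r c' (fun b' : Chain A (N.obj y z) (N.obj y₁ m) (s + b) =>
          φ (.cons (q := p + 1 + a) (by omega) (dif rfl (fun l' => α.ev (by omega) l') l) b')) := by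
    rw [Coch.pd_ev]
    have L := (N.nlin_braceSum_cons rfl r c' hφ
      (show (p + 1 + a) - 1 + (s + b) = n' by omega)).lin
    exact (L.map_add _ _).trans (congrArg _ (map_usmul (L.mk' _) _ _))
  rw [e₁, e₂, e₃, e₄, e₅, H m a b e l c' hl]
  simp only [smul_add, smul_smul, ← Int.negOnePow_add]
  rw [show (s * a + (p + a - 1)).negOnePow = (p - 1 + (s * a + a)).negOnePow from
      negOnePow_congr (by grind),
    show (p - 1 + (s + 1) * a).negOnePow = (p - 1 + (s * a + a)).negOnePow from
      negOnePow_congr (by grind),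
    show (s * a + (p + a - 1 + s)).negOnePow = (p - 1 + s + (a + s * a)).negOnePow from
      negOnePow_congr (by grind),
    show (p - 1 + s + s * (a + 1)).negOnePow = (s * a + p - 1).negOnePow from
      negOnePow_congr (by grind), Int.negOnePow_sub]
  simp only [Int.negOnePow_one, mul_neg, mul_one, Units.neg_smul]
  abel

end TwistedData
end DGCat

namespace DGCat

variable {k : Type u} [CommRing k]

open Chain

/-- An identity at an end of a chain is absorbed by its neighbour, so `dif h φ` need not be
normalized; it still vanishes at zero arguments. -/
theorem Chain.Good.zer_dif {D : DGCat k} {x z : D.Obj} {V : Type*} [AddCommGroup V] [Module k V]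
    {s t : ℤ} (h : s + 1 = t) {φ : Chain D x z t → V} (hφ : Good φ) : Zer (dif h φ) := by
  intro v w q κ
  induction κ generalizing t with
  | hole h₁ r =>
    rw [Ctx.plug, dif_cons (hq := rfl) (ht := rfl), map_zero, hφ.zer.head]
    simp only [hφ.zer.head, dif_zero]
    cases r with
    | nil h => simp [mulFn_nil]
    | cons h g r => simp [mulFn_cons (hm := rfl), hφ.zer.head]
  | cons h₁ g κ ih =>
    rw [Ctx.plug, dif_cons (hq := rfl) (ht := rfl), zer_mulFn _ _ hφ κ, ih _ (hφ.tail _ _)]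
    simp [(hφ.tail _ _).zer κ]

theorem Chain.cons_cast {D : DGCat k} {x y z : D.Obj} {q s s' t : ℤ} (e : s = s')
    (h : (q - 1) + s' = t) (g : D.Hom y z q) (r : Chain D x y s) :
    Chain.cons h g (r.cast e) = .cons (by omega) g r := by
  subst e
  rw [cast_rfl]

namespace TwistedData

variable {D E A : DGCat k} (N : TwistedData D E A) {V W : Type*} [AddCommGroup V] [Module k V]
  [AddCommGroup W]
  {y y' y₁ y₂ : D.Obj} {z z' : E.Obj} {s t n p q : ℤ}

/-- With nothing to insert, the head can only be a lone `h`; for the empty chain both sides are `0`.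
-/
theorem braceSum_nil_mulFn {x' : A.Obj} {m : ℤ} (f : A.Hom (N.obj y z') x' q) (h : q + n = m)
    {φ : Chain A (N.obj y z) x' m → V} (hφ : Good φ) (e : s + t = n) (hs : s = 0)
    (c : Chain E z z' t) :
    N.braceSum e (.nil hs) c (mulFn f h φ) =
      N.insSum (Coch.tau (N.right y)) (.nil hs) (by omega) (mulFn f h φ) c := by
  cases c with
  | nil ht =>
    rw [insSum_tau_nil _ _ _ _ (zer_mulFn f h hφ), braceSum_nil]
    rfl
  | cons h₁ g c =>
    subst hs
    rw [insSum_tau_cons _ _ _ _ _ _ (zer_mulFn f h hφ), braceSum_nil, braceSum_nil, zero_mul,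
      Int.negOnePow_zero, one_smul]
    rw [cons_cast]
    rfl

theorem splitSum_braceSum_nil_mulFn (α : Coch E A (N.obj y) (N.obj y₂) p) (h : p + s + t = n)
    (hs : s = 0) {φ : Chain A (N.obj y z) (N.obj y₂ z') n → V} (hφ : Good φ) (c : Chain E z z' t) :
    (splitSum c fun m a b e l c' => (s * a + a).negOnePow •
      N.braceSum (n := s + b) rfl (.nil hs) c' (mulFn (α.ev rfl l) (by omega) φ)) =
    N.insSum (Coch.cup rfl α (Coch.tau (N.right y))) (.nil hs) (by omega) φ c := by
  rw [← N.insSum_cup rfl (s := s) (by omega) α (Coch.tau (N.right y)) (.nil hs) h hφ c]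
  apply splitSum_congr
  intro m a b e l c'
  rw [N.braceSum_nil_mulFn _ _ hφ]

/-- Merging a value of `α` with the head of an insertion turns the two cases of `braceSum_cons` into
cup products, with `N.cochain g` and with `tau`. -/
theorem splitSum_braceSum_cons_mulFn {s' : ℤ} (α : Coch E A (N.obj y₁) (N.obj y₂) p)
    (h₁ : (q - 1) + s' = s) (g : D.Hom y' y₁ q) (r : Chain D y y' s') (h : p + s + t = n)
    {pq : ℤ} (hp : p + q = pq)
    {φ : Chain A (N.obj y z) (N.obj y₂ z') n → V} (hφ : Good φ) (c : Chain E z z' t) :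
    (splitSum c fun m a b e l c' => (s * a + a).negOnePow •
      N.braceSum (n := s + b) rfl (.cons h₁ g r) c' (mulFn (α.ev rfl l) (by omega) φ)) =
    N.insSum (Coch.cup hp α (N.cochain g)) r (by omega) φ c +
      N.insSum (Coch.cup rfl α (Coch.tau (N.right y₁))) (.cons h₁ g r) (by omega) φ c := by
  rw [← N.insSum_cup rfl (s := s) (by omega) α (Coch.tau (N.right y₁)) (.cons h₁ g r) h hφ c,
    ← N.insSum_cup hp h₁ α (N.cochain g) r h hφ c, ← splitSum_add]
  apply splitSum_congr
  intro m a b e l c'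
  rw [N.braceSum_cons _ _ _ _ _ (zer_mulFn _ _ hφ), smul_add]

/-- The relation `d_eps` with the terms in `tau` isolated; in `braceSum_dif` they cancel against the
merged terms. -/
theorem pd_cochain {f : D.Hom y y' p} : (N.cochain f).pd = N.cochain (D.d f) -
    (Coch.cup (add_comm 1 p) (Coch.tau (N.right y')) (N.cochain f) -
      p.negOnePow • Coch.cup rfl (N.cochain f) (Coch.tau (N.right y))) := by
  rw [← N.dC_cochain, Coch.dC, add_sub_cancel_right]

theorem cochain_comp {p₁ p₂ : ℤ} (h : p₂ + p₁ = p) (f₂ : D.Hom y₁ y₂ p₂) (f₁ : D.Hom y y₁ p₁) :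
    N.cochain (D.comp h f₂ f₁) = Coch.cup h (N.cochain f₂) (N.cochain f₁) := by
  ext w w' s n e c
  exact N.eps_comp h e f₂ f₁ c

theorem insSum_sub (α β : Coch E A (N.obj y₁) (N.obj y₂) p) (r : Chain D y y₁ s)
    (h : (p - 1) + s + t = n) {φ : Chain A (N.obj y z) (N.obj y₂ z') n → V} (hφ : Good φ)
    (c : Chain E z z' t) :
    N.insSum (α - β) r h φ c = N.insSum α r h φ c - N.insSum β r h φ c := by
  rw [sub_eq_add_neg, insSum_add _ _ _ _ _ hφ, insSum_neg _ _ _ _ hφ, ← sub_eq_add_neg]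

/-- The compatibility of `braceSum` with the differentials of the bar constructions. -/
theorem braceSum_dif {n' : ℤ} (e : s + t = n) (hn : n + 1 = n') (g : Chain D y y' s)
    (c : Chain E z z' t) {φ : Chain A (N.obj y z) (N.obj y' z') n' → V} (hφ : Good φ) :
    N.braceSum e g c (dif hn φ) =
      dif rfl (fun g' : Chain D y y' (s + 1) => N.braceSum (by omega) g' c φ) g +
      s.negOnePow • dif rfl (fun c' : Chain E z z' (t + 1) => N.braceSum (by omega) g c' φ) c := by
  subst e hn
  induction g generalizing z' t with
  | nil hs =>
    subst hs
    rw [dif_nil, braceSum_nil, dif_chainMap (h := rfl) (hs := rfl)]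
    simp [braceSum_nil]
  | @cons y₁ y' q s' s h₁ g r ih =>
    generalize hN : c.length = len
    -- The summand with `tau` keeps the whole chain of `D` but shortens the chain of `E`, hence a
    -- second induction.
    induction len using Nat.strong_induction_on generalizing z' t c with | _ len ihc =>
    rw [N.braceSum_cons _ _ _ _ _ (hφ.zer_dif _),
      N.insSum_dif (N.cochain g) r _ _ hφ c fun m a b e l c' _ => ih c' (hφ.tail _ _),
      N.insSum_dif (Coch.tau (N.right y')) (.cons h₁ g r) _ _ hφ c ?_]
    · rw [dif_cons (hq := rfl) (ht := rfl), dif_cons (hq := rfl) (ht := rfl)]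
      simp only [N.braceSum_cons _ _ _ _ _ hφ.zer, dif_add]
      -- Merging after `tau` produces the cup products of `tau` with `N.cochain g` and with `tau`;
      -- they cancel against `pd_cochain` and `pd_tau`.
      rw [N.splitSum_braceSum_cons_mulFn (Coch.tau (N.right y')) h₁ g r (by omega) (add_comm 1 q) hφ c,
        pd_cochain, Coch.pd_tau]
      have e₁ : q.negOnePow = -(q - 1).negOnePow := by rw [← Int.negOnePow_succ, sub_add_cancel]
      have e₂ : ((1 : ℤ) - 1).negOnePow = 1 := rfl
      have e₃ : (1 : ℤ) - 1 + s = s := by omega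
      cases r with
      | nil hs =>
        rw [N.splitSum_braceSum_nil_mulFn (N.cochain g) (by omega) hs hφ c]
        simp only [mulFn_nil, N.insSum_sub _ _ _ _ hφ, N.insSum_neg _ _ _ hφ,
          N.insSum_usmul _ _ _ _ hφ, e₁, e₂, e₃, h₁, smul_add, Units.neg_smul, one_smul,
          dh_rfl, smul_zero]
        abel
      | cons h₂ g₁ r =>
        -- The cup product of the cochains of `g` and `g₁` is the cochain of `g ∘ g₁`: it is the
        -- term of the bar differential of `D` which merges these two.
        rw [N.splitSum_braceSum_cons_mulFn (N.cochain g) h₂ g₁ r (by omega) rfl hφ c,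
          mulFn_cons (hm := rfl), mulFn_cons (hm := rfl), N.braceSum_cons _ _ _ _ _ hφ.zer,
          ← cochain_comp]
        simp only [N.insSum_sub _ _ _ _ hφ, N.insSum_neg _ _ _ hφ,
          N.insSum_usmul _ _ _ _ hφ, e₁, e₂, e₃, h₁, smul_add, Units.neg_smul, one_smul,
          dh_rfl]
        abel
    · intro m a b e l c' hl
      -- For empty `l` the value of `tau` is zero and every term vanishes; otherwise `c'` is shorter
      -- than `c`.
      cases l with
      | nil h₀ =>
        have h0 : ∀ {u : ℤ} (h : u + 1 = s + b + 1),
            dif h (fun _ : Chain A (N.obj y z) (N.obj y' z') (s + b + 1) => (0 : V)) = fun _ => 0 :=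
          fun h => funext fun b' => dif_zero h b'
        simp only [Coch.tau_nil, hφ.zer.head, h0, dif_zero, braceSum_zero, smul_zero, add_zero]
      | cons h₂ f l =>
        refine ihc c'.length ?_ c' (hφ.tail _ _) rfl
        simp only [length] at hl
        omega

end TwistedData
end DGCat

/-! ### Insertion commutes with cuts. -/

namespace DGCat

variable {k : Type u} [CommRing k]

open Chain

theorem Chain.splitSum_map {D A : DGCat k} {φ : D.Obj → A.Obj} (F : DGFunctor D A φ) {x z : D.Obj}
    {V : Type*} [AddCommGroup V] {s : ℤ} (c : Chain D x z s) (β : SplitFn A (φ x) (φ z) s V) :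
    splitSum (c.map F) β =
      splitSum c fun m a b e l r => β (φ m) a b e (l.map F) (r.map F) := by
  rw [splitSum, splits_map, List.map_map]
  rfl

namespace TwistedData

variable {D E A : DGCat k} (N : TwistedData D E A) {V W : Type*} [AddCommGroup V] [Module k V]
  [AddCommGroup W]
  {y y' y₁ y₂ : D.Obj} {z z' : E.Obj} {s t n p q : ℤ}

/-- The compatibility of the insertion of a cochain with decompositions, for chains for which
`braceSum` is compatible with them. -/
theorem insSum_splitSum (α : Coch E A (N.obj y₁) (N.obj y₂) p) (r : Chain D y y₁ s)
    (h : (p - 1) + s + t = n) (β : SplitFn A (N.obj y z) (N.obj y₂ z') n W) (c : Chain E z z' t)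
    (H : ∀ (m : E.Obj) (a b : ℤ) (e : a + b = t) (l : Chain E m z' a) (c' : Chain E z m b),
      l.length + c'.length = c.length →
      N.braceSum (n := s + b) rfl r c' (fun b' => splitSum b' fun m₁ a₁ b₁ e₁ bl br =>
        β m₁ ((p + a - 1) + a₁) b₁ (by omega) (.cons rfl (α.ev rfl l) bl) br) =
      splitSum r fun y₁ a₁ b₁ e₁ rl rr => splitSum c' fun z₁ a₂ b₂ e₂ cl cr =>
        (b₁ * a₂).negOnePow • N.braceSum rfl rl cl fun bl => N.braceSum rfl rr cr fun br =>
          β (N.obj y₁ z₁) ((p + a - 1) + (a₁ + a₂)) (b₁ + b₂) (by omega)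
            (.cons rfl (α.ev rfl l) bl) br) :
    N.insSum α r h (fun b => splitSum b β) c =
      N.insSum α r h (fun b => β _ 0 n (zero_add n) (.nil rfl) b) c +
      splitSum r fun y₁ a₁ b₁ e₁ rl rr => splitSum c fun z₁ a₂ b₂ e₂ cl cr =>
        (b₁ * a₂).negOnePow • N.insSum α rl rfl (fun bl => N.braceSum rfl rr cr fun br =>
          β (N.obj y₁ z₁) ((p - 1) + a₁ + a₂) (b₁ + b₂) (by omega) bl br) cl := by
  -- A cut of a chain with head `α(l)` either precedes nothing but the head's side, leaving the left
  -- part empty, or keeps the head in the left part and cuts the rest.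
  have e₁ : N.insSum α r h (fun b => splitSum b β) c =
      N.insSum α r h (fun b => β _ 0 n (zero_add n) (.nil rfl) b) c +
      splitSum c fun m a b e l c' => splitSum r fun y₁ a₁ b₁ e₁ rl rr =>
        splitSum c' fun z₁ a₂ b₂ e₂ cl cr =>
        (s * a + b₁ * a₂).negOnePow • N.braceSum rfl rl cl fun bl => N.braceSum rfl rr cr fun br =>
          β (N.obj y₁ z₁) ((p + a - 1) + (a₁ + a₂)) (b₁ + b₂) (by omega)
            (.cons rfl (α.ev rfl l) bl) br := by
    rw [insSum, insSum, ← splitSum_add]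
    apply splitSum_congr'
    intro m a b e l c' hl
    simp only [Int.negOnePow_add, mul_smul, splitSum_usmul]
    rw [← H m a b e l c' hl, ← smul_add, ← braceSum_add]
    congr 2
    ext b'
    rw [splitSum_cons]
  rw [e₁, splitSum_comm]
  congr 1
  apply splitSum_congr
  intro y₃ a₁ b₁ e rl rr
  -- Regrouping the cuts of `c`: the arguments of `α` are joined with those inserted into the left
  -- part.
  refine (splitSum_assoc c fun z₁ m a a₂ b₂ e₃ l cl cr => (s * a + b₁ * a₂).negOnePow •
    N.braceSum rfl rl cl fun bl => N.braceSum rfl rr cr fun br =>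
      β (N.obj y₃ z₁) ((p + a - 1) + (a₁ + a₂)) (b₁ + b₂) (by omega)
        (.cons rfl (α.ev rfl l) bl) br).symm.trans ?_
  apply splitSum_congr
  intro z₁ a₂ b₂ e₂ c' cr
  rw [insSum, ← splitSum_usmul]
  apply splitSum_congr
  intro m a b e₃ l cl
  rw [smul_smul, ← Int.negOnePow_add]
  congr 1
  · subst e e₃
    exact negOnePow_congr (by grind)
  · congr 1
    ext bl
    congr 1
    ext br
    have : ∀ {u v : ℤ} (huv : u = v) (h₁ : p + a - 1 + (a₁ + b) = u) (h₂ : p + a - 1 + (a₁ + b) = v)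
        (h₃ : u + (b₁ + b₂) = n) (h₄ : v + (b₁ + b₂) = n),
        β (N.obj y₃ z₁) u (b₁ + b₂) h₃ (.cons h₁ (α.ev rfl l) bl) br =
        β (N.obj y₃ z₁) v (b₁ + b₂) h₄ (.cons h₂ (α.ev rfl l) bl) br := by
      intro u v huv h₁ h₂ h₃ h₄
      subst huv
      rfl
    exact this (by omega) _ _ _ _

theorem insSum_congr_degree {m₁ m₂ : ℤ} (α : Coch E A (N.obj y₁) (N.obj y₂) p) (r : Chain D y y₁ s)
    (φ : ∀ m : ℤ, m + q = n → Chain A (N.obj y z) (N.obj y₂ z') m → W) (c : Chain E z z' t)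
    (h₁ : (p - 1) + s + t = m₁) (h₂ : (p - 1) + s + t = m₂) (e₁ : m₁ + q = n) (e₂ : m₂ + q = n) :
    N.insSum α r h₁ (φ m₁ e₁) c = N.insSum α r h₂ (φ m₂ e₂) c := by
  subst h₁ h₂
  rfl

theorem braceSum_nil_cons {z₁ : E.Obj} {t' : ℤ} (e : s + t = n) (hs : s = 0)
    (h₁ : (q - 1) + t' = t) (f : E.Hom z₁ z' q) (c : Chain E z z₁ t')
    {φ : Chain A (N.obj y z) (N.obj y z') n → W} (hφ : Zer φ) :
    N.braceSum e (.nil hs) (.cons h₁ f c) φ =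
      N.insSum (Coch.tau (N.right y)) (.nil hs) (by omega) φ (.cons h₁ f c) := by
  subst hs
  rw [insSum_tau_cons _ _ _ _ _ _ hφ, braceSum_nil, braceSum_nil, zero_mul, Int.negOnePow_zero,
    one_smul, cons_cast]
  rfl

/-- The compatibility of `braceSum` with decompositions. -/
theorem braceSum_splitSum (e : s + t = n) (g : Chain D y y' s) (c : Chain E z z' t)
    {β : SplitFn A (N.obj y z) (N.obj y' z') n W}
    (hl : ∀ m a b e r, Zer fun l => β m a b e l r) (hr : ∀ m a b e l, Zer fun r => β m a b e l r) :
    N.braceSum e g c (fun b => splitSum b β) =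
      splitSum g fun y₁ a₁ b₁ e₁ gl gr => splitSum c fun z₁ a₂ b₂ e₂ cl cr =>
        (b₁ * a₂).negOnePow • N.braceSum rfl gl cl fun bl => N.braceSum rfl gr cr fun br =>
          β (N.obj y₁ z₁) (a₁ + a₂) (b₁ + b₂) (by omega) bl br := by
  subst e
  induction g generalizing z' t with
  | nil hs =>
    subst hs
    rw [braceSum_nil, splitSum_nil]
    have : ∀ {n : ℤ} (e : t = n) (β : SplitFn A (N.obj y z) (N.obj y z') n W),
        splitSum ((c.map (N.right y)).cast e) β = splitSum c fun m a b e l r =>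
          β (N.obj y m) (0 + a) (0 + b) (by omega) ((l.map (N.right y)).cast (by omega))
            ((r.map (N.right y)).cast (by omega)) := by
      intro n e β
      subst e
      rw [cast_rfl, splitSum_map]
      apply splitSum_congr
      intro m a b e l r
      have : ∀ {a' b' : ℤ} (ha : a = a') (hb : b = b') (e' : a' + b' = t),
          β (N.obj y m) a b e (l.map (N.right y)) (r.map (N.right y)) =
            β (N.obj y m) a' b' e' ((l.map (N.right y)).cast ha)
              ((r.map (N.right y)).cast hb) := by
        intro a' b' ha hb e'
        subst ha hb
        rw [cast_rfl, cast_rfl]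
      exact this _ _ _
    rw [this]
    simp only [braceSum_nil, zero_mul, Int.negOnePow_zero, one_smul]
  | @cons y₁ y' q s' s h₁ g r ih =>
    generalize hN : c.length = len
    induction len using Nat.strong_induction_on generalizing z' t c with | _ len ihc =>
    -- This makes the recursion `braceSum_cons` available for the left factor.
    have hz : ∀ {y₁ z₁ a b a₁ b₁} (e₁ : a + b = s + t) (e₂ : a₁ + b₁ = b) (gr : Chain D y y₁ a₁)
      (cr : Chain E z z₁ b₁), Zer (fun bl => N.braceSum e₂ gr cr fun br =>
        β (N.obj y₁ z₁) a b e₁ bl br) := by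
      intro y₁ z₁ a b a₁ b₁ e₁ e₂ gr cr u v p κ
      simp only [hl _ _ _ _ _ κ, braceSum_zero]
    rw [N.braceSum_cons _ _ _ _ _ (Zer.splitSum hl hr),
      N.insSum_splitSum (N.cochain g) r _ _ c fun m a b e l c' _ => ih c'
        (fun _ _ _ _ _ => (hl _ _ _ _ _).tail _ _) (fun _ _ _ _ _ => hr _ _ _ _ _),
      N.insSum_splitSum (Coch.tau (N.right y')) (.cons h₁ g r) _ _ c ?_]
    · rw [splitSum_cons, splitSum_cons]
      -- Cuts which leave all of the chain of `D` on the right: the left part is empty or ends with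
      -- a lone `h`.
      have e₁ : (splitSum c fun z₁ a₂ b₂ e₂ cl cr => (s * a₂).negOnePow •
          N.braceSum rfl (.nil rfl) cl fun bl => N.braceSum rfl (.cons h₁ g r) cr fun br =>
            β (N.obj y' z₁) (0 + a₂) (s + b₂) (by omega) bl br) =
          N.braceSum rfl (.cons h₁ g r) c (fun b => β _ 0 (s + t) (zero_add _) (.nil rfl) b) +
          splitSum c fun z₁ a₂ b₂ e₂ cl cr => (s * a₂).negOnePow •
            N.insSum (Coch.tau (N.right y')) (.nil rfl) rfl (fun bl =>
              N.braceSum rfl (.cons h₁ g r) cr fun br =>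
                β (N.obj y' z₁) (1 - 1 + 0 + a₂) (s + b₂) (by omega) bl br) cl := by
        cases c with
        | nil h₀ =>
          subst h₀
          rw [splitSum_nil, splitSum_nil, insSum_tau_nil _ _ _ _ (hz _ _ _ _), braceSum_nil]
          simp
          rfl
        | cons h₂ f c =>
          rw [splitSum_cons, splitSum_cons, insSum_tau_nil _ _ _ _ (hz _ _ _ _), braceSum_nil,
            smul_zero, zero_add (M := W), mul_zero, Int.negOnePow_zero, one_smul]
          congr 1
          apply splitSum_congr
          intro m a b e l c'
          rw [braceSum_nil_cons _ _ _ _ _ _ (hz _ _ _ _)]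
          congr 1
      -- Cuts with `g` on the left: the left part ends with `ε(g; …)` or with a lone `h`.
      have e₂ : (splitSum r fun y₂ a₁ b₁ e₁ rl rr => splitSum c fun z₁ a₂ b₂ e₂ cl cr =>
          (b₁ * a₂).negOnePow • N.braceSum rfl (.cons rfl g rl) cl fun bl =>
            N.braceSum rfl rr cr fun br =>
              β (N.obj y₂ z₁) ((q - 1) + a₁ + a₂) (b₁ + b₂) (by omega) bl br) =
        (splitSum r fun y₂ a₁ b₁ e₁ rl rr => splitSum c fun z₁ a₂ b₂ e₂ cl cr =>
          (b₁ * a₂).negOnePow • N.insSum (N.cochain g) rl rfl (fun bl =>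
            N.braceSum rfl rr cr fun br =>
              β (N.obj y₂ z₁) ((q - 1) + a₁ + a₂) (b₁ + b₂) (by omega) bl br) cl) +
        splitSum r fun y₂ a₁ b₁ e₁ rl rr => splitSum c fun z₁ a₂ b₂ e₂ cl cr =>
          (b₁ * a₂).negOnePow • N.insSum (Coch.tau (N.right y')) (.cons rfl g rl) rfl (fun bl =>
            N.braceSum rfl rr cr fun br =>
              β (N.obj y₂ z₁) (1 - 1 + ((q - 1) + a₁) + a₂) (b₁ + b₂) (by omega) bl br) cl := by
        simp only [← splitSum_add, ← smul_add]
        apply splitSum_congr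
        intro y₃ a₁ b₁ e₁ rl rr
        apply splitSum_congr
        intro z₁ a₂ b₂ e₂ cl cr
        rw [braceSum_cons _ _ _ _ _ _ (hz _ _ _ _)]
        congr 2
        exact N.insSum_congr_degree _ _ (fun u hu bl => N.braceSum rfl rr cr fun br =>
                β (N.obj y₃ z₁) u (b₁ + b₂) hu bl br) _ _ _ _ _
      rw [e₁, e₂, N.braceSum_cons _ _ _ _ _ (hr _ _ _ _ _)]
      abel
    · intro m a b e l c' hl'
      cases l with
      | nil h₀ =>
        simp only [Coch.tau_nil, (hl _ _ _ _ _).head, braceSum_zero, smul_zero, splitSum_zero]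
      | cons h₂ f l =>
        refine ihc c'.length ?_ c' (fun _ _ _ _ _ => (hl _ _ _ _ _).tail _ _)
          (fun _ _ _ _ _ => hr _ _ _ _ _) rfl
        simp only [length] at hl'
        omega

end TwistedData
end DGCat

/-! ### Cochains of `A` pushed to cochains of `E` by insertion, and their differential. -/

namespace DGCat

variable {k : Type u} [CommRing k]

open Chain

namespace Coch

variable {E T : DGCat k} {F G : E.Obj → T.Obj} {p n n' q m : ℤ}

/-- Cochains which vanish if some morphism is zero. -/
def IsZer (φ : Coch E T F G p) : Prop :=
  ∀ ⦃y y' : E.Obj⦄ ⦃s n : ℤ⦄ (h : p + s = n), Zer fun c : Chain E y y' s => φ.ev h c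

theorem IsGood.isZer {φ : Coch E T F G p} (h : φ.IsGood) : φ.IsZer := fun _ _ _ _ e => (h e).zer

/-- The cochain `tau` is not normalized, as it sends an identity to an identity; hence the weaker
notion `IsZer`. -/
theorem isZer_tau {φ : E.Obj → T.Obj} (Φ : DGFunctor E T φ) : (tau Φ).IsZer := by
  intro y y' s n h v w q κ
  cases κ with
  | hole h₁ r =>
    cases r with
    | nil h₀ => simp [Ctx.plug, tau_single]
    | cons h₂ g r => rfl
  | cons h₁ g κ => cases κ <;> rfl

end Coch

namespace TwistedData

variable {D E A T : DGCat k} (N : TwistedData D E A) {V W : Type*} [AddCommGroup V]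
  {y y' y₁ y₂ : D.Obj} {z z' : E.Obj} {s t n p q : ℤ} {F G H : A.Obj → T.Obj}

theorem braceSum_cons_eq_zero {s' : ℤ} (e : s + t = n) (h : (q - 1) + s' = s) (g : D.Hom y₁ y' q)
    (r : Chain D y y₁ s') (c : Chain E z z' t) {φ : Chain A (N.obj y z) (N.obj y' z') n → V}
    (hφ : Zer φ) (hc : ∀ {x : A.Obj} {q s : ℤ} (h : (q - 1) + s = n) (f : A.Hom x _ q)
      (b : Chain A _ x s), φ (.cons h f b) = 0) :
    N.braceSum e (.cons h g r) c φ = 0 := by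
  rw [braceSum_cons _ _ _ _ _ _ hφ]
  simp [insSum, hc, braceSum_zero, splitSum_zero]

/-- The cochain obtained from a cochain of `A` and a chain of `D` by insertion into the chains
of `E`. -/
def push (h : p + s = n) (ψ : Coch A T F G p) (g : Chain D y y' s) :
    Coch E T (fun z => F (N.obj y z)) (fun z => G (N.obj y' z)) n :=
  .of fun e c => N.braceSum rfl g c fun b => ψ.ev (by omega) b

theorem push_ev (h : p + s = n) (ψ : Coch A T F G p) (g : Chain D y y' s) {z z' : E.Obj} {t m : ℤ}
    (e : n + t = m) (c : Chain E z z' t) :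
    (N.push h ψ g).ev e c = N.braceSum rfl g c fun b => ψ.ev (by omega) b := rfl

theorem push_ev' (h : p + s = n) (ψ : Coch A T F G p) (g : Chain D y y' s) {z z' : E.Obj}
    {t m l : ℤ} (e : n + t = m) (e' : s + t = l) (c : Chain E z z' t) :
    (N.push h ψ g).ev e c = N.braceSum e' g c fun b => ψ.ev (by omega) b := by
  subst e'; rfl

theorem push_add (h : p + s = n) (ψ ψ' : Coch A T F G p) (g : Chain D y y' s) :
    N.push h (ψ + ψ') g = N.push h ψ g + N.push h ψ' g := by
  ext
  simp only [push_ev, Coch.add_ev, braceSum_add]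

theorem push_usmul (h : p + s = n) (u : ℤˣ) (ψ : Coch A T F G p) (g : Chain D y y' s) :
    N.push h (u • ψ) g = u • N.push h ψ g := by
  ext
  simp only [push_ev, Coch.usmul_ev, braceSum_usmul]

theorem push_neg (h : p + s = n) (ψ : Coch A T F G p) (g : Chain D y y' s) :
    N.push h (-ψ) g = -N.push h ψ g := by
  simpa using N.push_usmul h (-1) ψ g

theorem push_sub (h : p + s = n) (ψ ψ' : Coch A T F G p) (g : Chain D y y' s) :
    N.push h (ψ - ψ') g = N.push h ψ g - N.push h ψ' g := by
  ext
  rw [sub_eq_add_neg, push_add, push_neg, ← sub_eq_add_neg]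

theorem isGood_push (h : p + s = n) {ψ : Coch A T F G p} (hψ : ψ.IsGood) (g : Chain D y y' s) :
    (N.push h ψ g).IsGood :=
  fun _ _ _ _ _ => N.good_braceSum_right _ _ (hψ _)

/-- The insertion of chains of `D` is compatible with cup products. -/
theorem push_cup {p₁ p₂ : ℤ} (hp : p₁ + p₂ = p) (h : p + s = n) {ψ₁ : Coch A T G H p₁}
    {ψ₂ : Coch A T F G p₂} (h₁ : ψ₁.IsZer) (h₂ : ψ₂.IsZer) (g : Chain D y y' s) :
    N.push h (Coch.cup hp ψ₁ ψ₂) g = splitSum g fun _ a b e gl gr => (p₂ * a).negOnePow •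
      Coch.cup (by omega) (N.push (n := p₁ + a) rfl ψ₁ gl) (N.push (n := p₂ + b) rfl ψ₂ gr) := by
  ext z z' t m e c
  rw [push_ev, ← Coch.evₗ_apply, map_splitSum]
  simp only [Coch.cup_ev]
  -- Insertion is a map of coalgebras, and the cup product is dual to cutting.
  rw [N.braceSum_splitSum]
  · apply splitSum_congr
    intro y₁ a₁ b₁ e₁ gl gr
    rw [Coch.evₗ_apply, Coch.usmul_ev, Coch.cup_ev, ← splitSum_usmul]
    apply splitSum_congr
    intro z₁ a₂ b₂ e₂ cl cr
    rw [push_ev, push_ev, smul_smul, ← Int.negOnePow_add, ← LinearMap.flip_apply, map_braceSum,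
      ← braceSum_usmul, ← braceSum_usmul]
    congr 1
    ext bl
    rw [LinearMap.flip_apply, map_braceSum, ← braceSum_usmul, ← braceSum_usmul]
    congr 1
    ext br
    rw [smul_smul, ← Int.negOnePow_add]
    congr 1
    · exact negOnePow_congr (by grind)
    · exact Coch.comp_ev _ _ _ _ _ _ _
  · intro m a b e r u v t κ
    simp [h₁ _ κ]
  · intro m a b e r u v t κ
    simp [h₂ _ κ]

/-- The compatibility of the insertion of chains of `D` with differentials. -/
theorem pd_push (h : p + s = n) {ψ : Coch A T F G p} (hψ : ψ.IsGood) (g : Chain D y y' s) :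
    (N.push h ψ g).pd = N.push (by omega) ψ.pd g - p.negOnePow •
      dif rfl (fun g' : Chain D y y' (s + 1) => N.push (by omega) ψ g') g := by
  ext z z' t m e c
  have e₁ : (dif rfl (fun g' : Chain D y y' (s + 1) => N.push (n := n + 1) (by omega) ψ g') g).ev e c =
      dif rfl (fun g' : Chain D y y' (s + 1) => N.braceSum (n := s + t + 1) (by omega) g' c
        fun b => ψ.ev (by omega) b) g := by
    rw [← Coch.evₗ_apply, dif_map]
    congr 1
    ext g'
    exact N.push_ev' (by omega) ψ g' _ _ c
  have e₂ : dif rfl (fun c' : Chain E z z' (t + 1) => (N.push h ψ g).ev (n := m) (by omega) c') c =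
      dif rfl (fun c' : Chain E z z' (t + 1) => N.braceSum (n := s + t + 1) (by omega) g c'
        fun b => ψ.ev (by omega) b) c := by
    congr 1
    ext g'
    exact N.push_ev' _ _ _ _ _ _
  rw [Coch.pd_ev, Coch.sub_ev, Coch.usmul_ev, e₁, e₂, push_ev, push_ev, map_braceSum]
  subst h
  simp only [Coch.pd_ev' ψ (l := p + s + t) (s' := s + t + 1) _ (add_assoc _ _ _).symm rfl]
  rw [braceSum_add, braceSum_usmul, N.braceSum_dif _ _ _ _ (hψ _), smul_add, smul_smul,
    ← Int.negOnePow_add]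
  abel

section tau

variable {φ : A.Obj → T.Obj} (Φ : DGFunctor A T φ)

theorem push_tau_nil (h : 1 + s = 1) (hs : s = 0) :
    N.push h (Coch.tau Φ) (.nil (x := y) hs) = Coch.tau (Φ.comp (N.right y)) := by
  ext z z' t m e c
  rw [push_ev, braceSum_nil]
  cases c with
  | nil h => rfl
  | cons h₁ g c => cases c <;> rfl

/-- A head on top of an insertion of a non-empty chain makes at least two morphisms, and `tau`
vanishes there. -/
theorem insSum_cons_tau {m t' : ℤ} (α : Coch E A (N.obj y₁) (N.obj y₂) p) (h : (p - 1) + s + t = n)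
    (h₁ : (q - 1) + t' = s) (g : D.Hom y' y₁ q) (r : Chain D y y' t') (c : Chain E z z' t)
    (e : 1 + n = m) : N.insSum α (.cons h₁ g r) h (fun b => (Coch.tau Φ).ev e b) c = 0 := by
  refine (splitSum_congr c fun w a b e' l c' => ?_).trans (splitSum_zero c)
  rw [braceSum_cons_eq_zero _ _ _ _ _ _ ((Coch.isZer_tau Φ _).tail _ _), smul_zero]
  intros
  exact Coch.tau_cons_cons _ _ _ _ _ _ _

/-- Together with `push_tau_nil` and `push_tau_cons_cons`, this recovers the length-one component of
insertion, which is nonzero only for chains of `D` with at most one morphism. -/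
theorem push_tau_single (h : 1 + s = q) (h₁ : (q - 1) + t = s) (g : D.Hom y y' q) (ht : t = 0) :
    N.push h (Coch.tau Φ) (.cons h₁ g (.nil ht)) = (N.postcomp Φ).cochain g := by
  ext z z' t m e c
  rw [push_ev, N.braceSum_cons _ _ _ _ _ (Coch.isZer_tau Φ _), insSum_cons_tau, add_zero, insSum,
    splitSum_right_nil]
  · subst ht
    rw [zero_mul, Int.negOnePow_zero, one_smul, braceSum_nil]
    refine (Coch.tau_single Φ _ _ _ _).trans ?_
    rw [← Φ.map_hc, Coch.hc_ev]
    rfl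
  · intros
    rw [braceSum_nil]
    refine (congrArg _ ?_).trans (smul_zero _)
    exact Coch.tau_cons_cons _ _ _ _ _ _ _

theorem push_tau_cons_cons {q' t' : ℤ} (h : 1 + s = n) (h₁ : (q - 1) + t = s) (g : D.Hom y₂ y' q)
    (h₂ : (q' - 1) + t' = t) (g' : D.Hom y₁ y₂ q') (r : Chain D y y₁ t') :
    N.push h (Coch.tau Φ) (.cons h₁ g (.cons h₂ g' r)) = 0 := by
  ext z z' t m e c
  rw [push_ev, N.braceSum_cons _ _ _ _ _ (Coch.isZer_tau Φ _), insSum_cons_tau, insSum_cons_tau,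
    add_zero, Coch.zero_ev]

theorem cup_push_tau_nil {m l : ℤ} {F : E.Obj → T.Obj} (e : 1 + s = n) (hs : s = 0)
    (h : n + m = l) (h' : 1 + m = l) (ψ : Coch E T F (fun z => φ (N.obj y z)) m) :
    Coch.cup h (N.push e (Coch.tau Φ) (.nil hs)) ψ =
      Coch.cup h' (Coch.tau (Φ.comp (N.right y))) ψ := by
  obtain rfl : n = 1 := by omega
  rw [push_tau_nil]

theorem push_cup_tau_nil {m l : ℤ} {F : E.Obj → T.Obj} (e : 1 + s = n) (hs : s = 0)
    (h : m + n = l) (h' : m + 1 = l) (ψ : Coch E T (fun z => φ (N.obj y z)) F m) :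
    Coch.cup h ψ (N.push e (Coch.tau Φ) (.nil hs)) =
      Coch.cup h' ψ (Coch.tau (Φ.comp (N.right y))) := by
  obtain rfl : n = 1 := by omega
  rw [push_tau_nil]

theorem cup_push_tau_single {m l : ℤ} {F : E.Obj → T.Obj} (e : 1 + s = n) (h₁ : (q - 1) + t = s)
    (g : D.Hom y y' q) (ht : t = 0) (h : n + m = l)
    (ψ : Coch E T F (fun z => φ (N.obj y z)) m) :
    Coch.cup h (N.push e (Coch.tau Φ) (.cons h₁ g (.nil ht))) ψ =
      Coch.cup (G := fun z => φ (N.obj y z)) (H := fun z => φ (N.obj y' z)) (p := q) (by omega)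
        ((N.postcomp Φ).cochain g) ψ := by
  obtain rfl : n = q := by omega
  rw [push_tau_single]

theorem push_cup_tau_single {m l : ℤ} {F : E.Obj → T.Obj} (e : 1 + s = n) (h₁ : (q - 1) + t = s)
    (g : D.Hom y y' q) (ht : t = 0) (h : m + n = l)
    (ψ : Coch E T (fun z => φ (N.obj y' z)) F m) :
    Coch.cup h ψ (N.push e (Coch.tau Φ) (.cons h₁ g (.nil ht))) =
      Coch.cup (G := fun z => φ (N.obj y' z)) (F := fun z => φ (N.obj y z)) (q := q) (by omega)
        ψ ((N.postcomp Φ).cochain g) := by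
  obtain rfl : n = q := by omega
  rw [push_tau_single]

variable {φ' : A.Obj → T.Obj} (Φ' : DGFunctor A T φ')

/-- The differential of a cochain obtained by insertion. -/
theorem dC_push (h : p + s = n) {ψ : Coch A T φ φ' p} (hψ : ψ.IsGood) (g : Chain D y y' s) :
    Coch.dC (Φ'.comp (N.right y')) (Φ.comp (N.right y)) (N.push h ψ g) =
      N.push (n := n + 1) (by omega) (Coch.dC Φ' Φ ψ) g
      - p.negOnePow • dif rfl (fun g' : Chain D y y' (s + 1) => N.push (n := n + 1) (by omega) ψ g') g
      - (g.uncons.map fun w => (p * (w.q - 1)).negOnePow •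
          Coch.cup (F := fun z => φ (N.obj y z)) (H := fun z => φ' (N.obj y' z))
            (p := w.q) (q := p + w.a) (n := n + 1) (by have := w.h; omega)
            ((N.postcomp Φ').cochain w.last) (N.push rfl ψ w.rest)).sum
      + (g.unsnoc.map fun w => (p + w.a).negOnePow •
          Coch.cup (F := fun z => φ (N.obj y z)) (H := fun z => φ' (N.obj y' z))
            (p := p + w.a) (q := w.q) (n := n + 1) (by have := w.h; omega)
            (N.push rfl ψ w.rest) ((N.postcomp Φ).cochain w.first)).sum := by
  subst h
  -- Only cuts with at most one morphism on the left count. The empty left part gives the `tau` of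
  -- the composite functor, and the other one the outer term `(id ⊗ gₙ) ∘ …`.
  have e₁ : N.push (show p + 1 + s = p + s + 1 by omega) (Coch.cup (add_comm 1 p) (Coch.tau Φ') ψ) g =
      Coch.cup (add_comm 1 (p + s)) (Coch.tau (Φ'.comp (N.right y'))) (N.push rfl ψ g) +
      (g.uncons.map fun w => (p * (w.q - 1)).negOnePow •
          Coch.cup (F := fun z => φ (N.obj y z)) (H := fun z => φ' (N.obj y' z))
            (p := w.q) (q := p + w.a) (n := p + s + 1) (by have := w.h; omega)
            ((N.postcomp Φ').cochain w.last) (N.push rfl ψ w.rest)).sum := by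
    rw [N.push_cup _ _ (Coch.isZer_tau Φ') hψ.isZer, splitSum_left_short]
    · rw [mul_zero, Int.negOnePow_zero, one_smul]
      congr 1
      · exact N.cup_push_tau_nil Φ' _ _ _ _ _
      · simp only [cup_push_tau_single]
        rfl
    · intros
      rw [push_tau_cons_cons]
      rw [Coch.cup_zero_left, smul_zero]
  -- Symmetrically, cuts with at most one morphism on the right give the term `… ∘ (id ⊗ g₁)`.
  have e₂ : N.push (show p + 1 + s = p + s + 1 by omega) (Coch.cup rfl ψ (Coch.tau Φ)) g =
      s.negOnePow • Coch.cup rfl (N.push rfl ψ g) (Coch.tau (Φ.comp (N.right y))) +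
      (g.unsnoc.map fun w => (w.a).negOnePow •
          Coch.cup (F := fun z => φ (N.obj y z)) (H := fun z => φ' (N.obj y' z))
            (p := p + w.a) (q := w.q) (n := p + s + 1) (by have := w.h; omega)
            (N.push rfl ψ w.rest) ((N.postcomp Φ).cochain w.first)).sum := by
    rw [N.push_cup _ _ hψ.isZer (Coch.isZer_tau Φ), splitSum_right_short]
    · rw [one_mul]
      congr 1
      · exact congrArg _ (N.push_cup_tau_nil Φ _ _ _ _ _)
      · simp only [push_cup_tau_single, one_mul]
    · intros
      rw [push_tau_cons_cons]
      rw [Coch.cup_zero_right, smul_zero]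
  rw [Coch.dC, Coch.dC, N.pd_push _ hψ, push_add, push_sub, e₁, push_usmul, e₂]
  simp only [smul_add, Int.negOnePow_add, mul_smul, sum_map_units_smul]
  abel

end tau

end TwistedData
end DGCat

/-! ### The generators of `C` and `D` in `Coh E T`. -/

namespace DGCat

variable {k : Type u} [CommRing k]

open Chain

/-- The identity dg functor. -/
def DGFunctor.id (C : DGCat k) : DGFunctor C C (fun x => x) where
  map := LinearMap.id
  map_idm _ := rfl
  map_comp _ _ _ := rfl
  map_d _ := rfl

theorem Coch.IsGood.dif {E T D : DGCat k} {F G : E.Obj → T.Obj} {p s t : ℤ} {y y' : D.Obj}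
    (h : s + 1 = t) {Φ : Chain D y y' t → Coch E T F G p} (hΦ : ∀ g, (Φ g).IsGood)
    (g : Chain D y y' s) : (Chain.dif h Φ g).IsGood := by
  subst h
  rw [dif_eq_sum]
  exact (IsGood.listSum _ fun w => (hΦ _).usmul _).add (IsGood.listSum _ fun w => (hΦ _).usmul _)

namespace TwistedData

variable {C D E A T : DGCat k} (N : TwistedData D E A) (Q : TwistedData C A T)
  {x x' x₁ : C.Obj} {y y' y₁ y₂ : D.Obj} {z z' : E.Obj} {s t n p q : ℤ}

theorem eps_cast {M : TwistedData C A T} {a a' : A.Obj} (e : s = t) (h : p + t = n)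
    (f : C.Hom x x' p) (c : Chain A a a' s) : M.eps h f (c.cast e) = M.eps (by omega) f c := by
  subst e
  rw [cast_rfl]

/-- Each term in the formula `dC_push` is built from good cochains. -/
theorem isGood_dC_push (h : p + s = n) (f : C.Hom x x' p) (g : Chain D y y' s) :
    (Coch.dC ((Q.right x').comp (N.right y')) ((Q.right x).comp (N.right y))
      (N.push h (Q.cochain f) g)).IsGood := by
  rw [N.dC_push _ _ h (Q.isGood_cochain f), Q.dC_cochain]
  refine (((N.isGood_push _ (Q.isGood_cochain _) g).sub
    ((Coch.IsGood.dif rfl (fun g => N.isGood_push _ (Q.isGood_cochain _) g) g).usmul _)).sub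
    (Coch.IsGood.listSum _ fun w => ?_)).add (Coch.IsGood.listSum _ fun w => ?_)
  · exact (((N.postcomp _).isGood_cochain _).cup _ (N.isGood_push _ (Q.isGood_cochain _) _)).usmul _
  · exact ((N.isGood_push _ (Q.isGood_cochain _) _).cup _ ((N.postcomp _).isGood_cochain _)).usmul _

/-- The coherent natural transformation obtained by insertion of a chain of `D`. -/
def insertEps (h : p + s = n) (f : C.Hom x x' p) (g : Chain D y y' s) :
    (Coh E T).Hom (Coh.of ((Q.right x).comp (N.right y))) (Coh.of ((Q.right x').comp (N.right y')))
      n :=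
  Coh.mk (N.push h (Q.cochain f) g) (N.isGood_push h (Q.isGood_cochain f) g)
    (N.isGood_dC_push Q h f g)

theorem val_insertEps (h : p + s = n) (f : C.Hom x x' p) (g : Chain D y y' s) :
    Coh.val (N.insertEps Q h f g) = N.push h (Q.cochain f) g := rfl

theorem push_cochain_add (h : p + s = n) (f f' : C.Hom x x' p) (g : Chain D y y' s) :
    N.push h (Q.cochain (f + f')) g = N.push h (Q.cochain f) g + N.push h (Q.cochain f') g := by
  rw [← push_add]
  congr 1
  ext
  exact Q.eps_add _ _ _ _

theorem push_smul {F G : A.Obj → T.Obj} (h : p + s = n) (a : k) (ψ : Coch A T F G p)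
    (g : Chain D y y' s) : N.push h (a • ψ) g = a • N.push h ψ g := by
  ext z z' t m e c
  exact (N.map_braceSum (LinearMap.lsmul k (T.Hom (F (N.obj y z)) (G (N.obj y' z')) m) a) _ _ _ _).symm

theorem good_push (h : p + s = n) {F G : A.Obj → T.Obj} {ψ : Coch A T F G p} (hψ : ψ.IsGood)
    {z z' : E.Obj} {t m : ℤ} (e : n + t = m) (c : Chain E z z' t) :
    Good fun g : Chain D y y' s => (N.push h ψ g).ev e c :=
  N.good_braceSum_left _ _ (hψ _)

/-- The generators obtained by insertion. -/
def insert : TwistedData C D (Coh E T) where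
  obj x y := Coh.of ((Q.right x).comp (N.right y))
  left y := (Q.comap (DGFunctor.id C) (N.right y)).toCoh
  right x := (N.postcomp (Q.right x)).toCoh
  eps := N.insertEps Q
  eps_nil y h hs f := Coh.val_injective <| by
    ext z z' t m e c
    refine (braceSum_nil _ _ _ _ _).trans ?_
    exact eps_cast _ _ _ _
  eps_add h f f' c := Coh.val_injective (N.push_cochain_add Q h f f' c)
  eps_smul h a f c := Coh.val_injective <| by
    rw [map_smul, val_insertEps, val_insertEps, ← push_smul]
    congr 1
    ext
    exact Q.eps_smul _ _ _ _
  eps_isAdd h f c c₁ c₂ H := Coh.val_injective <| by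
    ext z z' t m e b
    exact (N.good_push h (Q.isGood_cochain f) e b).isAdd H
  eps_isSMul h f a c c₁ H := Coh.val_injective <| by
    ext z z' t m e b
    exact (N.good_push h (Q.isGood_cochain f) e b).isSMul H
  eps_hasId h f c H := Coh.val_injective <| by
    ext z z' t m e b
    exact (N.good_push h (Q.isGood_cochain f) e b).hasId H
  eps_idm x h c H := Coh.val_injective <| by
    ext z z' t m e b
    cases c with
    | nil hs => simp [length] at H
    | cons h₁ g r =>
      -- Inserting a non-empty chain never yields the empty chain, so `ε(id; …) = 0` applies to
      -- every term.
      refine N.braceSum_cons_eq_zero _ _ _ _ _ ((Q.isGood_cochain _ _).zer) ?_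
      intros
      exact Q.eps_idm _ _ _ (by simp [length])
  eps_comp {_ _ _ _ _ p₂ p₁ _ _ _} hp h f₂ f₁ c := Coh.val_injective <| by
    rw [val_insertEps, Q.cochain_comp, N.push_cup _ _ (Q.isGood_cochain _).isZer
      (Q.isGood_cochain _).isZer]
    refine Eq.trans ?_ (map_splitSum Coh.val c fun _ a b e l r => (p₁ * a).negOnePow •
      (Coh E T).comp (p := p₂ + a) (q := p₁ + b) (by omega) (N.insertEps Q rfl f₂ l)
        (N.insertEps Q rfl f₁ r)).symm
    apply splitSum_congr
    intro m a b e l r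
    rw [map_usmul]
    rfl
  d_eps h f c := Coh.val_injective <| by
    rw [Coh.val_d, val_insertEps]
    -- The formula for the differential of an inserted cochain is the relation `d_eps` term by term,
    -- with `dif` split into its two sums.
    refine (N.dC_push _ _ h (Q.isGood_cochain f) c).trans ?_
    rw [Q.dC_cochain, dif_eq_sum]
    simp only [map_add, map_sub, map_list_sum, List.map_map, Function.comp_def, map_usmul]
    rw [smul_add, ← sum_map_units_smul, ← sum_map_units_smul, ← sub_sub]
    simp only [smul_smul, ← Int.negOnePow_add]
    rfl

end TwistedData
end DGCat

/-! ### The associativity dg functor and its values on generators. -/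

namespace DGCat

variable {k : Type u} [CommRing k]

open Chain

namespace TwistedData

variable {D E A : DGCat k} (N : TwistedData D E A)
  {y y' : D.Obj} {z z' : E.Obj} {s t n : ℤ}

theorem eps_nil' {x x' : D.Obj} {p : ℤ} (h : p + s = n) (hs : s = 0) (f : D.Hom x x' p) :
    N.eps h f (.nil (x := z) hs) = hc (by omega) ((N.left z).map f) := by
  subst hs
  obtain rfl : p = n := by omega
  exact N.eps_nil _ _ _ _

/-- With nothing to absorb, each `g` becomes `ε(g; ) = g ⊗ id`, in a single way. -/
theorem braceSum_nil_right {V : Type*} [AddCommGroup V] (e : s + t = n) (g : Chain D y y' s)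
    (ht : t = 0) {φ : Chain A (N.obj y z) (N.obj y' z) n → V} (hφ : Zer φ) :
    N.braceSum e g (.nil ht) φ = φ ((g.map (N.left z)).cast (by omega)) := by
  subst ht
  induction g generalizing n with
  | nil hs => rw [braceSum_nil]; rfl
  | cons h₁ g r ih =>
    rw [braceSum_cons _ _ _ _ _ _ hφ, insSum_tau_nil _ _ _ _ hφ, add_zero, insSum, splitSum_nil,
      mul_zero, Int.negOnePow_zero, one_smul, ih (hφ.tail _ _) _, N.cochain_ev,
      eps_nil', cons_hc, cons_cast]
    rfl

end TwistedData

theorem Chain.brace_eq {D E : DGCat k} {y y' : D.Obj} {z z' : E.Obj} {s t n : ℤ} (e : s + t = n)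
    (g : Chain D y y' s) (c : Chain E z z' t) :
    Chain.brace e g c = (Tw.gens D E).brace e g c := by
  induction g generalizing z' t n with
  | nil hs => rfl
  | cons h g r ih =>
    simp only [Chain.brace, TwistedData.brace, ih]
    rfl

namespace Tw

variable {C D E T : DGCat k}

/-- The generators in `C ⊗̃ (D ⊗̃ E)` which define the associativity dg functor. -/
def assocData (C D E : DGCat k) : TwistedData (Tw C D) E (Tw C (Tw D E)) :=
  .ofCoh (desc ((gens D E).insert (gens C (Tw D E))))

/-- The associativity dg functor. -/
def associator (C D E : DGCat k) :
    DGFunctor (Tw (Tw C D) E) (Tw C (Tw D E)) (assocObj C D E) :=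
  desc (assocData C D E)

theorem isAssociator_associator (C D E : DGCat k) : IsAssociator (associator C D E) where
  left_left f y z := (gens C (Tw D E)).eps_nil (pair y z) (add_zero _) rfl f
  right_left x _ _ _ g z := congrArg ((gens C (Tw D E)).right x).map
    ((gens D E).eps_nil z (add_zero _) rfl g)
  right_right x y _ _ _ h := rfl
  eps_left e f g z hg := by
    refine ((gens D E).braceSum_nil_right _ g rfl
      (((gens C (Tw D E)).isGood_cochain f _).zer)).trans ?_
    exact TwistedData.eps_cast _ _ _ _
  left_eps e f y h hh := rfl
  right_eps x _ _ _ _ _ _ _ e g h hh := rfl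
  eps_eps e₁ e₂ e₃ e₄ f g h hg hh := by
    subst e₃
    rw [brace_eq]
    rfl

/-! ### Dg functors out of iterated twisted tensor products are determined on generators. -/

theorem induction {P : ∀ {X Y : (Tw C D).Obj} {n : ℤ}, (Tw C D).Hom X Y n → Prop}
    (zero : ∀ (X Y : (Tw C D).Obj) (n : ℤ), P (0 : (Tw C D).Hom X Y n))
    (add : ∀ {X Y : (Tw C D).Obj} {n : ℤ} (a b : (Tw C D).Hom X Y n), P a → P b → P (a + b))
    (smul : ∀ {X Y : (Tw C D).Obj} {n : ℤ} (r : k) (a : (Tw C D).Hom X Y n), P a → P (r • a))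
    (idm : ∀ X : (Tw C D).Obj, P ((Tw C D).idm X))
    (comp : ∀ {X Y Z : (Tw C D).Obj} {p q n : ℤ} (h : p + q = n) (a : (Tw C D).Hom Y Z p)
      (b : (Tw C D).Hom X Y q), P a → P b → P ((Tw C D).comp h a b))
    (d : ∀ {X Y : (Tw C D).Obj} {n : ℤ} (a : (Tw C D).Hom X Y n), P a → P ((Tw C D).d a))
    (left : ∀ {x x' : C.Obj} {p : ℤ} (y : D.Obj) (f : C.Hom x x' p),
      P (((gens C D).left y).map f))
    (right : ∀ (x : C.Obj) {y y' : D.Obj} {q : ℤ} (g : D.Hom y y' q),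
      P (((gens C D).right x).map g))
    (eps : ∀ {x x' : C.Obj} {y y' : D.Obj} {p s n : ℤ} (h : p + s = n) (f : C.Hom x x' p)
      (c : Chain D y y' s), P ((gens C D).eps h f c))
    {X Y : (Tw C D).Obj} {n : ℤ} (a : (Tw C D).Hom X Y n) : P a := by
  have key : ∀ {X Y : C.Obj × D.Obj} {n : ℤ} (e : Expr C D X Y n),
      P (X := X) (Y := Y) (TwHom.mk e) := by
    intro X Y n e
    induction e with
    | zero X Y n => exact zero X Y n
    | add e e' h h' => exact add _ _ h h'
    | smul r e h => exact smul r _ h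
    | idm X => exact idm X
    | comp hh e e' h h' => exact comp hh _ _ h h'
    | d e h => exact d _ h
    | left y f => exact left y f
    | right x g => exact right x g
    | eps h f c => exact eps h f c
  induction a using Quotient.inductionOn with | _ e => exact key e

end Tw

namespace TwistedData

variable {A E S T : DGCat k} (M : TwistedData A E S) {ω : S.Obj → T.Obj} (F G : DGFunctor S T ω)

/-- The dg functors `F` and `G` agree on the morphisms `ε(f; g₁, …, gₙ)`. -/
def Agree {X Y : A.Obj} {p : ℤ} (f : A.Hom X Y p) : Prop :=
  ∀ ⦃z z' : E.Obj⦄ ⦃s n : ℤ⦄ (h : p + s = n) (c : Chain E z z' s),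
    F.map (M.eps h f c) = G.map (M.eps h f c)

namespace Agree

variable {M F G} {X Y Z : A.Obj} {p q n : ℤ}

theorem zero : M.Agree F G (0 : A.Hom X Y p) := fun _ _ _ _ h c => by
  rw [M.eps_zero, map_zero, map_zero]

theorem add {a b : A.Hom X Y p} (ha : M.Agree F G a) (hb : M.Agree F G b) :
    M.Agree F G (a + b) := fun _ _ _ _ h c => by
  rw [M.eps_add, map_add, map_add, ha, hb]

theorem smul (r : k) {a : A.Hom X Y p} (ha : M.Agree F G a) : M.Agree F G (r • a) := fun _ _ _ _ h c => by
  rw [M.eps_smul, map_smul, map_smul, ha]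

theorem of_length {a : A.Hom X Y p} (h₀ : ∀ z, F.map ((M.left z).map a) = G.map ((M.left z).map a))
    (h₁ : ∀ {z z' : E.Obj} {s n : ℤ} (h : p + s = n) (c : Chain E z z' s), 1 ≤ c.length →
      F.map (M.eps h a c) = G.map (M.eps h a c)) : M.Agree F G a := by
  intro z z' s n h c
  cases c with
  | nil hs => rw [M.eps_nil', F.map_hc, G.map_hc, h₀]
  | cons h₂ g r => exact h₁ _ _ (by simp [length])

theorem idm (X : A.Obj) : M.Agree F G (A.idm X) :=
  of_length (fun z => by rw [DGFunctor.map_idm, F.map_idm, G.map_idm]) fun h c hc => by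
    rw [M.eps_idm _ _ _ hc, map_zero, map_zero]

/-- The relation `eps_comp` expresses `ε(a b; …)` through values of `ε(a; …)` and `ε(b; …)`. -/
theorem comp (h : p + q = n) {a : A.Hom Y Z p} {b : A.Hom X Y q} (ha : M.Agree F G a)
    (hb : M.Agree F G b) : M.Agree F G (A.comp h a b) := fun _ _ _ _ h c => by
  rw [M.eps_comp, F.map_sum, G.map_sum]
  simp only [DGFunctor.map_units_smul, DGFunctor.map_comp]
  simp only [ha rfl, hb rfl]

/-- The relation `d_eps` can be solved for `ε(da; …)`; the other terms involve only `ε(a; …)` and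
the morphisms `id ⊗ h`. -/
theorem d (hr : ∀ (X : A.Obj) {z z' : E.Obj} {q : ℤ} (h : E.Hom z z' q),
      F.map ((M.right X).map h) = G.map ((M.right X).map h)) {a : A.Hom X Y p}
    (ha : M.Agree F G a) : M.Agree F G (A.d a) := by
  intro z z' s n h c
  obtain rfl : n = p + s + 1 := by omega
  have e : ∀ F : DGFunctor S T ω, F.map (M.eps h (A.d a) c) = T.d (F.map (M.eps rfl a c))
      + (c.diffs.map fun w => (p + w.1).negOnePow • F.map (M.eps (by omega) a w.2)).sum
      + (c.mults.map fun w => (p + w.1).negOnePow • F.map (M.eps (by omega) a w.2)).sum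
      + (c.uncons.map fun w => (p * (w.q - 1)).negOnePow •
          T.comp (p := w.q) (q := p + w.a) (n := p + s + 1) (by have := w.h; omega)
            (F.map ((M.right Y).map w.last)) (F.map (M.eps rfl a w.rest))).sum
      - (c.unsnoc.map fun w => (p + w.a).negOnePow •
          T.comp (p := p + w.a) (q := w.q) (n := p + s + 1) (by have := w.h; omega)
            (F.map (M.eps rfl a w.rest)) (F.map ((M.right X).map w.first))).sum := by
    intro F
    have := congrArg F.map (M.d_eps rfl a c)
    simp only [map_add, map_sub, F.map_d, F.map_sum, F.map_units_smul, F.map_comp] at this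
    rw [this]
    abel
  rw [e F, e G]
  simp only [ha _ _, hr]

end Agree

end TwistedData

namespace Tw

variable {C D E T : DGCat k}

theorem hom_ext {ω : (Tw C D).Obj → T.Obj} {F G : DGFunctor (Tw C D) T ω}
    (hr : ∀ (x : C.Obj) {y y' : D.Obj} {q : ℤ} (g : D.Hom y y' q),
      F.map (((gens C D).right x).map g) = G.map (((gens C D).right x).map g))
    (he : ∀ {x x' : C.Obj} {p : ℤ} (f : C.Hom x x' p), (gens C D).Agree F G f)
    {X Y : (Tw C D).Obj} {n : ℤ} (a : (Tw C D).Hom X Y n) : F.map a = G.map a := by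
  induction a using Tw.induction with
  | zero X Y n => rw [map_zero, map_zero]
  | add a b ha hb => rw [map_add, map_add, ha, hb]
  | smul r a ha => rw [map_smul, map_smul, ha]
  | idm X => rw [F.map_idm, G.map_idm]
  | comp h a b ha hb => rw [F.map_comp, G.map_comp, ha, hb]
  | d a ha => rw [F.map_d, G.map_d, ha]
  | left y f =>
    rw [← (gens C D).eps_nil y (add_zero _) rfl f]
    exact he f _ _
  | right x g => exact hr x g
  | eps h f c => exact he f h c

/-- A dg functor out of `(C ⊗̃ D) ⊗̃ E` is determined by its values on the generators. -/
theorem hom_ext₂ {ω : (Tw (Tw C D) E).Obj → T.Obj} {F G : DGFunctor (Tw (Tw C D) E) T ω}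
    (hll : ∀ {x x' : C.Obj} {p : ℤ} (f : C.Hom x x' p) (y : D.Obj) (z : E.Obj),
      F.map (((gens (Tw C D) E).left z).map (((gens C D).left y).map f)) =
        G.map (((gens (Tw C D) E).left z).map (((gens C D).left y).map f)))
    (hrl : ∀ (x : C.Obj) {y y' : D.Obj} {q : ℤ} (g : D.Hom y y' q) (z : E.Obj),
      F.map (((gens (Tw C D) E).left z).map (((gens C D).right x).map g)) =
        G.map (((gens (Tw C D) E).left z).map (((gens C D).right x).map g)))
    (hrr : ∀ (x : C.Obj) (y : D.Obj) {z z' : E.Obj} {r : ℤ} (h : E.Hom z z' r),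
      F.map (((gens (Tw C D) E).right (pair x y)).map h) =
        G.map (((gens (Tw C D) E).right (pair x y)).map h))
    (hel : ∀ {x x' : C.Obj} {y y' : D.Obj} {p s n : ℤ} (e : p + s = n) (f : C.Hom x x' p)
      (g : Chain D y y' s) (z : E.Obj), 1 ≤ g.length →
      F.map (((gens (Tw C D) E).left z).map ((gens C D).eps e f g)) =
        G.map (((gens (Tw C D) E).left z).map ((gens C D).eps e f g)))
    (hle : ∀ {x x' : C.Obj} {z z' : E.Obj} {p t n : ℤ} (e : p + t = n) (f : C.Hom x x' p)
      (y : D.Obj) (h : Chain E z z' t), 1 ≤ h.length →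
      F.map ((gens (Tw C D) E).eps e (((gens C D).left y).map f) h) =
        G.map ((gens (Tw C D) E).eps e (((gens C D).left y).map f) h))
    (hre : ∀ (x : C.Obj) {y y' : D.Obj} {z z' : E.Obj} {q t n : ℤ} (e : q + t = n)
      (g : D.Hom y y' q) (h : Chain E z z' t), 1 ≤ h.length →
      F.map ((gens (Tw C D) E).eps e (((gens C D).right x).map g) h) =
        G.map ((gens (Tw C D) E).eps e (((gens C D).right x).map g) h))
    (hee : ∀ {x x' : C.Obj} {y y' : D.Obj} {z z' : E.Obj} {p s ps t n : ℤ} (e₁ : p + s = ps)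
      (e₂ : ps + t = n) (f : C.Hom x x' p)
      (g : Chain D y y' s) (h : Chain E z z' t), 1 ≤ g.length → 1 ≤ h.length →
      F.map ((gens (Tw C D) E).eps e₂ ((gens C D).eps e₁ f g) h) =
        G.map ((gens (Tw C D) E).eps e₂ ((gens C D).eps e₁ f g) h))
    {X Y : (Tw (Tw C D) E).Obj} {n : ℤ} (a : (Tw (Tw C D) E).Hom X Y n) : F.map a = G.map a := by
  -- It remains to treat `ε(a; …)` for arbitrary `a` in `C ⊗̃ D`, by induction on how `a` is built
  -- from generators.
  refine hom_ext (fun (X : C.Obj × D.Obj) _ _ _ h => hrr X.1 X.2 h) (fun a => ?_) a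
  have hl : ∀ {x x' : C.Obj} {p : ℤ} (y : D.Obj) (f : C.Hom x x' p),
      (gens (Tw C D) E).Agree F G (((gens C D).left y).map f) := fun y f =>
    .of_length (hll f y) fun h c hc => hle h f y c hc
  induction a using Tw.induction with
  | zero X Y n => exact .zero
  | add a b ha hb => exact ha.add hb
  | smul r a ha => exact ha.smul r
  | idm X => exact .idm X
  | comp h a b ha hb => exact ha.comp h hb
  | d a ha => exact ha.d fun (X : C.Obj × D.Obj) _ _ _ h => hrr X.1 X.2 h
  | left y f => exact hl y f
  | right x g => exact .of_length (hrl x g) fun h c hc => hre x h g c hc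
  | eps h f g =>
    -- The hypotheses on `ε` assume non-empty chains; for the empty one `ε(f; )` is `f ⊗ id`.
    cases g with
    | nil hs =>
      subst hs
      obtain rfl := (add_zero _).symm.trans h
      rw [(gens C D).eps_nil]
      exact hl _ f
    | cons h₁ g r =>
      exact .of_length (fun z => hel h f _ z (by simp [length])) fun h' c hc =>
        hee h h' f _ c (by simp [length]) hc

end Tw
end DGCat

/-! ### Naturality and uniqueness. -/

namespace DGCat

variable {k : Type u} [CommRing k]

open Chain

namespace Chain

variable {D E : DGCat k} {φ : D.Obj → E.Obj} (F : DGFunctor D E φ) {x y z : D.Obj} {s t n : ℤ}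

theorem map_cast (e : s = t) (c : Chain D x y s) : (c.cast e).map F = (c.map F).cast e := by
  cases c <;> rfl

theorem map_append (h : s + t = n) (c : Chain D y z s) (c' : Chain D x y t) :
    (append h c c').map F = append h (c.map F) (c'.map F) := by
  induction c generalizing n with
  | nil h₀ => exact map_cast F _ _
  | cons h₁ g r ih =>
    simp only [append, map, ih]

end Chain

variable {C C' D D' E E' : DGCat k} {φ : C.Obj → C'.Obj} {ψ : D.Obj → D'.Obj} {χ : E.Obj → E'.Obj}
  (F : DGFunctor C C' φ) (G : DGFunctor D D' ψ) (H : DGFunctor E E' χ)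

theorem Chain.map_map_right (y : D.Obj) {z z' : E.Obj} {t : ℤ} (c : Chain E z z' t) :
    (c.map ((Tw.gens D E).right y)).map (Tw.map G H) =
      (c.map H).map ((Tw.gens D' E').right (ψ y)) := by
  induction c with
  | nil h => rfl
  | cons h g r ih => exact congrArg (Chain.cons h _) ih

theorem Chain.map_map_left (z : E.Obj) {y y' : D.Obj} {t : ℤ} (c : Chain D y y' t) :
    (c.map ((Tw.gens D E).left z)).map (Tw.map G H) =
      (c.map G).map ((Tw.gens D' E').left (χ z)) := by
  induction c with
  | nil h => rfl
  | cons h g r ih => exact congrArg (Chain.cons h _) ih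

/-- Cuts, concatenation and the generators `id ⊗ h` and `ε(g; …)` are all respected by dg functors,
and the signs depend only on degrees. -/
theorem Chain.brace_map {y y' : D.Obj} {z z' : E.Obj} {s t n : ℤ} (e : s + t = n)
    (g : Chain D y y' s) (c : Chain E z z' t) :
    Chain.brace e (g.map G) (c.map H) =
      (Chain.brace e g c).map fun b => (b.1, b.2.map (Tw.map G H)) := by
  induction g generalizing z' t n with
  | @nil s hs =>
    refine congrArg (fun b => [((0 : ℤ), b)]) ?_
    exact (congrArg (Chain.cast (show t = n by omega)) (map_map_right G H _ c).symm).trans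
      (map_cast _ _ _).symm
  | @cons y₁ y' q s' s h g r ih =>
    simp only [Chain.map, Chain.brace, splits_map, List.flatMap_map, List.map_flatMap, List.map_map]
    refine List.flatMap_congr fun w _ => ?_
    simp only [Split.map, splits_map, List.flatMap_map]
    refine List.flatMap_congr fun v _ => ?_
    refine (congrArg (List.map _) (ih rfl v.right)).trans ?_
    refine List.map_map.trans (List.map_congr_left fun b _ => Prod.ext rfl ?_)
    refine Eq.trans ?_ (map_append (Tw.map G H) (t := (q + v.a - 1) + (s' + v.b))
      (by have := w.h; have := v.h; omega) (w.left.map ((Tw.gens D E).right y'))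
      (.cons rfl ((Tw.gens D E).eps rfl g v.left) b.2)).symm
    exact congrArg (fun l => Chain.append _ l _) (map_map_right G H _ w.left).symm

/-- The naturality of the associativity dg functors. -/
theorem IsAssociator.naturality
    {α : DGFunctor (Tw (Tw C D) E) (Tw C (Tw D E)) (Tw.assocObj C D E)}
    {α' : DGFunctor (Tw (Tw C' D') E') (Tw C' (Tw D' E')) (Tw.assocObj C' D' E')}
    (hα : IsAssociator α) (hα' : IsAssociator α') {X Y : (Tw (Tw C D) E).Obj} {n : ℤ}
    (a : (Tw (Tw C D) E).Hom X Y n) :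
    α'.map ((Tw.map (Tw.map F G) H).map a) = (Tw.map F (Tw.map G H)).map (α.map a) := by
  refine Tw.hom_ext₂ (F := α'.comp (Tw.map (Tw.map F G) H))
    (G := (Tw.map F (Tw.map G H)).comp α) ?_ ?_ ?_ ?_ ?_ ?_ ?_ a
  · intro x x' p f y z
    refine (hα'.left_left (F.map f) (ψ y) (χ z)).trans ?_
    exact congrArg (Tw.map F (Tw.map G H)).map (hα.left_left f y z).symm
  · intro x y y' q g z
    refine (hα'.right_left (φ x) (G.map g) (χ z)).trans ?_
    exact congrArg (Tw.map F (Tw.map G H)).map (hα.right_left x g z).symm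
  · intro x y z z' r h
    refine (hα'.right_right (φ x) (ψ y) (H.map h)).trans ?_
    exact congrArg (Tw.map F (Tw.map G H)).map (hα.right_right x y h).symm
  · intro x x' y y' p s n e f g z hg
    refine (hα'.eps_left e (F.map f) (g.map G) (χ z) (by rwa [length_map])).trans ?_
    rw [← map_map_left G H]
    exact congrArg (Tw.map F (Tw.map G H)).map (hα.eps_left e f g z hg).symm
  · intro x x' z z' p t n e f y h hh
    refine (hα'.left_eps e (F.map f) (ψ y) (h.map H) (by rwa [length_map])).trans ?_
    rw [← map_map_right G H]
    exact congrArg (Tw.map F (Tw.map G H)).map (hα.left_eps e f y h hh).symm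
  · intro x y y' z z' q t n e g h hh
    refine (hα'.right_eps (φ x) e (G.map g) (h.map H) (by rwa [length_map])).trans ?_
    exact congrArg (Tw.map F (Tw.map G H)).map (hα.right_eps x e g h hh).symm
  · intro x x' y y' z z' p s ps t n e₁ e₂ f g h hg hh
    refine (hα'.eps_eps e₁ e₂ rfl (by omega) (F.map f) (g.map G) (h.map H) (by rwa [length_map])
      (by rwa [length_map])).trans ?_
    refine Eq.trans ?_
      (congrArg (Tw.map F (Tw.map G H)).map (hα.eps_eps e₁ e₂ rfl (by omega) f g h hg hh).symm)
    rw [DGFunctor.map_sum, brace_map]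
    refine congrArg List.sum (List.map_map.trans (List.map_congr_left fun b _ => ?_))
    exact ((Tw.map F (Tw.map G H)).map_units_smul b.1.negOnePow
      ((Tw.gens C (Tw D E)).eps (n := n) (by omega) f b.2)).symm

/-- The uniqueness of the associativity dg functor. -/
theorem IsAssociator.unique {α β : DGFunctor (Tw (Tw C D) E) (Tw C (Tw D E)) (Tw.assocObj C D E)}
    (hα : IsAssociator α) (hβ : IsAssociator β) : α = β := by
  ext X Y n a
  refine Tw.hom_ext₂ ?_ ?_ ?_ ?_ ?_ ?_ ?_ a
  · intros; rw [hα.left_left, hβ.left_left]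
  · intros; rw [hα.right_left, hβ.right_left]
  · intros; rw [hα.right_right, hβ.right_right]
  · intro _ _ _ _ _ _ _ e f g z hg
    rw [hα.eps_left e f g z hg, hβ.eps_left e f g z hg]
  · intro _ _ _ _ _ _ _ e f y h hh
    rw [hα.left_eps e f y h hh, hβ.left_eps e f y h hh]
  · intro x _ _ _ _ _ _ _ e g h hh
    rw [hα.right_eps x e g h hh, hβ.right_eps x e g h hh]
  · intro _ _ _ _ _ _ _ _ _ _ _ e₁ e₂ f g h hg hh
    rw [hα.eps_eps e₁ e₂ rfl (by omega) f g h hg hh, hβ.eps_eps e₁ e₂ rfl (by omega) f g h hg hh]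

end DGCat

/-- For all small dg categories `C`, `D`, `E` over a field `k` there is a unique dg functor
`α : (C ⊗̃ D) ⊗̃ E → C ⊗̃ (D ⊗̃ E)` which is the identity `((x, y), z) ↦ (x, (y, z))` on objects and
has the prescribed values on generators, and these dg functors are natural in `C`, `D` and `E`. -/
theorem theorem2p1 (k : Type u) [Field k] :
    (∀ C D E : DGCat k,
      ∃! α : DGCat.DGFunctor (DGCat.Tw (DGCat.Tw C D) E) (DGCat.Tw C (DGCat.Tw D E))
          (DGCat.Tw.assocObj C D E),
        DGCat.IsAssociator α) ∧
    (∀ (C D E C' D' E' : DGCat k)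
      (φ : C.Obj → C'.Obj) (F : DGCat.DGFunctor C C' φ)
      (ψ : D.Obj → D'.Obj) (G : DGCat.DGFunctor D D' ψ)
      (χ : E.Obj → E'.Obj) (H : DGCat.DGFunctor E E' χ)
      (α : DGCat.DGFunctor (DGCat.Tw (DGCat.Tw C D) E) (DGCat.Tw C (DGCat.Tw D E))
          (DGCat.Tw.assocObj C D E))
      (α' : DGCat.DGFunctor (DGCat.Tw (DGCat.Tw C' D') E') (DGCat.Tw C' (DGCat.Tw D' E'))
          (DGCat.Tw.assocObj C' D' E')),
      DGCat.IsAssociator α → DGCat.IsAssociator α' →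
      ∀ (X Y : (DGCat.Tw (DGCat.Tw C D) E).Obj) (n : ℤ)
        (a : (DGCat.Tw (DGCat.Tw C D) E).Hom X Y n),
        α'.map ((DGCat.Tw.map (DGCat.Tw.map F G) H).map a) =
          (DGCat.Tw.map F (DGCat.Tw.map G H)).map (α.map a)) :=
  ⟨fun C D E => ⟨DGCat.Tw.associator C D E, DGCat.Tw.isAssociator_associator C D E,
    fun _ h => h.unique (DGCat.Tw.isAssociator_associator C D E)⟩,
    fun _ _ _ _ _ _ _ F _ G _ H _ _ hα hα' _ _ _ a => hα.naturality F G H hα' a⟩
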